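/- **Setting.** Let $\mathrm{AP}$ be a finite set of atomic propositions and let $\mathcal A=(L,X,E,\mathcal I,\mathcal L)$ be a timed automaton: $L$, $X$, $E$ are finite sets of locations, clocks and edges; an edge $e$ has a source and a target in $L$, a guard and a set of reset clocks; $\mathcal I$ assigns an invariant to each location and $\mathcal L:L\to 2^{\mathrm{AP}}$ labels the locations. Guards and invariants are finite conjunctions of constraints $x\sim c$ with $x\in X$, $c\in\mathbb N$, $\sim\in\{<,\le,=,\ge,>\}$. A state is a pair $s=(\ell,v)$ with $v\in\mathbb R_{+}^X$ and $v\models\mathcal I(\ell)$. There is a transition $(\ell,v)\xrightarrow{\tau,e}(\ell',v')$ if $\tau\ge 0$, $e$ goes from $\ell$ to $\ell'$, $v+\tau'\models\mathcal I(\ell)$ for all $0\le\tau'\le\tau$, $v+\tau$ satisfies the guard of $e$, $v'$ is $v+\tau$ with the clocks in the reset set of $e$ set to $0$, and $v'\models\mathcal I(\ell')$. Let $I(s,e)$ be the set of delays $\tau$ after which $e$ can be taken from $s$, and $I(s)=\bigcup_e I(s,e)$. $\mathcal A$ is non-blocking: $I(s)\ne\emptyset$ for every state $s$. $\mathrm{Runs}(\mathcal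 A,s)$ is the set of infinite runs $s=s_0\xrightarrow{\tau_1,e_1}s_1\xrightarrow{\tau_2,e_2}\cdots$. For edges $e_1,\dots,e_n$ and $\mathcal C\subseteq\mathbb R^n$, the constrained path $\pi_{\mathcal C}(s,e_1\cdots e_n)$ consists of the finite runs from $s$ along $e_1,\dots,e_n$ whose delay vector lies in $\mathcal C$; $\mathrm{Pol}$ denotes its set of delay vectors, and $\mathrm{Cyl}$ the set of infinite runs having a prefix in it. **Probability.** For each state $s$, $\mu_s$ is a probability measure on $\mathbb R_{+}$, depending measurably on $s$, with $\mu_s(I(s))=1$; it is equivalent to Lebesgue measure restricted to $I(s)$ if $I(s)$ has positive Lebesgue measure, and otherwise equivalent to the uniform distribution on the (finite) set $I(s)$. Each edge has a weight $w(e)>0$; $p_s(e)=w(e)/\sum_{e'}w(e')$, the sum being over the edges enabled in $s$ without delay, if $e$ is one of them, and $p_s(e)=0$ otherwise. $\mathrm{Prob}$ is the unique measure on the $\sigma$-algebra on $\mathrm{Runs}(\mathcal A,s)$ generated by the cylinders $\mathrm{Cyl}(\pi_{\mathcal C}(s,e_1\cdots e_n))$, $\mathcal C$ Borel, whose values on them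 are the iterated integrals $$\mathrm{Prob}(\pi_{\mathcal C}(s,e_1\cdots e_n))=\int_{I(s,e_1)}p_{s+t}(e_1)\,\mathrm{Prob}(\pi_{\mathcal C_t}(s_t,e_2\cdots e_n))\,d\mu_s(t),$$ where $s\xrightarrow{t,e_1}s_t$, $\mathcal C_t$ is the section of $\mathcal C$ at first coordinate $t$, and the value for $n=0$ is $1$ or $0$ according to whether the empty tuple lies in $\mathcal C$. **Topology.** $\dim$ is Hausdorff dimension, which is the usual dimension on finite unions of convex sets and on their relatively open subsets. Let $\mathcal C_i$ be the projection of $\mathrm{Pol}(\pi_{\mathcal C})$ to the first $i$ coordinates ($\mathcal C_0$ is true). The path $\pi_{\mathcal C}(s,e_1\cdots e_n)$ is thin if for some $1\le i\le n$ $$\dim\mathrm{Pol}(\pi_{\mathcal C_i}(s,e_1\cdots e_i))<\dim\bigcup_{e}\mathrm{Pol}(\pi_{\mathcal C_{i-1}}(s,e_1\cdots e_{i-1}e)),$$ and thick otherwise. The topology on $\mathrm{Runs}(\mathcal A,s)$ is generated by $\emptyset$, the whole space, and the cylinders $\mathrm{Cyl}(\pi_{\mathcal C}(s,e_1\cdots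 e_n))$ with $\mathcal C$ Borel, $\pi_{\mathcal C}$ thick and $\mathrm{Pol}(\pi_{\mathcal C})$ relatively open in $\mathrm{Pol}(\pi(s,e_1\cdots e_n))$ (the path without constraint). **Thick graph and fairness.** Let $M$ be the largest constant in guards and invariants. Valuations $v,v'\in\mathbb R_{+}^X$ are region equivalent if for every clock $x$ either $v(x),v'(x)>M$, or $\lfloor v(x)\rfloor=\lfloor v'(x)\rfloor$ and $\{v(x)\}=0\Leftrightarrow\{v'(x)\}=0$; and for all $x,y$ with $v(x),v(y)\le M$, $\{v(x)\}\le\{v(y)\}\Leftrightarrow\{v'(x)\}\le\{v'(y)\}$. Its classes $[v]$ are the regions. The region automaton has as vertices the pairs (location, region); its edges are the tuples $f=((\ell,r),r'',e,(\ell',r'))$ for which some transition $(\ell,v)\xrightarrow{\tau,e}(\ell',v')$ has $v\in r$, $v+\tau\in r''$, $v'\in r'$. For $v\in r$, let $I((\ell,v),f)=\{\tau\in I((\ell,v),e): v+\tau\in r''\}$. The edge $f$ is thin if $\dim I((\ell,v),f)<\dim\bigcup_{f'}I((\ell,v),f')$ for some (equivalently, every) $v\in r$, where $f'$ ranges over the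 edges with the same source vertex, and thick otherwise. The thick graph is obtained by deleting the thin edges. Every run of $\mathcal A$ induces an infinite path in the region automaton; the run is fair if every thick edge whose source vertex is visited infinitely often by this path is taken infinitely often by it. **Statement.** Let $s=(\ell,v)$ be a state of $\mathcal A$ and let $P\subseteq(2^{\mathrm{AP}})^\omega$ be a prefix-independent untimed property, i.e. whether $w\in P$ depends only on the set of letters of $2^{\mathrm{AP}}$ that occur infinitely often in $w$. Assume that the set of fair runs from $s$ has probability $1$. Then the following are equivalent: 1. $\mathcal A$ almost-surely satisfies $P$ from $s$: the set of runs from $s$ whose label word $\mathcal L(\ell_0)\mathcal L(\ell_1)\cdots$ lies in $P$ is measurable and has probability $1$; 2. $\mathcal A$ largely satisfies $P$ from $s$: the complement of that set is meagre in $\mathrm{Runs}(\mathcal A,s)$; 3. condition $\mathcal S$: every bottom strongly connected component $C$ of the thick graph that is reachable in the thick graph from $(\ell,[v])$ satisfies $P$, i.e. every infinite path of the thick graph that visits all vertices of $C$ infinitely often has its label word in $P$. -/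

import Mathlib

open MeasureTheory ProbabilityTheory Filter Topology
open scoped ENNReal

namespace TimedAut

/-! ## Timed automata -/

/-- The five comparison symbols allowed in clock constraints. -/
inductive Cmp where
  | lt | le | eq | ge | gt

/-- The meaning of a comparison symbol on real numbers. -/
def Cmp.Holds : Cmp → ℝ → ℝ → Prop
  | .lt, a, b => a < b
  | .le, a, b => a ≤ b
  | .eq, a, b => a = b
  | .ge, a, b => a ≥ b
  | .gt, a, b => a > b

/-- An atomic clock constraint: clock, comparison symbol, natural number. -/
structure Atom (X : Type*) where
  clock : X
  cmp : Cmp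
  bound : ℕ

/-- A guard is a finite conjunction of atomic clock constraints. -/
abbrev Guard (X : Type*) := List (Atom X)

/-- The valuation `v` satisfies the guard `g`. -/
def Guard.Sat {X : Type*} (g : Guard X) (v : X → ℝ) : Prop :=
  ∀ a ∈ g, a.cmp.Holds (v a.clock) (a.bound : ℝ)

/-- Time elapse: all clocks grow by `τ`. -/
def shift {X : Type*} (v : X → ℝ) (τ : ℝ) : X → ℝ := fun x => v x + τ

open Classical in
/-- Reset to zero of the clocks in `Y`. -/
noncomputable def resetClocks {X : Type*} (Y : Set X) (v : X → ℝ) : X → ℝ :=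
  fun x => if x ∈ Y then 0 else v x

/-- Timed automaton with atomic propositions `AP`, locations `L`, clocks `X` and edges named
by `E`; all four types are finite in the results. -/
structure TimedAutomaton (AP L X E : Type*) where
  source : E → L
  guard : E → Guard X
  reset : E → Set X
  target : E → L
  inv : L → Guard X
  label : L → Set AP

section TA

variable {AP L X E : Type*} (A : TimedAutomaton AP L X E)

/-- A pair `(ℓ, v)` is a state if `v` is a nonnegative valuation satisfying the invariant
of `ℓ`. -/
def TimedAutomaton.IsState (s : L × (X → ℝ)) : Prop :=
  (∀ x, 0 ≤ s.2 x) ∧ (A.inv s.1).Sat s.2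

/-- The configuration reached from `s` after delay `τ` and then taking the edge `e`. -/
noncomputable def TimedAutomaton.post (s : L × (X → ℝ)) (τ : ℝ) (e : E) : L × (X → ℝ) :=
  (A.target e, resetClocks (A.reset e) (shift s.2 τ))

/-- The timed transition from `s` to `s'` with delay `τ` and edge `e`. -/
def TimedAutomaton.Step (s : L × (X → ℝ)) (τ : ℝ) (e : E) (s' : L × (X → ℝ)) : Prop :=
  A.IsState s ∧ A.source e = s.1 ∧ 0 ≤ τ ∧
    (∀ τ' ∈ Set.Icc 0 τ, (A.inv s.1).Sat (shift s.2 τ')) ∧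
    (A.guard e).Sat (shift s.2 τ) ∧ s' = A.post s τ e ∧ A.IsState s'

/-- `I(s, e)`: the delays after which the edge `e` can be taken from `s`. -/
def TimedAutomaton.edgeDelays (s : L × (X → ℝ)) (e : E) : Set ℝ :=
  {τ | ∃ s', A.Step s τ e s'}

/-- `I(s)`: the delays after which some edge can be taken from `s`. -/
def TimedAutomaton.delays (s : L × (X → ℝ)) : Set ℝ := ⋃ e, A.edgeDelays s e

/-- Every state has an outgoing timed transition. -/
def TimedAutomaton.NonBlocking : Prop := ∀ s, A.IsState s → (A.delays s).Nonempty

/-- The infinite runs from `s`. -/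
structure TimedAutomaton.Run (s : L × (X → ℝ)) where
  state : ℕ → L × (X → ℝ)
  delay : ℕ → ℝ
  edge : ℕ → E
  start : state 0 = s
  step : ∀ i, A.Step (state i) (delay i) (edge i) (state (i + 1))

/-- The cylinder of the symbolic path from `s` with edges `e 0, …, e (n-1)` whose delays are
constrained by `C`. -/
def TimedAutomaton.cyl (s : L × (X → ℝ)) {n : ℕ} (e : Fin n → E) (C : Set (Fin n → ℝ)) :
    Set (A.Run s) :=
  {ρ | (∀ i : Fin n, ρ.edge i = e i) ∧ (fun i : Fin n => ρ.delay i) ∈ C}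

/-- The σ-algebra generated by the cylinders with Borel constraints. -/
instance (s : L × (X → ℝ)) : MeasurableSpace (A.Run s) :=
  MeasurableSpace.generateFrom
    {S | ∃ (n : ℕ) (e : Fin n → E) (C : Set (Fin n → ℝ)), MeasurableSet C ∧ S = A.cyl s e C}

/-! ## Properties -/

/-- The word over sets of atomic propositions read along a run. -/
def TimedAutomaton.word {s : L × (X → ℝ)} (ρ : A.Run s) : ℕ → Set AP :=
  fun i => A.label (ρ.state i).1

/-- The runs from `s` that satisfy the untimed property `P`. -/
def TimedAutomaton.sem (s : L × (X → ℝ)) (P : Set (ℕ → Set AP)) : Set (A.Run s) :=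
  {ρ | A.word ρ ∈ P}

/-- The letters that occur infinitely often in a word. -/
def infLetters (w : ℕ → Set AP) : Set (Set AP) := {a | ∃ᶠ i in atTop, w i = a}

/-- Prefix-independent properties: membership of a word depends only on the set of letters
that it contains infinitely often. -/
def PrefixIndependent (P : Set (ℕ → Set AP)) : Prop :=
  ∀ w w' : ℕ → Set AP, infLetters w = infLetters w' → (w ∈ P ↔ w' ∈ P)

/-! ## Topology on runs -/

/-- The polyhedron of a constrained symbolic path. -/
def TimedAutomaton.pol (s : L × (X → ℝ)) {n : ℕ} (e : Fin n → E) (C : Set (Fin n → ℝ)) :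
    Set (Fin n → ℝ) :=
  {τ | τ ∈ C ∧ ∃ σ : Fin (n + 1) → L × (X → ℝ), σ 0 = s ∧
    ∀ i : Fin n, A.Step (σ i.castSucc) (τ i) (e i) (σ i.succ)}

/-- The constraint induced on the first `i` delays by projecting the polyhedron of a
constrained path; for `i = 0` it is true. -/
def TimedAutomaton.proj (s : L × (X → ℝ)) {n : ℕ} (e : Fin n → E) (C : Set (Fin n → ℝ))
    (i : ℕ) (hi : i ≤ n) : Set (Fin i → ℝ) :=
  {τ | i = 0 ∨ ∃ τ' ∈ A.pol s e C, ∀ j : Fin i, τ j = τ' (j.castLE hi)}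

/-- Thin constrained paths: at some (zero-based) index `i`, the polyhedron of the path up to and
including its edge number `i` has smaller dimension than the union, over all edges `e'`, of the
polyhedra obtained when that edge is replaced by `e'` and its delay is left unconstrained. -/
def TimedAutomaton.IsThinPath (s : L × (X → ℝ)) {n : ℕ} (e : Fin n → E)
    (C : Set (Fin n → ℝ)) : Prop :=
  ∃ i : Fin n,
    dimH (A.pol s (fun j : Fin (i + 1) => e (j.castLE i.isLt)) (A.proj s e C (i + 1) i.isLt)) <
    dimH (⋃ e' : E, A.pol s
      (Fin.snoc (α := fun _ => E) (fun j : Fin i => e (j.castLE i.isLt.le)) e')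
      {τ : Fin (i + 1) → ℝ | (fun j : Fin i => τ j.castSucc) ∈ A.proj s e C i i.isLt.le})

/-- The basic open sets: the whole space, the empty set, and the cylinders of thick paths with
Borel constraint whose polyhedron is open in the polyhedron of the unconstrained path. -/
def TimedAutomaton.basicOpens (s : L × (X → ℝ)) : Set (Set (A.Run s)) :=
  {Set.univ, ∅} ∪
  {S | ∃ (n : ℕ) (e : Fin n → E) (C : Set (Fin n → ℝ)), S = A.cyl s e C ∧
    ¬ A.IsThinPath s e C ∧ MeasurableSet C ∧
    ∃ O : Set (Fin n → ℝ), IsOpen O ∧ A.pol s e C = O ∩ A.pol s e Set.univ}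

instance (s : L × (X → ℝ)) : TopologicalSpace (A.Run s) :=
  TopologicalSpace.generateFrom (A.basicOpens s)

/-- Large satisfaction: the complement of the set of runs satisfying `P` is meagre. -/
def TimedAutomaton.LargelySat (s : L × (X → ℝ)) (P : Set (ℕ → Set AP)) : Prop :=
  IsMeagre (A.sem s P)ᶜ

/-! ## Regions, the thick graph, fairness -/

/-- The largest constant in guards and invariants (`0` if there is none). -/
noncomputable def TimedAutomaton.maxConst : ℕ :=
  sSup {c | (∃ e, ∃ a ∈ A.guard e, a.bound = c) ∨ (∃ ℓ, ∃ a ∈ A.inv ℓ, a.bound = c)}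

/-- Region equivalence of valuations. -/
def TimedAutomaton.RegionEquiv (v v' : X → ℝ) : Prop :=
  (∀ x, ((A.maxConst : ℝ) < v x ∧ (A.maxConst : ℝ) < v' x) ∨
    (⌊v x⌋ = ⌊v' x⌋ ∧ (Int.fract (v x) = 0 ↔ Int.fract (v' x) = 0))) ∧
  (∀ x y, v x ≤ A.maxConst → v y ≤ A.maxConst →
    (Int.fract (v x) ≤ Int.fract (v y) ↔ Int.fract (v' x) ≤ Int.fract (v' y)))

/-- The region `[v]` of the valuation `v`. -/
def TimedAutomaton.regionOf (v : X → ℝ) : Set (X → ℝ) :=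
  {v' | (∀ x, 0 ≤ v' x) ∧ A.RegionEquiv v v'}

/-- The set of all regions. -/
def TimedAutomaton.regions : Set (Set (X → ℝ)) :=
  {r | ∃ v : X → ℝ, (∀ x, 0 ≤ v x) ∧ r = A.regionOf v}

/-- The vertex `(ℓ, [v])` of the region automaton that belongs to `(ℓ, v)`. -/
def TimedAutomaton.vertexOf (s : L × (X → ℝ)) : L × Set (X → ℝ) := (s.1, A.regionOf s.2)

/-- Data of an edge of the timed region automaton: source vertex, the region `mid` whose guard
labels the edge, the underlying edge, target vertex. -/
@[ext] structure REdge (L X E : Type*) where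
  src : L × Set (X → ℝ)
  mid : Set (X → ℝ)
  edge : E
  tgt : L × Set (X → ℝ)

/-- The edges of the timed region automaton. -/
def TimedAutomaton.IsREdge (f : REdge L X E) : Prop :=
  f.src.2 ∈ A.regions ∧ f.mid ∈ A.regions ∧ f.tgt.2 ∈ A.regions ∧
  ∃ v ∈ f.src.2, ∃ τ : ℝ, ∃ v' ∈ f.tgt.2,
    A.Step (f.src.1, v) τ f.edge (f.tgt.1, v') ∧ shift v τ ∈ f.mid

/-- `I(s, f)` in the region automaton, for `s = (ℓ, v)` with `v` in the source region of `f`. -/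
def TimedAutomaton.redgeDelays (v : X → ℝ) (f : REdge L X E) : Set ℝ :=
  {τ | shift v τ ∈ f.mid ∧ ∃ s', A.Step (f.src.1, v) τ f.edge s'}

/-- Thick edges of the region automaton: those edges `f` for which no `v` in the source region
has `dim I(s, f) < dim I(s)`, where `I(s)` is the union of the `I(s, f')` over the edges `f'`
with the same source vertex. -/
def TimedAutomaton.IsThickEdge (f : REdge L X E) : Prop :=
  A.IsREdge f ∧ ¬ ∃ v ∈ f.src.2,
    dimH (A.redgeDelays v f) <
      dimH (⋃ f' ∈ {f' : REdge L X E | A.IsREdge f' ∧ f'.src = f.src}, A.redgeDelays v f')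

/-- Reachability in the thick graph, that is, along thick edges of the region automaton. -/
def TimedAutomaton.Reach : L × Set (X → ℝ) → L × Set (X → ℝ) → Prop :=
  Relation.ReflTransGen (fun q q' => ∃ f, A.IsThickEdge f ∧ f.src = q ∧ f.tgt = q')

/-- Bottom strongly connected components of the thick graph: nonempty sets of vertices such that
the vertices reachable from any member are exactly the members. -/
def TimedAutomaton.IsBSCC (C : Set (L × Set (X → ℝ))) : Prop :=
  C.Nonempty ∧ ∀ q ∈ C, ∀ q', A.Reach q q' ↔ q' ∈ C

/-- `C` satisfies `P`: every infinite path of the thick graph that visits every vertex in `C`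
infinitely often satisfies `P`. -/
def TimedAutomaton.BSCCSat (C : Set (L × Set (X → ℝ))) (P : Set (ℕ → Set AP)) : Prop :=
  ∀ f : ℕ → REdge L X E, (∀ i, A.IsThickEdge (f i) ∧ (f i).tgt = (f (i + 1)).src) →
    (∀ q ∈ C, ∃ᶠ i in atTop, (f i).src = q) → (fun i => A.label (f i).src.1) ∈ P

/-- All bottom strongly connected components of the thick graph that are reachable from `[s]`
satisfy `P`. -/
def TimedAutomaton.CondS (s : L × (X → ℝ)) (P : Set (ℕ → Set AP)) : Prop :=
  ∀ C, A.IsBSCC C → (∃ q ∈ C, A.Reach (A.vertexOf s) q) → A.BSCCSat C P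

/-- The region edge taken in the transition number `i` of the run `ρ`. -/
def TimedAutomaton.redgeOf {s : L × (X → ℝ)} (ρ : A.Run s) (i : ℕ) : REdge L X E where
  src := A.vertexOf (ρ.state i)
  mid := A.regionOf (shift (ρ.state i).2 (ρ.delay i))
  edge := ρ.edge i
  tgt := A.vertexOf (ρ.state (i + 1))

/-- Fair runs: along the image of the run in the region automaton, every thick edge that is
enabled infinitely often is taken infinitely often. -/
def TimedAutomaton.Fair {s : L × (X → ℝ)} (ρ : A.Run s) : Prop :=
  ∀ f, A.IsThickEdge f → (∃ᶠ i in atTop, A.vertexOf (ρ.state i) = f.src) →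
    ∃ᶠ i in atTop, A.redgeOf ρ i = f

end TA

/-! ## Stochastic timed automata -/

open Classical in
/-- The probability `p_s(e)` of an edge at the configuration `s`, given by weights on the edges
that are enabled in `s` without delay. -/
noncomputable def TimedAutomaton.edgeProb {AP L X E : Type*} [Fintype E]
    (A : TimedAutomaton AP L X E) (w : E → ℝ) (s : L × (X → ℝ)) (e : E) : ℝ :=
  if 0 ∈ A.edgeDelays s e then
    w e / ∑ e' ∈ Finset.univ.filter (fun e' => 0 ∈ A.edgeDelays s e'), w e'
  else 0

/-- Non-blocking timed automaton with distributions over delays and weights on edges. The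
distribution over delays at `(ℓ, v)` is `delay ℓ v`, and it depends measurably on `v`; the values
at pairs that are not states play no role. -/
structure StochasticTA (AP L X E : Type*) [Fintype E] extends TimedAutomaton AP L X E where
  nonblocking : toTimedAutomaton.NonBlocking
  delay : L → Kernel (X → ℝ) ℝ
  isMarkov : ∀ ℓ, IsMarkovKernel (delay ℓ)
  full : ∀ s, toTimedAutomaton.IsState s →
    delay s.1 s.2 (toTimedAutomaton.delays s) = 1
  equiv_volume : ∀ s, toTimedAutomaton.IsState s →
    0 < volume (toTimedAutomaton.delays s) →
      delay s.1 s.2 ≪ volume.restrict (toTimedAutomaton.delays s) ∧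
      volume.restrict (toTimedAutomaton.delays s) ≪ delay s.1 s.2
  equiv_uniform : ∀ s, toTimedAutomaton.IsState s →
    volume (toTimedAutomaton.delays s) = 0 →
      delay s.1 s.2 ≪ uniformOn (toTimedAutomaton.delays s) ∧
      uniformOn (toTimedAutomaton.delays s) ≪ delay s.1 s.2
  weight : E → ℝ
  weight_pos : ∀ e, 0 < weight e

section STA

variable {AP L X E : Type*} [Fintype E] (A : StochasticTA AP L X E)

/-- The probability of the constrained symbolic path from `s` with edges `e 0, …, e (n-1)` and
constraint `C` on the delays, as an iterated integral. -/
noncomputable def StochasticTA.pathProb :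
    (n : ℕ) → (L × (X → ℝ)) → (Fin n → E) → Set (Fin n → ℝ) → ℝ≥0∞
  | 0, _, _, C => C.indicator 1 Fin.elim0
  | n + 1, s, e, C =>
      ∫⁻ t in A.edgeDelays s (e 0),
        ENNReal.ofReal (A.edgeProb A.weight (s.1, shift s.2 t) (e 0)) *
          StochasticTA.pathProb n (A.post s t (e 0)) (fun i => e i.succ)
            {τ | (Fin.cons t τ : Fin (n + 1) → ℝ) ∈ C}
        ∂(A.delay s.1 s.2)

end STA

/-! ### Auxiliary facts: the cylinder probabilities extend to a unique measure on runs -/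

section Construction

set_option linter.unusedSectionVars false

open unitInterval

variable {AP L X E : Type*}

theorem Guard.sat_between {g : Guard X} {v : X → ℝ} {t t' : ℝ} (h0 : g.Sat v)
    (h1 : g.Sat (shift v t)) (h : t' ∈ Set.Icc 0 t) : g.Sat (shift v t') := by
  intro a ha
  have h0 := h0 a ha
  have h1 := h1 a ha
  obtain ⟨h2, h3⟩ := h
  cases hc : a.cmp <;> simp only [hc, Cmp.Holds, shift] at * <;> linarith

theorem shift_zero (v : X → ℝ) : shift v 0 = v := by
  funext x; simp [shift]

theorem shift_shift (v : X → ℝ) (t u : ℝ) : shift (shift v t) u = shift v (t + u) := by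
  funext x; simp [shift, add_assoc]

theorem TimedAutomaton.mem_edgeDelays (A : TimedAutomaton AP L X E) (s : L × (X → ℝ)) (e : E)
    (t : ℝ) : t ∈ A.edgeDelays s e ↔ (∀ x, 0 ≤ s.2 x) ∧ (A.inv s.1).Sat s.2 ∧ A.source e = s.1 ∧
      0 ≤ t ∧ (A.inv s.1).Sat (shift s.2 t) ∧ (A.guard e).Sat (shift s.2 t) ∧
      (A.inv (A.target e)).Sat (A.post s t e).2 := by
  constructor
  · rintro ⟨s', h1, h2, h3, h4, h5, rfl, h7⟩
    exact ⟨h1.1, h1.2, h2, h3, h4 t ⟨h3, le_rfl⟩, h5, h7.2⟩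
  · rintro ⟨h1, h2, h3, h4, h5, h6, h7⟩
    refine ⟨A.post s t e, ⟨h1, h2⟩, h3, h4, fun t' ht' => Guard.sat_between h2 h5 ht', h6, rfl, ?_, h7⟩
    intro x
    simp only [TimedAutomaton.post, resetClocks, shift]
    split_ifs
    · exact le_rfl
    · exact add_nonneg (h1 x) h4

theorem TimedAutomaton.step_post {A : TimedAutomaton AP L X E} {s : L × (X → ℝ)} {e : E}
    {t : ℝ} (h : t ∈ A.edgeDelays s e) : A.Step s t e (A.post s t e) := by
  obtain ⟨s', h⟩ := h
  have := h.2.2.2.2.2.1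
  rwa [this] at h

theorem TimedAutomaton.zero_mem_edgeDelays (A : TimedAutomaton AP L X E) {s : L × (X → ℝ)}
    {t : ℝ} (ht : t ∈ A.delays s) (e : E) :
    0 ∈ A.edgeDelays (s.1, shift s.2 t) e ↔ t ∈ A.edgeDelays s e := by
  obtain ⟨e', he'⟩ := Set.mem_iUnion.1 ht
  rw [mem_edgeDelays] at he' ⊢
  rw [mem_edgeDelays]
  obtain ⟨h1, h2, -, h4, h5, -, -⟩ := he'
  have : A.post (s.1, shift s.2 t) 0 e = A.post s t e := by
    simp [TimedAutomaton.post, shift_zero]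
  rw [this]
  simp only [shift_zero]
  have : ∀ x, 0 ≤ shift s.2 t x := fun x => add_nonneg (h1 x) h4
  tauto

theorem Guard.measurableSet_sat (g : Guard X) : MeasurableSet {v : X → ℝ | g.Sat v} := by
  have : {v : X → ℝ | g.Sat v} =
      ⋂ a ∈ {a | a ∈ g}, {v : X → ℝ | a.cmp.Holds (v a.clock) (a.bound : ℝ)} := by
    ext v; simp [Guard.Sat]
  rw [this]
  refine MeasurableSet.biInter (List.finite_toSet g).countable fun a _ => ?_
  have hm : Measurable fun v : X → ℝ => v a.clock := measurable_pi_apply _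
  cases hc : a.cmp <;> simp only [Cmp.Holds]
  · exact measurableSet_lt hm measurable_const
  · exact measurableSet_le hm measurable_const
  · exact measurableSet_eq_fun hm measurable_const
  · exact measurableSet_le measurable_const hm
  · exact measurableSet_lt measurable_const hm

variable [MeasurableSpace L] [DiscreteMeasurableSpace L] [MeasurableSpace E]
  [DiscreteMeasurableSpace E]

section Meas

variable {α : Type*} [MeasurableSpace α] [Finite L] [Finite X] [Finite E]

theorem measurableSet_sat_family {J : Type*} [Finite J] [MeasurableSpace J]
    [DiscreteMeasurableSpace J] (g : J → Guard X) {j : α → J} {v : α → X → ℝ}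
    (hj : Measurable j) (hv : Measurable v) : MeasurableSet {a | (g (j a)).Sat (v a)} := by
  have : {a | (g (j a)).Sat (v a)} = ⋃ i, (j ⁻¹' {i} ∩ v ⁻¹' {v | (g i).Sat v}) := by
    ext a; simp
  rw [this]
  exact MeasurableSet.iUnion fun i =>
    (hj (MeasurableSet.of_discrete)).inter (hv (Guard.measurableSet_sat _))

theorem measurable_shift {v : α → X → ℝ} {t : α → ℝ} (hv : Measurable v) (ht : Measurable t) :
    Measurable fun a => shift (v a) (t a) := by
  unfold shift
  fun_prop

theorem TimedAutomaton.measurable_post (A : TimedAutomaton AP L X E) {s : α → L × (X → ℝ)}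
    {t : α → ℝ} {e : α → E} (hs : Measurable s) (ht : Measurable t) (he : Measurable e) :
    Measurable fun a => A.post (s a) (t a) (e a) := by
  refine Measurable.prodMk ((Measurable.of_discrete (f := A.target)).comp he) ?_
  refine measurable_pi_lambda _ fun x => ?_
  unfold resetClocks
  refine Measurable.ite ?_ measurable_const ?_
  · exact he (MeasurableSet.of_discrete (s := {e | x ∈ A.reset e}))
  · exact (measurable_pi_apply x).comp (measurable_shift (measurable_snd.comp hs) ht)

theorem TimedAutomaton.measurableSet_edgeDelays (A : TimedAutomaton AP L X E)
    {s : α → L × (X → ℝ)} {t : α → ℝ} {e : α → E} (hs : Measurable s) (ht : Measurable t)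
    (he : Measurable e) : MeasurableSet {a | t a ∈ A.edgeDelays (s a) (e a)} := by
  simp only [mem_edgeDelays]
  have h1 : Measurable fun a => (s a).1 := measurable_fst.comp hs
  have h2 : Measurable fun a => (s a).2 := measurable_snd.comp hs
  refine MeasurableSet.inter ?_ (MeasurableSet.inter ?_ (MeasurableSet.inter ?_
    (MeasurableSet.inter ?_ (MeasurableSet.inter ?_ (MeasurableSet.inter ?_ ?_)))))
  · show MeasurableSet {a | ∀ x, 0 ≤ (s a).2 x}
    rw [Set.ofPred_forall]
    exact MeasurableSet.iInter fun x =>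
      measurableSet_le measurable_const ((measurable_pi_apply x).comp h2)
  · exact measurableSet_sat_family A.inv h1 h2
  · exact measurableSet_eq_fun ((Measurable.of_discrete (f := A.source)).comp he) h1
  · exact measurableSet_le measurable_const ht
  · exact measurableSet_sat_family A.inv h1 (measurable_shift h2 ht)
  · exact measurableSet_sat_family A.guard he (measurable_shift h2 ht)
  · exact measurableSet_sat_family (fun e => A.inv (A.target e)) he
      (measurable_snd.comp (A.measurable_post hs ht he))

theorem TimedAutomaton.measurableSet_delays (A : TimedAutomaton AP L X E)
    {s : α → L × (X → ℝ)} {t : α → ℝ} (hs : Measurable s) (ht : Measurable t) :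
    MeasurableSet {a | t a ∈ A.delays (s a)} := by
  have : {a | t a ∈ A.delays (s a)} = ⋃ e, {a | t a ∈ A.edgeDelays (s a) e} := by
    ext a; simp [TimedAutomaton.delays]
  rw [this]
  exact MeasurableSet.iUnion fun e => A.measurableSet_edgeDelays hs ht measurable_const

end Meas

variable [Finite L] [Finite X] [Fintype E]

theorem TimedAutomaton.measurable_edgeProb {α : Type*} [MeasurableSpace α]
    (A : TimedAutomaton AP L X E) (w : E → ℝ) {s : α → L × (X → ℝ)} (e : E)
    (hs : Measurable s) : Measurable fun a => A.edgeProb w (s a) e := by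
  classical
  unfold edgeProb
  simp only [Finset.sum_filter]
  have h : ∀ e', MeasurableSet {a | 0 ∈ A.edgeDelays (s a) e'} := fun e' =>
    A.measurableSet_edgeDelays hs measurable_const measurable_const
  refine Measurable.ite (h e) ?_ measurable_const
  refine measurable_const.div (Finset.measurable_sum _ fun e' _ => ?_)
  exact Measurable.ite (h e') measurable_const measurable_const

theorem TimedAutomaton.edgeProb_nonneg (A : TimedAutomaton AP L X E) {w : E → ℝ}
    (hw : ∀ e, 0 < w e) (s : L × (X → ℝ)) (e : E) : 0 ≤ A.edgeProb w s e := by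
  unfold edgeProb
  split_ifs
  · exact div_nonneg (hw e).le (Finset.sum_nonneg fun e _ => (hw e).le)
  · exact le_rfl

theorem TimedAutomaton.sum_edgeProb (A : TimedAutomaton AP L X E) {w : E → ℝ}
    (hw : ∀ e, 0 < w e) {s : L × (X → ℝ)} (h : ∃ e, 0 ∈ A.edgeDelays s e) :
    ∑ e, A.edgeProb w s e = 1 := by
  classical
  unfold edgeProb
  obtain ⟨e, he⟩ := h
  rw [← Finset.sum_filter, ← Finset.sum_div]
  refine div_self (ne_of_gt (Finset.sum_pos (fun e _ => hw e) ⟨e, ?_⟩))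
  simpa using he

variable (A : StochasticTA AP L X E)

/-- A Markov kernel choosing a delay and then an edge. -/
theorem StochasticTA.exists_kernel [Nonempty E] :
    ∃ K : Kernel (L × (X → ℝ)) (ℝ × E), IsMarkovKernel K ∧
      ∀ s,
        (∀ e, ∀ h : ℝ → ℝ≥0∞, Measurable h →
          ∫⁻ z in {z | z.1 ∈ A.edgeDelays s z.2 ∧ z.2 = e}, h z.1 ∂(K s) =
          ∫⁻ t in A.edgeDelays s e,
            ENNReal.ofReal (A.edgeProb A.weight (s.1, shift s.2 t) e) * h t ∂(A.delay s.1 s.2)) ∧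
        (A.IsState s → ∀ᵐ z ∂(K s), z.1 ∈ A.edgeDelays s z.2) := by
  classical
  obtain ⟨e0⟩ := ‹Nonempty E›
  have := A.isMarkov
  let μ : Kernel (L × (X → ℝ)) ℝ :=
    ⟨fun s => A.delay s.1 s.2, measurable_from_prod_countable_right fun ℓ => (A.delay ℓ).measurable⟩
  have hμ : IsMarkovKernel μ := ⟨fun s => (A.isMarkov s.1).isProbabilityMeasure s.2⟩
  let g : (L × (X → ℝ)) × ℝ → E → ℝ≥0∞ := fun p e =>
    if p.2 ∈ A.delays p.1 then ENNReal.ofReal (A.edgeProb A.weight (p.1.1, shift p.1.2 p.2) e)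
    else if e = e0 then 1 else 0
  have hg1 : ∀ e, Measurable fun p => g p e := by
    intro e
    refine Measurable.ite (A.measurableSet_delays measurable_fst measurable_snd) ?_
      measurable_const
    refine (A.measurable_edgeProb A.weight e ?_).ennreal_ofReal
    exact (measurable_fst.comp measurable_fst).prodMk
      (measurable_shift (measurable_snd.comp measurable_fst) measurable_snd)
  have hg : Measurable (Function.uncurry g) := measurable_from_prod_countable_left hg1
  let η : Kernel ((L × (X → ℝ)) × ℝ) E :=
    Kernel.withDensity (Kernel.const _ (Measure.count : Measure E)) g
  have hηl : ∀ p, ∀ h : E → ℝ≥0∞, ∫⁻ e, h e ∂(η p) = ∑ e, g p e * h e := by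
    intro p h
    rw [Kernel.lintegral_withDensity _ hg _ Measurable.of_discrete, Kernel.const_apply,
      lintegral_count, tsum_fintype]
  have hpos := A.weight_pos
  have hex : ∀ p : (L × (X → ℝ)) × ℝ, p.2 ∈ A.delays p.1 →
      ∃ e, 0 ∈ A.edgeDelays (p.1.1, shift p.1.2 p.2) e := by
    intro p hp
    obtain ⟨e, he⟩ := Set.mem_iUnion.1 hp
    exact ⟨e, (A.zero_mem_edgeDelays hp e).2 he⟩
  have hη : IsMarkovKernel η := by
    refine ⟨fun p => ⟨?_⟩⟩
    rw [← lintegral_one, hηl]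
    simp only [mul_one, g]
    split_ifs with h
    · rw [← ENNReal.ofReal_sum_of_nonneg fun e _ => A.edgeProb_nonneg hpos _ e,
        A.sum_edgeProb hpos (hex p h), ENNReal.ofReal_one]
    · simp
  have hK : ∀ s, ∀ h : ℝ × E → ℝ≥0∞, Measurable h →
      ∫⁻ z, h z ∂((μ ⊗ₖ η) s) = ∫⁻ t, ∑ e, g (s, t) e * h (t, e) ∂(A.delay s.1 s.2) := by
    intro s h hh
    rw [Kernel.lintegral_compProd _ _ _ hh]
    exact lintegral_congr fun t => hηl _ _
  have hms : ∀ s, MeasurableSet {z : ℝ × E | z.1 ∈ A.edgeDelays s z.2} := fun s =>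
    A.measurableSet_edgeDelays measurable_const measurable_fst measurable_snd
  refine ⟨μ ⊗ₖ η, inferInstance, fun s => ⟨fun e h hh => ?_, fun hs => ?_⟩⟩
  · have hme : MeasurableSet {z : ℝ × E | z.1 ∈ A.edgeDelays s z.2 ∧ z.2 = e} :=
      (hms s).inter (measurable_snd (MeasurableSet.of_discrete (s := {e})))
    rw [← lintegral_indicator hme, hK _ _ ((show Measurable fun z : ℝ × E => h z.1 from
        hh.comp measurable_fst).indicator hme),
      ← lintegral_indicator (show MeasurableSet (A.edgeDelays s e) from
        A.measurableSet_edgeDelays measurable_const measurable_id measurable_const)]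
    refine lintegral_congr fun t => ?_
    rw [Finset.sum_eq_single e]
    · by_cases ht : t ∈ A.edgeDelays s e
      · rw [Set.indicator_of_mem (by exact ⟨ht, rfl⟩), Set.indicator_of_mem ht]
        have : t ∈ A.delays s := Set.mem_iUnion.2 ⟨e, ht⟩
        simp [g, this]
      · rw [Set.indicator_of_notMem (by rintro ⟨h1, -⟩; exact ht h1),
          Set.indicator_of_notMem ht, mul_zero]
    · intro e' _ he'
      rw [Set.indicator_of_notMem (by rintro ⟨-, h1⟩; exact he' h1), mul_zero]
    · simp
  · show ((μ ⊗ₖ η) s) {z : ℝ × E | z.1 ∈ A.edgeDelays s z.2}ᶜ = 0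
    rw [← lintegral_indicator_one (hms s).compl,
      hK _ _ (measurable_one.indicator (hms s).compl)]
    have hd : ∀ᵐ t ∂(A.delay s.1 s.2), t ∈ A.delays s := by
      have hm : MeasurableSet (A.delays s) := A.measurableSet_delays measurable_const measurable_id
      exact (prob_compl_eq_zero_iff hm).2 (A.full s hs)
    rw [lintegral_eq_zero_iff' ?_]
    · filter_upwards [hd] with t ht
      simp only [Pi.zero_apply, Finset.sum_eq_zero_iff, Finset.mem_univ, true_implies]
      intro e
      by_cases hte : t ∈ A.edgeDelays s e
      · rw [Set.indicator_of_notMem (by simpa using hte), mul_zero]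
      · have h0 : 0 ∉ A.edgeDelays (s.1, shift s.2 t) e := by
          rwa [A.zero_mem_edgeDelays ht]
        simp [g, ht, TimedAutomaton.edgeProb, h0]
    · refine (Finset.measurable_sum _ fun e _ => ?_).aemeasurable
      refine ((hg1 e).comp (measurable_const.prodMk measurable_id)).mul ?_
      exact (measurable_one.indicator (hms s).compl).comp (measurable_id.prodMk measurable_const)

/-- Prepend a term to a sequence. -/
def consSeq (p : I × (ℕ → I)) : ℕ → I
  | 0 => p.1
  | n + 1 => p.2 n

theorem measurable_consSeq : Measurable consSeq := by
  refine measurable_pi_lambda _ fun n => ?_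
  cases n
  · exact measurable_fst
  · exact (measurable_pi_apply _).comp measurable_snd

/-- The law of a sequence of independent uniform variables. -/
theorem infinitePi_cons (P : Measure (ℕ → I))
    (hP : P = Measure.infinitePi fun _ => (volume : Measure I)) :
    (volume.prod P).map consSeq = P := by
  have hm := measurable_consSeq
  subst hP
  refine Measure.eq_infinitePi _ fun s t ht => ?_
  rw [Measure.map_apply hm (MeasurableSet.pi s.countable_toSet fun i hi => ht i)]
  have hpre : consSeq ⁻¹'
      (Set.pi s t) = {u | 0 ∈ s → u ∈ t 0} ×ˢ
        Set.pi (s.preimage Nat.succ (Nat.succ_injective.injOn)) (fun i => t (i + 1)) := by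
    ext ⟨u, ω⟩
    simp only [Set.mem_preimage, Set.mem_pi, Set.mem_prod, Finset.mem_coe, Set.mem_ofPred_eq,
      Finset.coe_preimage]
    constructor
    · intro h
      exact ⟨fun h0 => h 0 h0, fun i hi => h (i + 1) hi⟩
    · rintro ⟨h0, h1⟩ i hi
      cases i with
      | zero => exact h0 hi
      | succ i => exact h1 i hi
  rw [hpre, Measure.prod_prod, Measure.infinitePi_pi _ (fun i _ => ht _)]
  by_cases h0 : 0 ∈ s
  · rw [← Finset.mul_prod_erase s _ h0]
    congr 1
    · simp [h0]
    · refine Finset.prod_bij (fun i _ => i + 1) ?_ ?_ ?_ ?_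
      · intro i hi
        simpa using hi
      · intro i _ j _ h
        omega
      · intro i hi
        rw [Finset.mem_erase] at hi
        obtain ⟨j, rfl⟩ := Nat.exists_eq_succ_of_ne_zero hi.1
        exact ⟨j, by simpa using hi.2, rfl⟩
      · intro i _
        rfl
  · have : {u : I | 0 ∈ s → u ∈ t 0} = Set.univ := by ext; simp [h0]
    rw [this, measure_univ, one_mul]
    refine Finset.prod_bij (fun i _ => i + 1) ?_ ?_ ?_ ?_
    · intro i hi
      simpa using hi
    · intro i _ j _ h
      omega
    · intro i hi
      obtain ⟨j, rfl⟩ := Nat.exists_eq_succ_of_ne_zero (n := i) (by rintro rfl; exact h0 hi)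
      exact ⟨j, by simpa using hi, rfl⟩
    · intro i _
      rfl

/-- The configurations of the trajectory driven by `φ` and the random input `ω`. -/
noncomputable def TimedAutomaton.traj (A : TimedAutomaton AP L X E)
    (φ : L × (X → ℝ) → I → ℝ × E) (s : L × (X → ℝ)) (ω : ℕ → I) : ℕ → L × (X → ℝ)
  | 0 => s
  | n + 1 => A.post (TimedAutomaton.traj A φ s ω n) (φ (TimedAutomaton.traj A φ s ω n) (ω n)).1
      (φ (TimedAutomaton.traj A φ s ω n) (ω n)).2

theorem TimedAutomaton.traj_succ (A : TimedAutomaton AP L X E)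
    (φ : L × (X → ℝ) → I → ℝ × E) (s : L × (X → ℝ)) (ω : ℕ → I) (n : ℕ) :
    A.traj φ s ω (n + 1) =
      A.traj φ (A.post s (φ s (ω 0)).1 (φ s (ω 0)).2) (fun k => ω (k + 1)) n := by
  induction n with
  | zero => rfl
  | succ n ih => rw [TimedAutomaton.traj, ih, TimedAutomaton.traj]

theorem TimedAutomaton.measurable_traj (A : TimedAutomaton AP L X E)
    {φ : L × (X → ℝ) → I → ℝ × E} (hφ : Measurable (Function.uncurry φ)) (n : ℕ) :
    Measurable fun p : (L × (X → ℝ)) × (ℕ → I) => A.traj φ p.1 p.2 n := by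
  induction n with
  | zero => exact measurable_fst
  | succ n ih =>
    have h : Measurable fun p : (L × (X → ℝ)) × (ℕ → I) =>
        φ (A.traj φ p.1 p.2 n) (p.2 n) :=
      hφ.comp (ih.prodMk ((measurable_pi_apply n).comp measurable_snd))
    exact A.measurable_post ih (measurable_fst.comp h) (measurable_snd.comp h)

/-- The delay and edge chosen at step `n`. -/
noncomputable def TimedAutomaton.draw (A : TimedAutomaton AP L X E)
    (φ : L × (X → ℝ) → I → ℝ × E) (s : L × (X → ℝ)) (ω : ℕ → I) (n : ℕ) : ℝ × E :=
  φ (A.traj φ s ω n) (ω n)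

theorem TimedAutomaton.draw_succ (A : TimedAutomaton AP L X E)
    (φ : L × (X → ℝ) → I → ℝ × E) (s : L × (X → ℝ)) (ω : ℕ → I) (n : ℕ) :
    A.draw φ s ω (n + 1) =
      A.draw φ (A.post s (φ s (ω 0)).1 (φ s (ω 0)).2) (fun k => ω (k + 1)) n := by
  rw [draw, traj_succ, draw]

theorem TimedAutomaton.measurable_draw (A : TimedAutomaton AP L X E)
    {φ : L × (X → ℝ) → I → ℝ × E} (hφ : Measurable (Function.uncurry φ)) (n : ℕ) :
    Measurable fun p : (L × (X → ℝ)) × (ℕ → I) => A.draw φ p.1 p.2 n :=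
  hφ.comp ((A.measurable_traj hφ n).prodMk ((measurable_pi_apply n).comp measurable_snd))

/-- Inputs for which the first `n` steps form a path with the given edges and constraint. -/
def TimedAutomaton.follows (A : TimedAutomaton AP L X E)
    (φ : L × (X → ℝ) → I → ℝ × E) (s : L × (X → ℝ)) {n : ℕ} (e : Fin n → E)
    (C : Set (Fin n → ℝ)) : Set (ℕ → I) :=
  {ω | (∀ i : Fin n, (A.draw φ s ω i).1 ∈ A.edgeDelays (A.traj φ s ω i) (A.draw φ s ω i).2 ∧
    (A.draw φ s ω i).2 = e i) ∧ (fun i : Fin n => (A.draw φ s ω i).1) ∈ C}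

/-- Inputs for which all steps are transitions. -/
def TimedAutomaton.legal (A : TimedAutomaton AP L X E)
    (φ : L × (X → ℝ) → I → ℝ × E) (s : L × (X → ℝ)) (n : ℕ) : Set (ℕ → I) :=
  {ω | ∀ i < n, (A.draw φ s ω i).1 ∈ A.edgeDelays (A.traj φ s ω i) (A.draw φ s ω i).2}

theorem TimedAutomaton.measurableSet_legalStep (A : TimedAutomaton AP L X E)
    {φ : L × (X → ℝ) → I → ℝ × E} (hφ : Measurable (Function.uncurry φ)) (n : ℕ) :
    MeasurableSet {p : (L × (X → ℝ)) × (ℕ → I) |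
      (A.draw φ p.1 p.2 n).1 ∈ A.edgeDelays (A.traj φ p.1 p.2 n) (A.draw φ p.1 p.2 n).2} :=
  A.measurableSet_edgeDelays (A.measurable_traj hφ n)
    (measurable_fst.comp (A.measurable_draw hφ n)) (measurable_snd.comp (A.measurable_draw hφ n))

theorem TimedAutomaton.measurableSet_follows (A : TimedAutomaton AP L X E)
    {φ : L × (X → ℝ) → I → ℝ × E} (hφ : Measurable (Function.uncurry φ)) {n : ℕ} (e : Fin n → E)
    {C : Set (ℝ × (Fin n → ℝ))} (hC : MeasurableSet C) :
    MeasurableSet {p : (ℝ × (L × (X → ℝ))) × (ℕ → I) |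
      p.2 ∈ A.follows φ p.1.2 e {τ | (p.1.1, τ) ∈ C}} := by
  have hq : Measurable fun p : (ℝ × (L × (X → ℝ))) × (ℕ → I) => (p.1.2, p.2) :=
    (measurable_snd.comp measurable_fst).prodMk measurable_snd
  refine MeasurableSet.inter ?_ ?_
  · show MeasurableSet {p : (ℝ × (L × (X → ℝ))) × (ℕ → I) | ∀ i : Fin n, _}
    rw [Set.ofPred_forall]
    refine MeasurableSet.iInter fun i => MeasurableSet.inter ?_ ?_
    · exact hq (A.measurableSet_legalStep hφ i)
    · exact ((measurable_snd.comp (A.measurable_draw hφ i)).comp hq)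
        (MeasurableSet.of_discrete (s := {e i}))
  · have : Measurable fun p : (ℝ × (L × (X → ℝ))) × (ℕ → I) =>
        (p.1.1, fun i : Fin n => (A.draw φ p.1.2 p.2 i).1) :=
      (measurable_fst.comp measurable_fst).prodMk (measurable_pi_lambda _ fun i =>
        (measurable_fst.comp (A.measurable_draw hφ i)).comp hq)
    exact this hC

theorem measurable_cons {n : ℕ} :
    Measurable fun p : ℝ × (Fin n → ℝ) => (Fin.cons p.1 p.2 : Fin (n + 1) → ℝ) := by
  refine measurable_pi_lambda _ fun i => ?_
  refine Fin.cases ?_ (fun i => ?_) i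
  · exact measurable_fst
  · simp only [Fin.cons_succ]
    exact (measurable_pi_apply i).comp measurable_snd

theorem StochasticTA.measure_follows {K : Kernel (L × (X → ℝ)) (ℝ × E)}
    (hK : ∀ s e, ∀ h : ℝ → ℝ≥0∞, Measurable h →
          ∫⁻ z in {z | z.1 ∈ A.edgeDelays s z.2 ∧ z.2 = e}, h z.1 ∂(K s) =
          ∫⁻ t in A.edgeDelays s e,
            ENNReal.ofReal (A.edgeProb A.weight (s.1, shift s.2 t) e) * h t ∂(A.delay s.1 s.2))
    {φ : L × (X → ℝ) → I → ℝ × E} (hφ : Measurable (Function.uncurry φ))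
    (hφK : ∀ s, volume.map (φ s) = K s) (P : Measure (ℕ → I)) [IsProbabilityMeasure P]
    (hP : (volume.prod P).map consSeq = P)
    (n : ℕ) : ∀ (s : L × (X → ℝ)) (e : Fin n → E) (C : Set (Fin n → ℝ)), MeasurableSet C →
      P (A.follows φ s e C) = A.pathProb n s e C := by
  have hm := measurable_consSeq
  induction n with
  | zero =>
    intro s e C _
    by_cases h : Fin.elim0 ∈ C
    · have : A.follows φ s e C = Set.univ := by
        ext ω
        simp only [TimedAutomaton.follows, Set.mem_ofPred_eq, Set.mem_univ, iff_true]
        exact ⟨fun i => i.elim0, by convert h⟩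
      rw [this, measure_univ, StochasticTA.pathProb, Set.indicator_of_mem h]
      rfl
    · have : A.follows φ s e C = ∅ := by
        ext ω
        simp only [TimedAutomaton.follows, Set.mem_ofPred_eq, Set.mem_empty_iff_false, iff_false]
        rintro ⟨-, h'⟩
        exact h (by convert h')
      rw [this, measure_empty, StochasticTA.pathProb, Set.indicator_of_notMem h]
  | succ n ih =>
    intro s e C hC
    have hC' : MeasurableSet {p : ℝ × (Fin n → ℝ) | (Fin.cons p.1 p.2 : Fin (n + 1) → ℝ) ∈ C} :=
      measurable_cons hC
    have hsec := A.measurableSet_follows hφ (fun i => e i.succ) hC'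
    have hD : Measurable fun p : ℝ × (L × (X → ℝ)) =>
        P (A.follows φ p.2 (fun i => e i.succ)
          {τ | (Fin.cons p.1 τ : Fin (n + 1) → ℝ) ∈ C}) :=
      measurable_measure_prodMk_left hsec
    let h : ℝ → ℝ≥0∞ := fun t => P (A.follows φ (A.post s t (e 0)) (fun i => e i.succ)
          {τ | (Fin.cons t τ : Fin (n + 1) → ℝ) ∈ C})
    have hh : Measurable h := hD.comp (measurable_id.prodMk
      (A.measurable_post measurable_const measurable_id measurable_const))
    have hS : MeasurableSet {z : ℝ × E | z.1 ∈ A.edgeDelays s z.2 ∧ z.2 = e 0} :=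
      (A.measurableSet_edgeDelays measurable_const measurable_fst measurable_snd).inter
        (measurable_snd (MeasurableSet.of_discrete (s := {e 0})))
    have hF : MeasurableSet (A.follows φ s e C) := by
      have h1 := A.measurableSet_follows hφ e
        (C := {p : ℝ × (Fin (n + 1) → ℝ) | p.2 ∈ C}) (measurable_snd hC)
      exact (measurable_const.prodMk measurable_id :
        Measurable fun ω : ℕ → I => (((0 : ℝ), s), ω)) h1
    have hφs : Measurable (φ s) := hφ.comp (measurable_const.prodMk measurable_id)
    have hpre : ∀ u : I, P (Prod.mk u ⁻¹' (consSeq ⁻¹' (A.follows φ s e C))) =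
        {z : ℝ × E | z.1 ∈ A.edgeDelays s z.2 ∧ z.2 = e 0}.indicator (fun z => h z.1) (φ s u) := by
      intro u
      by_cases hu : (φ s u).1 ∈ A.edgeDelays s (φ s u).2 ∧ (φ s u).2 = e 0
      · rw [Set.indicator_of_mem (by exact hu)]
        congr 1
        ext ω
        simp only [TimedAutomaton.follows, Set.mem_preimage, Set.mem_ofPred_eq, Fin.forall_fin_succ,
          Fin.val_zero, Fin.val_succ, TimedAutomaton.draw_succ, TimedAutomaton.traj_succ]
        have h0 : (fun i : Fin (n + 1) => (A.draw φ s
            (consSeq (u, ω)) i).1) =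
            Fin.cons (φ s u).1 (fun i : Fin n => (A.draw φ (A.post s (φ s u).1 (e 0)) ω i).1) := by
          funext i
          refine Fin.cases ?_ (fun i => ?_) i
          · rfl
          · simp only [Fin.val_succ, TimedAutomaton.draw_succ, Fin.cons_succ]
            rw [← hu.2]
            rfl
        rw [h0]
        have h1 : A.draw φ s (consSeq (u, ω)) 0 = φ s u := rfl
        have h3 : consSeq (u, ω) 0 = u := rfl
        have h4 : (fun k => consSeq (u, ω) (k + 1)) = ω := rfl
        have h2 : A.traj φ s (consSeq (u, ω)) 0 = s := rfl
        rw [h1, h2, h3, h4, ← hu.2]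
        simp only [hu.1, true_and, and_self]
      · rw [Set.indicator_of_notMem (by exact hu)]
        have : Prod.mk u ⁻¹' (consSeq ⁻¹' (A.follows φ s e C)) = ∅ := by
          ext ω
          simp only [Set.mem_preimage, Set.mem_empty_iff_false, iff_false]
          rintro ⟨h1, -⟩
          exact hu (h1 0)
        rw [this, measure_empty]
    rw [← hP, Measure.map_apply hm hF, Measure.prod_apply (hm hF)]
    simp only [hpre]
    rw [hP] at *
    rw [← lintegral_map (f := {z : ℝ × E | z.1 ∈ A.edgeDelays s z.2 ∧ z.2 = e 0}.indicator
      (fun z => h z.1)) ((hh.comp measurable_fst).indicator hS) hφs, hφK,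
      lintegral_indicator hS, hK s (e 0) h hh, StochasticTA.pathProb]
    refine lintegral_congr fun t => ?_
    congr 1
    exact ih _ _ _ ((measurable_const.prodMk measurable_id :
      Measurable fun τ : Fin n → ℝ => (t, τ)) hC')

theorem StochasticTA.measure_legal {K : Kernel (L × (X → ℝ)) (ℝ × E)}
    (hK : ∀ s, A.IsState s → ∀ᵐ z ∂(K s), z.1 ∈ A.edgeDelays s z.2)
    {φ : L × (X → ℝ) → I → ℝ × E} (hφ : Measurable (Function.uncurry φ))
    (hφK : ∀ s, volume.map (φ s) = K s) (P : Measure (ℕ → I)) [IsProbabilityMeasure P]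
    (hP : (volume.prod P).map consSeq = P)
    (n : ℕ) : ∀ s, A.IsState s → ∀ᵐ ω ∂P, ω ∈ A.legal φ s n := by
  have hm := measurable_consSeq
  induction n with
  | zero => intro s _; filter_upwards with ω i hi; omega
  | succ n ih =>
    intro s hs
    have hleg : MeasurableSet (A.legal φ s (n + 1)) := by
      have : A.legal φ s (n + 1) = ⋂ i ∈ {i | i < n + 1}, {ω | (A.draw φ s ω i).1 ∈
          A.edgeDelays (A.traj φ s ω i) (A.draw φ s ω i).2} := by
        ext ω; simp [TimedAutomaton.legal]
      rw [this]
      refine MeasurableSet.biInter (Set.to_countable _) fun i _ => ?_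
      exact (measurable_const.prodMk measurable_id :
        Measurable fun ω : ℕ → I => (s, ω)) (A.measurableSet_legalStep hφ i)
    have hφs : Measurable (φ s) := hφ.comp (measurable_const.prodMk measurable_id)
    rw [← hP, ae_map_iff (p := fun ω => ω ∈ A.legal φ s (n + 1)) hm.aemeasurable hleg]
    refine (Measure.measure_prod_null (hm hleg.compl)).2 ?_
    have h1 : ∀ᵐ u : I, (φ s u).1 ∈ A.edgeDelays s (φ s u).2 := by
      have := hK s hs
      rw [← hφK s] at this
      exact ae_of_ae_map hφs.aemeasurable this
    filter_upwards [h1] with u hu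
    have h2 := ih _ (TimedAutomaton.step_post hu).2.2.2.2.2.2
    refine measure_mono_null ?_ h2
    intro ω hω hω'
    refine hω fun i hi => ?_
    cases i with
    | zero => exact hu
    | succ i =>
      rw [TimedAutomaton.draw_succ, TimedAutomaton.traj_succ]
      exact hω' i (by omega)

end Construction

section RunMeasure

variable {AP L X E : Type*}

theorem TimedAutomaton.measurableSet_cyl (A : TimedAutomaton AP L X E) (s : L × (X → ℝ)) {n : ℕ}
    (e : Fin n → E) {C : Set (Fin n → ℝ)} (hC : MeasurableSet C) :
    MeasurableSet (A.cyl s e C) :=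
  MeasurableSpace.measurableSet_generateFrom ⟨n, e, C, hC, rfl⟩

theorem TimedAutomaton.cyl_inter (A : TimedAutomaton AP L X E) (s : L × (X → ℝ)) {n m : ℕ}
    (hnm : n ≤ m) (e : Fin n → E) (e' : Fin m → E) {C : Set (Fin n → ℝ)} {C' : Set (Fin m → ℝ)}
    (hC : MeasurableSet C) (hC' : MeasurableSet C') (h : (A.cyl s e C ∩ A.cyl s e' C').Nonempty) :
    ∃ D : Set (Fin m → ℝ), MeasurableSet D ∧ A.cyl s e C ∩ A.cyl s e' C' = A.cyl s e' D := by
  refine ⟨C' ∩ (fun τ : Fin m → ℝ => fun i : Fin n => τ (i.castLE hnm)) ⁻¹' C,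
    hC'.inter ((measurable_pi_lambda _ fun i => measurable_pi_apply _) hC), ?_⟩
  obtain ⟨ρ₀, ⟨h1, -⟩, ⟨h2, -⟩⟩ := h
  ext ρ
  constructor
  · rintro ⟨⟨-, h4⟩, ⟨h5, h6⟩⟩
    exact ⟨h5, h6, h4⟩
  · rintro ⟨h5, h6, h4⟩
    refine ⟨⟨fun i => ?_, h4⟩, ⟨h5, h6⟩⟩
    have a := h5 (i.castLE hnm)
    have b := h2 (i.castLE hnm)
    have c := h1 i
    simp only [Fin.val_castLE] at a b
    rw [a, ← b, c]

variable [Fintype E] (A : StochasticTA AP L X E)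

/-- The probabilities of constrained symbolic paths extend uniquely to a measure on the
σ-algebra generated by the cylinders. -/
theorem StochasticTA.existsUnique_runMeasure [Finite L] [Finite X] (s : L × (X → ℝ))
    (hs : A.IsState s) :
    ∃! ν : Measure (A.Run s), ∀ (n : ℕ) (e : Fin n → E) (C : Set (Fin n → ℝ)),
      MeasurableSet C → ν (A.cyl s e C) = A.pathProb n s e C := by
  classical
  let _ : MeasurableSpace L := ⊤
  let _ : MeasurableSpace E := ⊤
  have : DiscreteMeasurableSpace L := ⟨fun _ => trivial⟩
  have : DiscreteMeasurableSpace E := ⟨fun _ => trivial⟩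
  have hE : Nonempty E := by
    obtain ⟨t, ht⟩ := A.nonblocking s hs
    exact ⟨(Set.mem_iUnion.1 ht).choose⟩
  obtain ⟨K, hKm, hK⟩ := A.exists_kernel
  obtain ⟨φ, hφ, hφK⟩ := Kernel.exists_measurable_map_eq_unitInterval K
  let P : Measure (ℕ → unitInterval) := Measure.infinitePi fun _ => volume
  have hP := infinitePi_cons P rfl
  have hfol := A.measure_follows (fun s => (hK s).1) hφ hφK P hP
  have hleg : ∀ᵐ ω ∂P, ∀ n, ω ∈ A.legal φ s n :=
    ae_all_iff.2 fun n => A.measure_legal (fun s => (hK s).2) hφ hφK P hP n s hs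
  have hlegm : MeasurableSet {ω | ∀ n, ω ∈ A.legal φ s n} := by
    rw [Set.ofPred_forall]
    refine MeasurableSet.iInter fun n => ?_
    have : {ω | ω ∈ A.legal φ s n} = ⋂ i ∈ {i | i < n}, {ω | (A.draw φ s ω i).1 ∈
        A.edgeDelays (A.traj φ s ω i) (A.draw φ s ω i).2} := by
      ext ω; simp [TimedAutomaton.legal]
    rw [this]
    refine MeasurableSet.biInter (Set.to_countable _) fun i _ => ?_
    exact (measurable_const.prodMk measurable_id :
      Measurable fun ω : ℕ → unitInterval => (s, ω)) (A.measurableSet_legalStep hφ i)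
  have hfolm : ∀ (n : ℕ) (e : Fin n → E) (C : Set (Fin n → ℝ)), MeasurableSet C →
      MeasurableSet (A.follows φ s e C) := by
    intro n e C hC
    have h1 := A.measurableSet_follows hφ e
      (C := {p : ℝ × (Fin n → ℝ) | p.2 ∈ C}) (measurable_snd hC)
    exact (measurable_const.prodMk measurable_id :
      Measurable fun ω : ℕ → unitInterval => (((0 : ℝ), s), ω)) h1
  let mk : ∀ ω, (∀ n, ω ∈ A.legal φ s n) → A.Run s := fun ω h =>
    { state := A.traj φ s ω
      delay := fun i => (A.draw φ s ω i).1
      edge := fun i => (A.draw φ s ω i).2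
      start := rfl
      step := fun i => TimedAutomaton.step_post (h (i + 1) i (Nat.lt_succ_self i)) }
  obtain ⟨ω₀, hω₀⟩ := hleg.exists
  let run : (ℕ → unitInterval) → A.Run s := fun ω =>
    if h : ∀ n, ω ∈ A.legal φ s n then mk ω h else mk ω₀ hω₀
  have hrun : ∀ ω, (∀ n, ω ∈ A.legal φ s n) → ∀ (n : ℕ) (e : Fin n → E) (C : Set (Fin n → ℝ)),
      run ω ∈ A.cyl s e C ↔ ω ∈ A.follows φ s e C := by
    intro ω h n e C
    simp only [run, dif_pos h, mk, TimedAutomaton.cyl, TimedAutomaton.follows, Set.mem_ofPred_eq]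
    have : ∀ i : Fin n, (A.draw φ s ω i).1 ∈ A.edgeDelays (A.traj φ s ω i) (A.draw φ s ω i).2 :=
      fun i => h n i i.isLt
    simp only [this, true_and]
  have hrunm : Measurable run := by
    refine measurable_generateFrom ?_
    rintro _ ⟨n, e, C, hC, rfl⟩
    have : run ⁻¹' A.cyl s e C = ({ω | ∀ n, ω ∈ A.legal φ s n} ∩ A.follows φ s e C) ∪
        ({ω | ∀ n, ω ∈ A.legal φ s n}ᶜ ∩ {_ω | mk ω₀ hω₀ ∈ A.cyl s e C}) := by
      ext ω
      by_cases h : ∀ n, ω ∈ A.legal φ s n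
      · have := hrun ω h n e C
        simp only [Set.mem_preimage, this, Set.mem_union, Set.mem_inter_iff, Set.mem_ofPred_eq,
          Set.mem_compl_iff, h, implies_true, true_and, not_true, false_and, or_false]
      · have h' : run ω = mk ω₀ hω₀ := dif_neg h
        simp only [Set.mem_preimage, h', Set.mem_union, Set.mem_inter_iff, Set.mem_ofPred_eq,
          Set.mem_compl_iff, h, false_and, not_false_iff, true_and, false_or]
    rw [this]
    exact (hlegm.inter (hfolm n e C hC)).union (hlegm.compl.inter (MeasurableSet.const _))
  refine ⟨P.map run, ?_, ?_⟩
  · intro n e C hC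
    rw [Measure.map_apply hrunm (A.measurableSet_cyl s e hC), ← hfol n s e C hC]
    refine measure_congr ?_
    filter_upwards [hleg] with ω hω
    exact propext (hrun ω hω n e C)
  · intro ν hν
    have huniv : A.cyl s (Fin.elim0 : Fin 0 → E) Set.univ = Set.univ := by
      ext ρ; simp [TimedAutomaton.cyl]
    have hval : ∀ (n : ℕ) (e : Fin n → E) (C : Set (Fin n → ℝ)), MeasurableSet C →
        P.map run (A.cyl s e C) = A.pathProb n s e C := by
      intro n e C hC
      rw [Measure.map_apply hrunm (A.measurableSet_cyl s e hC), ← hfol n s e C hC]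
      refine measure_congr ?_
      filter_upwards [hleg] with ω hω
      exact propext (hrun ω hω n e C)
    have hfin : IsFiniteMeasure (P.map run) := inferInstance
    refine (ext_of_generate_finite _ rfl ?_ ?_ ?_).symm
    · rintro _ ⟨n, e, C, hC, rfl⟩ _ ⟨m, e', C', hC', rfl⟩ hne
      rcases le_total n m with h | h
      · obtain ⟨D, hD, hD'⟩ := A.cyl_inter s h e e' hC hC' hne
        exact ⟨m, e', D, hD, hD'⟩
      · rw [Set.inter_comm] at hne ⊢
        obtain ⟨D, hD, hD'⟩ := A.cyl_inter s h e' e hC' hC hne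
        exact ⟨n, e, D, hD, hD'⟩
    · rintro _ ⟨n, e, C, hC, rfl⟩
      rw [hval n e C hC, hν n e C hC]
    · rw [← huniv, hval _ _ _ MeasurableSet.univ, hν _ _ _ MeasurableSet.univ]

/-- The probability measure on the runs from the state `s`: the unique extension of the
probabilities of constrained symbolic paths to the σ-algebra generated by the cylinders. -/
noncomputable def StochasticTA.prob [Finite L] [Finite X] (s : L × (X → ℝ)) (hs : A.IsState s) :
    Measure (A.Run s) :=
  (A.existsUnique_runMeasure s hs).choose

/-- Almost-sure satisfaction. -/
def StochasticTA.AlmostSurelySat [Finite L] [Finite X] (s : L × (X → ℝ)) (hs : A.IsState s)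
    (P : Set (ℕ → Set AP)) : Prop :=
  MeasurableSet (A.sem s P) ∧ A.prob s hs (A.sem s P) = 1

/-- Almost-sure fairness. -/
def StochasticTA.AlmostSurelyFair [Finite L] [Finite X] (s : L × (X → ℝ)) (hs : A.IsState s) :
    Prop :=
  A.prob s hs {ρ | A.Fair ρ} = 1

end RunMeasure

end TimedAut

/-!
The almost-sure and the topological semantics are reduced to one criterion,
`eventually_sem_iff_condS`, about a filter on the runs from `s`. Suppose that almost all runs, in
the sense of the filter, are fair and follow the thick graph, and that for every vertex `q` of the
thick graph reachable from the vertex of `s` the runs through `q` are not negligible. A fair path of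
the thick graph visits infinitely often exactly the vertices of one bottom strongly connected
component, so the letters that its word contains infinitely often are the labels of that component.
Conversely every reachable bottom component catches a non-negligible set of runs. Hence a
prefix-independent property holds for almost all runs if and only if all reachable bottom components
satisfy it. It remains to check the two hypotheses for the residual filter and for the filter of
sets of full probability.

Both rest on a description of thick region edges. Call a region loose if no clock at most the
largest constant has an integral value in it. From a given state, the delays that lead to a loose
region form a nondegenerate interval, and those that lead to any other region form at most one
point. So an edge of the region automaton is thick if and only if its label is loose, or no edge
with the same source has a loose label (`isThickEdge_iff`).

*Topology.* A box is an open set of delay vectors along fixed edges that meets the polyhedron of the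
path in a thick set and all of whose runs follow the same thick region edges. Polyhedra are convex,
so homotheties show that their projections have the same dimension near every point
(`dimH_image_convex_le`); thickness therefore passes to smaller open sets, and thick cylinders form
a base of the topology. Every thick cylinder contains a box (`ThickSet.exists_isBox`): a thin region
edge would make the last delay of some prefix a function of the previous ones, where the set of all
continuations contains a cylinder over a convex set and so has larger dimension
(`dimH_lt_dimH_prism`). Every box can be continued along every thick edge (`IsBox.exists_succ`).
Polyhedra are locally closed, so boxes can be shrunk to have compact closure inside them, which
makes the space of runs a Baire space (`baireSpace_run`). Extending boxes shows that the residual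
filter contains the fair runs of the thick graph.

*Probability.* The distribution of the delay is equivalent to Lebesgue measure or to a uniform
distribution, so thin region edges are null and thick ones have positive probability; by induction
on the length, the same is true of finite paths (`pathProb_thinStep`, `pathProb_followStep_pos`).
That almost all runs are fair is a hypothesis.
-/

namespace TimedAut

/-! ### Region equivalence -/

section Regions

variable {AP L X E : Type*} {A : TimedAutomaton AP L X E}

theorem TimedAutomaton.bound_le_maxConst_of_mem_guard [Finite L] [Finite E] {e : E} {a : Atom X}
    (ha : a ∈ A.guard e) : a.bound ≤ A.maxConst := by
  refine le_csSup ?_ (Or.inl ⟨e, a, ha, rfl⟩)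
  refine Set.Finite.bddAbove (Set.Finite.union
    (s := {c | ∃ e, ∃ a ∈ A.guard e, a.bound = c})
    (t := {c | ∃ ℓ, ∃ a ∈ A.inv ℓ, a.bound = c}) ?_ ?_)
  · rw [Set.ofPred_exists]
    exact Set.finite_iUnion fun e => (List.finite_toSet (A.guard e)).image Atom.bound
  · rw [Set.ofPred_exists]
    exact Set.finite_iUnion fun ℓ => (List.finite_toSet (A.inv ℓ)).image Atom.bound

theorem TimedAutomaton.bound_le_maxConst_of_mem_inv [Finite L] [Finite E] {ℓ : L} {a : Atom X}
    (ha : a ∈ A.inv ℓ) : a.bound ≤ A.maxConst := by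
  refine le_csSup ?_ (Or.inr ⟨ℓ, a, ha, rfl⟩)
  refine Set.Finite.bddAbove (Set.Finite.union
    (s := {c | ∃ e, ∃ a ∈ A.guard e, a.bound = c})
    (t := {c | ∃ ℓ, ∃ a ∈ A.inv ℓ, a.bound = c}) ?_ ?_)
  · rw [Set.ofPred_exists]
    exact Set.finite_iUnion fun e => (List.finite_toSet (A.guard e)).image Atom.bound
  · rw [Set.ofPred_exists]
    exact Set.finite_iUnion fun ℓ => (List.finite_toSet (A.inv ℓ)).image Atom.bound

theorem TimedAutomaton.RegionEquiv.refl (v : X → ℝ) : A.RegionEquiv v v :=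
  ⟨fun _ => Or.inr ⟨rfl, Iff.rfl⟩, fun _ _ _ _ => Iff.rfl⟩

theorem le_iff_floor {a : ℝ} {c : ℕ} :
    a ≤ c ↔ ⌊a⌋ < c ∨ (⌊a⌋ = c ∧ Int.fract a = 0) := by
  have h1 := Int.floor_add_fract a
  have h2 := Int.fract_nonneg a
  have h3 := Int.fract_lt_one a
  constructor
  · intro h
    rcases lt_or_ge ⌊a⌋ (c : ℤ) with h4 | h4
    · exact Or.inl h4
    · have h5 : ((c : ℤ) : ℝ) ≤ (⌊a⌋ : ℝ) := by exact_mod_cast h4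
      push_cast at h5
      refine Or.inr ⟨?_, by linarith⟩
      have : (⌊a⌋ : ℝ) = ((c : ℤ) : ℝ) := by push_cast; linarith
      exact_mod_cast this
  · rintro (h | ⟨h, h'⟩)
    · have h5 : (⌊a⌋ : ℝ) + 1 ≤ ((c : ℤ) : ℝ) := by exact_mod_cast h
      push_cast at h5
      linarith
    · have : (⌊a⌋ : ℝ) = ((c : ℤ) : ℝ) := by exact_mod_cast h
      push_cast at this
      linarith

namespace TimedAutomaton.RegionEquiv

variable {v v' v'' : X → ℝ}

theorem le_nat_iff (h : A.RegionEquiv v v') {c : ℕ} (hc : c ≤ A.maxConst) (x : X) :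
    v x ≤ c ↔ v' x ≤ c := by
  have hc' : (c : ℝ) ≤ A.maxConst := by exact_mod_cast hc
  rcases h.1 x with ⟨h1, h2⟩ | ⟨h1, h2⟩
  · constructor <;> intro <;> linarith
  · rw [le_iff_floor, le_iff_floor, h1, h2]

theorem lt_nat_iff (h : A.RegionEquiv v v') {c : ℕ} (hc : c ≤ A.maxConst) (x : X) :
    v x < c ↔ v' x < c := by
  have hc' : (c : ℝ) ≤ A.maxConst := by exact_mod_cast hc
  rcases h.1 x with ⟨h1, h2⟩ | ⟨h1, h2⟩
  · constructor <;> intro <;> linarith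
  · have := Int.floor_lt (a := v x) (z := (c : ℤ))
    have h' := Int.floor_lt (a := v' x) (z := (c : ℤ))
    push_cast at this h'
    rw [← this, ← h', h1]

theorem floor_eq (h : A.RegionEquiv v v') {x : X} (hx : v x ≤ A.maxConst) : ⌊v x⌋ = ⌊v' x⌋ := by
  rcases h.1 x with ⟨h1, _⟩ | ⟨h1, _⟩
  · linarith
  · exact h1

theorem fract_eq_zero_iff (h : A.RegionEquiv v v') {x : X} (hx : v x ≤ A.maxConst) :
    Int.fract (v x) = 0 ↔ Int.fract (v' x) = 0 := by
  rcases h.1 x with ⟨h1, _⟩ | ⟨_, h1⟩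
  · linarith
  · exact h1

theorem symm (h : A.RegionEquiv v v') : A.RegionEquiv v' v := by
  refine ⟨fun x => ?_, fun x y hx hy => ?_⟩
  · rcases h.1 x with ⟨h1, h2⟩ | ⟨h1, h2⟩
    · exact Or.inl ⟨h2, h1⟩
    · exact Or.inr ⟨h1.symm, h2.symm⟩
  · exact (h.2 x y ((h.le_nat_iff le_rfl x).2 hx) ((h.le_nat_iff le_rfl y).2 hy)).symm

theorem trans (h : A.RegionEquiv v v') (h' : A.RegionEquiv v' v'') : A.RegionEquiv v v'' := by
  refine ⟨fun x => ?_, fun x y hx hy => ?_⟩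
  · by_cases hx : v x ≤ A.maxConst
    · have hx' := (h.le_nat_iff le_rfl x).1 hx
      exact Or.inr ⟨(h.floor_eq hx).trans (h'.floor_eq hx'),
        (h.fract_eq_zero_iff hx).trans (h'.fract_eq_zero_iff hx')⟩
    · have hx' := fun h2 => hx ((h.le_nat_iff le_rfl x).2 h2)
      have hx'' := fun h2 => hx' ((h'.le_nat_iff le_rfl x).2 h2)
      exact Or.inl ⟨not_le.1 hx, not_le.1 hx''⟩
  · exact (h.2 x y hx hy).trans
      (h'.2 x y ((h.le_nat_iff le_rfl x).1 hx) ((h.le_nat_iff le_rfl y).1 hy))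

theorem sat_iff (h : A.RegionEquiv v v') {g : Guard X} (hg : ∀ a ∈ g, a.bound ≤ A.maxConst) :
    g.Sat v ↔ g.Sat v' := by
  refine forall₂_congr fun a ha => ?_
  have h1 := h.le_nat_iff (hg a ha) a.clock
  have h2 := h.lt_nat_iff (hg a ha) a.clock
  cases a.cmp <;> simp only [Cmp.Holds]
  · exact h2
  · exact h1
  · rw [le_antisymm_iff, le_antisymm_iff, h1, ← not_lt (b := (a.bound : ℝ)), h2, not_lt]
  · rw [ge_iff_le, ← not_lt, h2, not_lt]
  · rw [gt_iff_lt, ← not_le, h1, not_le]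

theorem resetClocks (h : A.RegionEquiv v v') (Y : Set X) :
    A.RegionEquiv (resetClocks Y v) (resetClocks Y v') := by
  unfold TimedAut.resetClocks
  refine ⟨fun x => ?_, fun x y hx hy => ?_⟩
  · by_cases hx : x ∈ Y
    · simp [hx]
    · simpa [hx] using h.1 x
  · by_cases hx' : x ∈ Y <;> by_cases hy' : y ∈ Y
    · simp [hx', hy']
    · simp [hx', hy', Int.fract_nonneg]
    · simp only [hx', hy', if_true, if_false, Int.fract_zero] at hx ⊢
      have h1 := h.fract_eq_zero_iff hx
      constructor <;> intro h2
      · exact (h1.1 (le_antisymm h2 (Int.fract_nonneg _))).le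
      · exact (h1.2 (le_antisymm h2 (Int.fract_nonneg _))).le
    · simp only [hx', hy', if_false] at hx hy ⊢
      exact h.2 x y hx hy

end TimedAutomaton.RegionEquiv

/-- Fractional parts `φ x`, `φ' x` in `[0, 1)` indexed by a finite set and ordered in the same way
can be separated in the same way: each level `ψ` in the first family has a counterpart `ψ'` in the
second. -/
theorem exists_level {s : Finset X} {φ φ' : X → ℝ} (h0 : ∀ x ∈ s, 0 ≤ φ' x)
    (h1 : ∀ x ∈ s, φ x < 1) (h1' : ∀ x ∈ s, φ' x < 1)
    (hz : ∀ x ∈ s, φ x = 0 ↔ φ' x = 0) (ho : ∀ x ∈ s, ∀ y ∈ s, φ x ≤ φ y ↔ φ' x ≤ φ' y)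
    {ψ : ℝ} (hψ0 : 0 < ψ) (hψ1 : ψ ≤ 1) :
    ∃ ψ' : ℝ, 0 < ψ' ∧ ψ' ≤ 1 ∧ (ψ = 1 ↔ ψ' = 1) ∧
      ∀ x ∈ s, (φ x < ψ ↔ φ' x < ψ') ∧ (φ x = ψ ↔ φ' x = ψ') := by
  classical
  have hlt : ∀ x ∈ s, ∀ y ∈ s, φ x < φ y ↔ φ' x < φ' y := fun x hx y hy => by
    rw [← not_le, ho y hy x hx, not_le]
  rcases hψ1.eq_or_lt with rfl | hψ1
  · exact ⟨1, one_pos, le_rfl, Iff.rfl, fun x hx =>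
      ⟨iff_of_true (h1 x hx) (h1' x hx), iff_of_false (h1 x hx).ne (h1' x hx).ne⟩⟩
  by_cases hex : ∃ x ∈ s, φ x = ψ
  · obtain ⟨y, hy, rfl⟩ := hex
    have hpos : 0 < φ' y := lt_of_le_of_ne (h0 y hy) fun h => hψ0.ne' ((hz y hy).2 h.symm)
    refine ⟨φ' y, hpos, (h1' y hy).le, iff_of_false hψ1.ne (h1' y hy).ne, fun x hx =>
      ⟨hlt x hx y hy, ?_⟩⟩
    rw [le_antisymm_iff, le_antisymm_iff, ho x hx y hy, ho y hy x hx]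
  · push Not at hex
    obtain ⟨ψ', hlo, hhi⟩ := Order.exists_between_finsets
      (lo := insert 0 ((s.filter fun x => φ x < ψ).image φ'))
      (hi := insert 1 ((s.filter fun x => ψ < φ x).image φ')) (by
        intro a ha b hb
        simp only [Finset.mem_insert, Finset.mem_image, Finset.mem_filter] at ha hb
        rcases ha with rfl | ⟨x, ⟨hx, hx'⟩, rfl⟩ <;> rcases hb with rfl | ⟨y, ⟨hy, hy'⟩, rfl⟩
        · exact one_pos
        · exact lt_of_le_of_ne (h0 y hy) fun h =>
            (hψ0.trans hy').ne' ((hz y hy).2 h.symm)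
        · exact h1' x hx
        · exact (hlt x hx y hy).1 (hx'.trans hy'))
    have hψ'1 : ψ' < 1 := hhi 1 (Finset.mem_insert_self _ _)
    refine ⟨ψ', hlo 0 (Finset.mem_insert_self _ _), hψ'1.le,
      iff_of_false hψ1.ne hψ'1.ne, fun x hx => ?_⟩
    rcases (hex x hx).lt_or_gt with h | h
    · have := hlo (φ' x) (Finset.mem_insert_of_mem (Finset.mem_image_of_mem _
        (Finset.mem_filter.2 ⟨hx, h⟩)))
      exact ⟨iff_of_true h this, iff_of_false h.ne this.ne⟩
    · have := hhi (φ' x) (Finset.mem_insert_of_mem (Finset.mem_image_of_mem _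
        (Finset.mem_filter.2 ⟨hx, h⟩)))
      exact ⟨iff_of_false h.not_gt this.not_gt, iff_of_false h.ne' this.ne'⟩

theorem floor_fract_add {n m : ℤ} {φ θ : ℝ} (h0 : 0 ≤ φ) (h1 : φ < 1) (h2 : 0 ≤ θ) (h3 : θ < 1) :
    (φ < 1 - θ → ⌊n + φ + (m + θ)⌋ = n + m ∧ Int.fract (n + φ + (m + θ)) = φ + θ) ∧
    (1 - θ ≤ φ → ⌊n + φ + (m + θ)⌋ = n + m + 1 ∧
      Int.fract (n + φ + (m + θ)) = φ + θ - 1) := by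
  refine ⟨fun h => ?_, fun h => ?_⟩
  · have : ⌊n + φ + (m + θ)⌋ = n + m := by
      rw [Int.floor_eq_iff]; push_cast; constructor <;> linarith
    refine ⟨this, ?_⟩
    rw [Int.fract, this]; push_cast; ring
  · have : ⌊n + φ + (m + θ)⌋ = n + m + 1 := by
      rw [Int.floor_eq_iff]; push_cast; constructor <;> linarith
    refine ⟨this, ?_⟩
    rw [Int.fract, this]; push_cast; ring

/-- Region equivalence is a time-abstract bisimulation: every delay from `v` is matched by a delay
from `v'`. The integral part of the delay is kept; the fractional part is chosen so that the same
clocks cross an integer. -/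
theorem TimedAutomaton.RegionEquiv.exists_shift [Finite X] {v v' : X → ℝ}
    (h : A.RegionEquiv v v') {τ : ℝ} (hτ : 0 ≤ τ) :
    ∃ τ', 0 ≤ τ' ∧ A.RegionEquiv (shift v τ) (shift v' τ') := by
  classical
  have := Fintype.ofFinite X
  obtain ⟨ψ', hψ0, hψ1, hψe, hψ⟩ := exists_level
    (s := Finset.univ.filter fun x => v x ≤ A.maxConst)
    (φ := fun x => Int.fract (v x)) (φ' := fun x => Int.fract (v' x))
    (fun x _ => Int.fract_nonneg _) (fun x _ => Int.fract_lt_one _)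
    (fun x _ => Int.fract_lt_one _)
    (fun x hx => h.fract_eq_zero_iff (Finset.mem_filter.1 hx).2)
    (fun x hx y hy => h.2 x y (Finset.mem_filter.1 hx).2 (Finset.mem_filter.1 hy).2)
    (ψ := 1 - Int.fract τ) (by linarith [Int.fract_lt_one τ]) (by linarith [Int.fract_nonneg τ])
  simp only [Finset.mem_filter, Finset.mem_univ, true_and] at hψ
  have hfl : (0 : ℝ) ≤ ⌊τ⌋ := by exact_mod_cast Int.floor_nonneg.2 hτ
  have hτe : τ = ⌊τ⌋ + Int.fract τ := (Int.floor_add_fract τ).symm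
  set m := ⌊τ⌋
  set θ := Int.fract τ
  have hθ0 : 0 ≤ θ := Int.fract_nonneg τ
  have hθ1 : θ < 1 := Int.fract_lt_one τ
  have hθz : θ = 0 ↔ 1 - ψ' = 0 := by
    rw [← sub_eq_self (a := (1 : ℝ)), hψe, sub_eq_zero, eq_comm]
  refine ⟨m + (1 - ψ'), by linarith, ?_⟩
  -- the values reached by a clock below the largest constant, in both valuations
  have key : ∀ x, v x ≤ A.maxConst → ⌊v x + τ⌋ = ⌊v' x + (m + (1 - ψ'))⌋ ∧
      (Int.fract (v x) < 1 - θ ∧ Int.fract (v x + τ) = Int.fract (v x) + θ ∧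
        Int.fract (v' x + (m + (1 - ψ'))) = Int.fract (v' x) + (1 - ψ') ∨
      1 - θ ≤ Int.fract (v x) ∧ Int.fract (v x + τ) = Int.fract (v x) + θ - 1 ∧
        Int.fract (v' x + (m + (1 - ψ'))) = Int.fract (v' x) + (1 - ψ') - 1) := by
    intro x hx
    have e1 : v x + τ = ⌊v x⌋ + Int.fract (v x) + (m + θ) := by
      rw [← hτe, Int.floor_add_fract]
    have e2 : v' x + (m + (1 - ψ')) = ⌊v x⌋ + Int.fract (v' x) + (m + (1 - ψ')) := by
      rw [h.floor_eq hx, Int.floor_add_fract]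
    have a := floor_fract_add (n := ⌊v x⌋) (m := m) (Int.fract_nonneg (v x))
      (Int.fract_lt_one (v x)) hθ0 hθ1
    have b := floor_fract_add (n := ⌊v x⌋) (m := m) (Int.fract_nonneg (v' x))
      (Int.fract_lt_one (v' x)) (θ := 1 - ψ') (by linarith) (by linarith)
    rw [← e1] at a
    rw [← e2, sub_sub_cancel] at b
    rcases lt_or_ge (Int.fract (v x)) (1 - θ) with h1 | h1
    · have h2 := (hψ x hx).1.1 h1
      exact ⟨(a.1 h1).1.trans (b.1 h2).1.symm, Or.inl ⟨h1, (a.1 h1).2, (b.1 h2).2⟩⟩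
    · have h2 : ψ' ≤ Int.fract (v' x) := not_lt.1 fun h3 => h1.not_gt ((hψ x hx).1.2 h3)
      exact ⟨(a.2 h1).1.trans (b.2 h2).1.symm, Or.inr ⟨h1, (a.2 h1).2, (b.2 h2).2⟩⟩
  refine ⟨fun x => ?_, fun x y hx hy => ?_⟩
  · simp only [shift]
    by_cases hx : v x ≤ A.maxConst
    · refine Or.inr ⟨(key x hx).1, ?_⟩
      have hz := h.fract_eq_zero_iff hx
      have n1 := Int.fract_nonneg (v x)
      have n2 := Int.fract_nonneg (v' x)
      rcases (key x hx).2 with ⟨h1, h2, h3⟩ | ⟨h1, h2, h3⟩ <;> rw [h2, h3]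
      · rw [add_eq_zero_iff_of_nonneg n1 hθ0, add_eq_zero_iff_of_nonneg n2 (by linarith), hz, hθz]
      · have := (hψ x hx).2
        rw [add_sub_assoc, add_sub_assoc, ← sub_sub_cancel 1 θ, sub_sub, sub_sub]
        constructor <;> intro h4
        · have := this.1 (by linarith)
          linarith
        · have := this.2 (by linarith)
          linarith
    · have hx' := not_le.1 fun h2 => hx ((h.le_nat_iff le_rfl x).2 h2)
      left; constructor <;> linarith
  · have hx' : v x ≤ A.maxConst := by simp only [shift] at hx; linarith
    have hy' : v y ≤ A.maxConst := by simp only [shift] at hy; linarith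
    have ho := h.2 x y hx' hy'
    have := Int.fract_lt_one (v x)
    have := Int.fract_lt_one (v y)
    have := Int.fract_lt_one (v' x)
    have := Int.fract_lt_one (v' y)
    have := Int.fract_nonneg (v x)
    have := Int.fract_nonneg (v y)
    have := Int.fract_nonneg (v' x)
    have := Int.fract_nonneg (v' y)
    simp only [shift]
    rcases (key x hx').2 with ⟨h1, h2, h3⟩ | ⟨h1, h2, h3⟩ <;>
    rcases (key y hy').2 with ⟨k1, k2, k3⟩ | ⟨k1, k2, k3⟩ <;> rw [h2, h3, k2, k3]
    · rw [add_le_add_iff_right, add_le_add_iff_right, ho]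
    · constructor <;> intro <;> linarith
    · constructor <;> intro <;> linarith
    · rw [sub_le_sub_iff_right, sub_le_sub_iff_right, add_le_add_iff_right, add_le_add_iff_right,
        ho]

/-- A valuation is loose if no clock whose value is relevant sits at an integer. These are the
valuations from which a small amount of time can elapse within the region. -/
def TimedAutomaton.Loose (A : TimedAutomaton AP L X E) (v : X → ℝ) : Prop :=
  ∀ x, v x ≤ A.maxConst → Int.fract (v x) ≠ 0

theorem TimedAutomaton.RegionEquiv.loose {v v' : X → ℝ} (h : A.RegionEquiv v v')
    (hv : A.Loose v) : A.Loose v' := fun x hx => by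
  have hx' := (h.le_nat_iff le_rfl x).2 hx
  rw [Ne, ← h.fract_eq_zero_iff hx']
  exact hv x hx'

/-- A region that is not loose fixes the value of one clock. -/
theorem TimedAutomaton.exists_const_of_not_loose {u : X → ℝ} (hu : ¬ A.Loose u) :
    ∃ (x : X) (c : ℝ), ∀ u', A.RegionEquiv u u' → u' x = c := by
  unfold Loose at hu
  push Not at hu
  obtain ⟨x, hx, hf⟩ := hu
  refine ⟨x, ⌊u x⌋, fun u' h => ?_⟩
  have h1 := (h.fract_eq_zero_iff hx).1 hf
  rw [h.floor_eq hx, ← Int.floor_add_fract (u' x), h1]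
  simp

/-- Loose regions are open among the time successors of a given region: the equalities between
fractional parts are inherited from the source region. -/
theorem TimedAutomaton.Loose.eventually_regionEquiv [Finite X] {v : X → ℝ} {t : ℝ} (ht : 0 ≤ t)
    (h : A.Loose (shift v t)) :
    ∀ᶠ u in 𝓝 (shift v t), ∀ v' t', A.RegionEquiv v v' → u = shift v' t' →
      A.RegionEquiv (shift v t) u := by
  set w := shift v t with hw
  have h1 : ∀ x, ∀ᶠ u in 𝓝 w, ((A.maxConst : ℝ) < w x ∧ (A.maxConst : ℝ) < u x) ∨
      (w x ≤ A.maxConst ∧ ⌊w x⌋ = ⌊u x⌋ ∧ (Int.fract (w x) = 0 ↔ Int.fract (u x) = 0)) := by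
    intro x
    have hc : Tendsto (fun u : X → ℝ => u x) (𝓝 w) (𝓝 (w x)) := (continuous_apply x).tendsto w
    rcases lt_or_ge (A.maxConst : ℝ) (w x) with hx | hx
    · filter_upwards [hc.eventually (lt_mem_nhds hx)] with u hu
      exact Or.inl ⟨hx, hu⟩
    · have hf := h x hx
      have h2 : (⌊w x⌋ : ℝ) < w x := by
        have := Int.floor_add_fract (w x)
        have := lt_of_le_of_ne (Int.fract_nonneg (w x)) hf.symm
        linarith
      filter_upwards [hc.eventually (lt_mem_nhds h2),
        hc.eventually (gt_mem_nhds (Int.lt_floor_add_one (w x)))] with u hu1 hu2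
      have h3 : ⌊u x⌋ = ⌊w x⌋ := Int.floor_eq_iff.2 ⟨hu1.le, hu2⟩
      refine Or.inr ⟨hx, h3.symm, iff_of_false hf ?_⟩
      rw [Int.fract, h3]
      linarith
  have h2 : ∀ x y, ∀ᶠ u in 𝓝 w, w x ≤ A.maxConst → w y ≤ A.maxConst →
      Int.fract (w x) < Int.fract (w y) → Int.fract (u x) < Int.fract (u y) := by
    intro x y
    have hc : ∀ x, w x ≤ A.maxConst →
        Tendsto (fun u : X → ℝ => Int.fract (u x)) (𝓝 w) (𝓝 (Int.fract (w x))) := by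
      intro x hx
      have : w x ≠ ⌊w x⌋ := fun h3 => h x hx (sub_eq_zero.2 h3)
      exact (continuousAt_fract this).tendsto.comp ((continuous_apply x).tendsto w)
    by_cases hx : w x ≤ A.maxConst
    · by_cases hy : w y ≤ A.maxConst
      · by_cases hxy : Int.fract (w x) < Int.fract (w y)
        · filter_upwards [(hc x hx).eventually_lt (hc y hy) hxy] with u hu _ _ _
          exact hu
        · exact Eventually.of_forall fun u _ _ h3 => absurd h3 hxy
      · exact Eventually.of_forall fun u _ h3 => absurd h3 hy
    · exact Eventually.of_forall fun u h3 => absurd h3 hx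
  filter_upwards [eventually_all.2 h1, eventually_all.2 fun x => eventually_all.2 (h2 x)]
    with u hu1 hu2 v' t' hv' hu
  refine ⟨fun x => (hu1 x).imp_right And.right, fun x y hx hy => ?_⟩
  rcases lt_trichotomy (Int.fract (w x)) (Int.fract (w y)) with h3 | h3 | h3
  · exact iff_of_true h3.le (hu2 x y hx hy h3).le
  · have hx' : v x ≤ A.maxConst := by simp only [hw, shift] at hx; linarith
    have hy' : v y ≤ A.maxConst := by simp only [hw, shift] at hy; linarith
    have h4 : ∀ {a b c : ℝ}, Int.fract (a + c) = Int.fract (b + c) ↔ Int.fract a = Int.fract b := by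
      intro a b c
      rw [Int.fract_eq_fract, Int.fract_eq_fract, add_sub_add_right_eq_sub]
    have h5 : Int.fract (v x) = Int.fract (v y) := by
      rw [hw] at h3
      exact h4.1 h3
    have h6 : Int.fract (v' x) = Int.fract (v' y) :=
      le_antisymm ((hv'.2 x y hx' hy').1 h5.le) ((hv'.2 y x hy' hx').1 h5.ge)
    have h7 : Int.fract (u x) = Int.fract (u y) := by
      rw [hu]
      exact h4.2 h6
    exact iff_of_true h3.le h7.le
  · exact iff_of_false h3.not_ge (hu2 y x hy hx h3).not_ge

end Regions

/-! ### Regions as sign patterns, region edges -/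

section RegionTests

variable {AP L X E : Type*} (A : TimedAutomaton AP L X E)

/-- Index set of the tests that determine regions: a clock, an optional second clock, and an
integer bound of absolute value at most the largest constant. -/
abbrev TimedAutomaton.Test : Type _ :=
  X × Option X × Set.Icc (-(A.maxConst : ℤ)) (A.maxConst : ℤ)

/-- The value of a test: the first clock, minus the second one if present, minus the bound. -/
noncomputable def TimedAutomaton.test (j : A.Test) (v : X → ℝ) : ℝ :=
  v j.1 - j.2.1.elim 0 v - ((j.2.2 : ℤ) : ℝ)

theorem TimedAutomaton.continuous_test (j : A.Test) : Continuous (A.test j) := by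
  obtain ⟨x, o, c⟩ := j
  unfold test
  cases o <;> simp only [Option.elim] <;> fun_prop

variable {A}

/-- The signs of the tests determine the region. -/
theorem TimedAutomaton.regionEquiv_of_sign_test {v v' : X → ℝ} (hv : ∀ x, 0 ≤ v x)
    (h : ∀ j : A.Test, SignType.sign (A.test j v) = SignType.sign (A.test j v')) :
    A.RegionEquiv v v' := by
  have hle : ∀ x o (c : ℤ), c ∈ Set.Icc (-(A.maxConst : ℤ)) (A.maxConst : ℤ) →
      (v x - Option.elim o 0 v ≤ c ↔ v' x - Option.elim o 0 v' ≤ c) := by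
    intro x o c hc
    have h1 := h (x, o, ⟨c, hc⟩)
    rw [← sub_nonpos, ← sub_nonpos (b := (c : ℝ)), ← sign_nonpos_iff,
      ← sign_nonpos_iff (a := v' x - _ - _)]
    exact iff_of_eq (congrArg (· ≤ 0) h1)
  have hge : ∀ x (c : ℤ), c ∈ Set.Icc (-(A.maxConst : ℤ)) (A.maxConst : ℤ) →
      ((c : ℝ) ≤ v x ↔ (c : ℝ) ≤ v' x) := by
    intro x c hc
    have h1 := h (x, none, ⟨c, hc⟩)
    simp only [test, Option.elim, sub_zero] at h1
    rw [← sub_nonneg, ← sub_nonneg (b := (c : ℝ)), ← sign_nonneg_iff,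
      ← sign_nonneg_iff (a := v' x - _)]
    exact iff_of_eq (congrArg (0 ≤ ·) h1)
  have hle1 : ∀ x (c : ℤ), c ∈ Set.Icc (-(A.maxConst : ℤ)) (A.maxConst : ℤ) →
      (v x ≤ c ↔ v' x ≤ c) := fun x c hc => by simpa using hle x none c hc
  have hM : (A.maxConst : ℤ) ∈ Set.Icc (-(A.maxConst : ℤ)) (A.maxConst : ℤ) := ⟨by omega, le_rfl⟩
  have hbig : ∀ x, v x ≤ A.maxConst ↔ v' x ≤ A.maxConst := fun x => by
    simpa using hle1 x _ hM
  have hk0 : ∀ x, 0 ≤ ⌊v x⌋ := fun x => Int.floor_nonneg.2 (hv x)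
  have hkM : ∀ x, v x ≤ A.maxConst → ⌊v x⌋ ≤ A.maxConst := fun x hx => by
    have := (Int.floor_le (v x)).trans hx
    exact_mod_cast this
  have hfloor : ∀ x, v x ≤ A.maxConst → ⌊v x⌋ = ⌊v' x⌋ := by
    intro x hx
    have k0 := hk0 x
    have kM := hkM x hx
    refine (Int.floor_eq_iff.2 ⟨(hge x ⌊v x⌋ ⟨by omega, kM⟩).1 (Int.floor_le _), ?_⟩).symm
    rcases kM.lt_or_eq with h1 | h1
    · have h2 := hge x (⌊v x⌋ + 1) ⟨by omega, by omega⟩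
      rw [← not_iff_not, not_le, not_le] at h2
      push_cast at h2
      exact h2.1 (Int.lt_floor_add_one _)
    · have h2 := (hbig x).1 hx
      have h3 : ((⌊v x⌋ : ℤ) : ℝ) = A.maxConst := by rw [h1]; simp
      linarith
  have hz : ∀ a : ℝ, Int.fract a = 0 ↔ a ≤ ⌊a⌋ := fun a => by
    rw [Int.fract]
    have := Int.floor_le a
    constructor <;> intro <;> linarith
  refine ⟨fun x => ?_, fun x y hx hy => ?_⟩
  · by_cases hx : v x ≤ A.maxConst
    · refine Or.inr ⟨hfloor x hx, ?_⟩
      have k0 := hk0 x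
      rw [hz, hz, ← hfloor x hx]
      exact hle1 x _ ⟨by omega, hkM x hx⟩
    · exact Or.inl ⟨not_le.1 hx, not_le.1 fun h1 => hx ((hbig x).2 h1)⟩
  · have kx := hk0 x
    have ky := hk0 y
    have mx := hkM x hx
    have my := hkM y hy
    have h1 := hle x (some y) (⌊v x⌋ - ⌊v y⌋) ⟨by omega, by omega⟩
    simp only [Option.elim] at h1
    push_cast at h1
    have h2 : ∀ a b c d : ℝ, a - b ≤ c - d ↔ a - c ≤ b - d := fun a b c d => by
      constructor <;> intro <;> linarith
    rw [h2, h2 (v' x)] at h1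
    rw [Int.fract, Int.fract, h1, Int.fract, Int.fract, hfloor x hx, hfloor y hy]

theorem TimedAutomaton.RegionEquiv.regionOf_eq {v v' : X → ℝ} (h : A.RegionEquiv v v') :
    A.regionOf v = A.regionOf v' := by
  ext u
  exact ⟨fun hu => ⟨hu.1, h.symm.trans hu.2⟩, fun hu => ⟨hu.1, h.trans hu.2⟩⟩

theorem TimedAutomaton.mem_regionOf {v : X → ℝ} (hv : ∀ x, 0 ≤ v x) : v ∈ A.regionOf v :=
  ⟨hv, .refl v⟩

theorem TimedAutomaton.regionOf_mem_regions {v : X → ℝ} (hv : ∀ x, 0 ≤ v x) :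
    A.regionOf v ∈ A.regions := ⟨v, hv, rfl⟩

theorem TimedAutomaton.regionOf_eq_iff {v v' : X → ℝ} (hv' : ∀ x, 0 ≤ v' x) :
    A.regionOf v = A.regionOf v' ↔ A.RegionEquiv v v' := by
  refine ⟨fun h => ?_, RegionEquiv.regionOf_eq⟩
  have := mem_regionOf (A := A) hv'
  rw [← h] at this
  exact this.2

theorem TimedAutomaton.mem_region_iff {r : Set (X → ℝ)} (hr : r ∈ A.regions) {v : X → ℝ} :
    v ∈ r ↔ (∀ x, 0 ≤ v x) ∧ A.regionOf v = r := by
  obtain ⟨u, hu, rfl⟩ := hr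
  exact and_congr_right fun hv => by rw [eq_comm, regionOf_eq_iff hv]

theorem TimedAutomaton.finite_regions [Finite X] : A.regions.Finite := by
  classical
  let sig : (X → ℝ) → A.Test → SignType := fun v j => SignType.sign (A.test j v)
  have : A.regions ⊆ Set.range fun σ : A.Test → SignType =>
      if h : ∃ v : X → ℝ, (∀ x, 0 ≤ v x) ∧ sig v = σ then A.regionOf h.choose else ∅ := by
    rintro r ⟨v, hv, rfl⟩
    have h : ∃ v' : X → ℝ, (∀ x, 0 ≤ v' x) ∧ sig v' = sig v := ⟨v, hv, rfl⟩
    refine ⟨sig v, ?_⟩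
    simp only [dif_pos h]
    refine RegionEquiv.regionOf_eq (regionEquiv_of_sign_test h.choose_spec.1 fun j => ?_)
    exact congrFun h.choose_spec.2 j
  exact (Set.finite_range _).subset this

theorem TimedAutomaton.measurableSet_region [Finite X] {r : Set (X → ℝ)} (hr : r ∈ A.regions) :
    MeasurableSet r := by
  obtain ⟨u, hu, rfl⟩ := hr
  have hx : ∀ x : X, Measurable fun v : X → ℝ => v x := measurable_pi_apply
  have hfl : ∀ x : X, Measurable fun v : X → ℝ => ⌊v x⌋ := fun x => (hx x).floor
  have hfr : ∀ x : X, Measurable fun v : X → ℝ => Int.fract (v x) := fun x => (hx x).fract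
  refine MeasurableSet.inter ?_ (MeasurableSet.inter ?_ ?_)
  · show MeasurableSet {v : X → ℝ | ∀ x, 0 ≤ v x}
    rw [Set.ofPred_forall]
    exact MeasurableSet.iInter fun x => measurableSet_le measurable_const (hx x)
  · show MeasurableSet {v : X → ℝ | ∀ x, _}
    rw [Set.ofPred_forall]
    refine MeasurableSet.iInter fun x => MeasurableSet.union ?_ ?_
    · exact (MeasurableSet.const _).inter (measurableSet_lt measurable_const (hx x))
    · refine MeasurableSet.inter ?_ ?_
      · exact measurableSet_eq_fun measurable_const (hfl x)
      · exact (MeasurableSet.const _).iff (measurableSet_eq_fun (hfr x) measurable_const)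
  · show MeasurableSet {v : X → ℝ | ∀ x, _}
    rw [Set.ofPred_forall]
    refine MeasurableSet.iInter fun x => ?_
    rw [Set.ofPred_forall]
    refine MeasurableSet.iInter fun y => MeasurableSet.imp (MeasurableSet.const _)
      (MeasurableSet.imp (MeasurableSet.const _) ?_)
    exact (MeasurableSet.const _).iff (measurableSet_le (hfr x) (hfr y))

end RegionTests

section RegionEdges

variable {AP L X E : Type*} {A : TimedAutomaton AP L X E}

theorem shift_nonneg {v : X → ℝ} (hv : ∀ x, 0 ≤ v x) {t : ℝ} (ht : 0 ≤ t) (x : X) :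
    0 ≤ shift v t x := add_nonneg (hv x) ht

/-- The edge of the region automaton induced by the transition from `s` with delay `t` and
edge `e`. -/
noncomputable def TimedAutomaton.redge (A : TimedAutomaton AP L X E) (s : L × (X → ℝ)) (t : ℝ)
    (e : E) : REdge L X E where
  src := A.vertexOf s
  mid := A.regionOf (shift s.2 t)
  edge := e
  tgt := A.vertexOf (A.post s t e)

theorem TimedAutomaton.Run.state_succ {s : L × (X → ℝ)} (ρ : A.Run s) (i : ℕ) :
    ρ.state (i + 1) = A.post (ρ.state i) (ρ.delay i) (ρ.edge i) := (ρ.step i).2.2.2.2.2.1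

theorem TimedAutomaton.Run.isState {s : L × (X → ℝ)} (ρ : A.Run s) (i : ℕ) :
    A.IsState (ρ.state i) := (ρ.step i).1

theorem TimedAutomaton.Run.delay_mem {s : L × (X → ℝ)} (ρ : A.Run s) (i : ℕ) :
    ρ.delay i ∈ A.edgeDelays (ρ.state i) (ρ.edge i) := ⟨_, ρ.step i⟩

theorem TimedAutomaton.redgeOf_eq {s : L × (X → ℝ)} (ρ : A.Run s) (i : ℕ) :
    A.redgeOf ρ i = A.redge (ρ.state i) (ρ.delay i) (ρ.edge i) := by
  rw [redgeOf, redge, ρ.state_succ]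

theorem TimedAutomaton.delay_nonneg {s : L × (X → ℝ)} {t : ℝ} {e : E}
    (h : t ∈ A.edgeDelays s e) : 0 ≤ t := ((A.mem_edgeDelays s e t).1 h).2.2.2.1

theorem TimedAutomaton.nonneg_of_mem {s : L × (X → ℝ)} {t : ℝ} {e : E}
    (h : t ∈ A.edgeDelays s e) : ∀ x, 0 ≤ s.2 x := ((A.mem_edgeDelays s e t).1 h).1

theorem TimedAutomaton.isState_post {s : L × (X → ℝ)} {t : ℝ} {e : E}
    (h : t ∈ A.edgeDelays s e) : A.IsState (A.post s t e) := (step_post h).2.2.2.2.2.2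

theorem TimedAutomaton.isREdge_redge {s : L × (X → ℝ)} {t : ℝ} {e : E}
    (h : t ∈ A.edgeDelays s e) : A.IsREdge (A.redge s t e) := by
  have hs := nonneg_of_mem h
  have ht := delay_nonneg h
  have hp := (isState_post h).1
  exact ⟨regionOf_mem_regions hs, regionOf_mem_regions (shift_nonneg hs ht),
    regionOf_mem_regions hp, s.2, mem_regionOf hs, t, _, mem_regionOf hp, step_post h,
    mem_regionOf (shift_nonneg hs ht)⟩

/-- Every edge of the region automaton is induced by a transition. -/
theorem TimedAutomaton.IsREdge.exists_eq {f : REdge L X E} (hf : A.IsREdge f) :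
    ∃ v t, t ∈ A.edgeDelays (f.src.1, v) f.edge ∧ f = A.redge (f.src.1, v) t f.edge := by
  obtain ⟨h1, h2, h3, v, hv, t, v', hv', hst, ht⟩ := hf
  have hpost := hst.2.2.2.2.2.1
  refine ⟨v, t, ⟨_, hst⟩, ?_⟩
  rw [mem_region_iff h1] at hv
  rw [mem_region_iff h2] at ht
  rw [mem_region_iff h3] at hv'
  ext1
  · exact Prod.ext rfl hv.2.symm
  · exact ht.2.symm
  · rfl
  · rw [redge, ← hpost]
    exact Prod.ext rfl hv'.2.symm

theorem TimedAutomaton.redge_eq_of_regionEquiv {ℓ : L} {v v' : X → ℝ} {t t' : ℝ} {e : E}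
    (h : A.RegionEquiv v v') (h' : A.RegionEquiv (shift v t) (shift v' t')) :
    A.redge (ℓ, v) t e = A.redge (ℓ, v') t' e := by
  ext1
  · exact Prod.ext rfl h.regionOf_eq
  · exact h'.regionOf_eq
  · rfl
  · exact Prod.ext rfl (h'.resetClocks _).regionOf_eq

theorem TimedAutomaton.mem_redgeDelays_redge {s : L × (X → ℝ)} {t : ℝ} {e : E}
    (h : t ∈ A.edgeDelays s e) : t ∈ A.redgeDelays s.2 (A.redge s t e) :=
  ⟨mem_regionOf (shift_nonneg (nonneg_of_mem h) (delay_nonneg h)), h⟩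

/-- The region edges whose label is a loose region; their sets of delays are nondegenerate
intervals. -/
def TimedAutomaton.LooseEdge (A : TimedAutomaton AP L X E) (f : REdge L X E) : Prop :=
  ∀ u ∈ f.mid, A.Loose u

theorem TimedAutomaton.looseEdge_iff {f : REdge L X E} (hf : A.IsREdge f) {u : X → ℝ}
    (hu : u ∈ f.mid) : A.LooseEdge f ↔ A.Loose u := by
  refine ⟨fun h => h u hu, fun h u' hu' => RegionEquiv.loose ?_ h⟩
  have h1 := ((mem_region_iff hf.2.1).1 hu).2
  have h2 := (mem_region_iff hf.2.1).1 hu'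
  exact (regionOf_eq_iff h2.1).1 (h1.trans h2.2.symm)

theorem TimedAutomaton.exists_const_of_not_looseEdge {f : REdge L X E} (hf : A.IsREdge f)
    (h : ¬ A.LooseEdge f) : ∃ (x : X) (c : ℝ), ∀ u ∈ f.mid, u x = c := by
  obtain ⟨u, hu, hr⟩ := hf.2.1
  have hum : u ∈ f.mid := hr ▸ mem_regionOf hu
  rw [looseEdge_iff hf hum] at h
  obtain ⟨x, c, hc⟩ := exists_const_of_not_loose h
  refine ⟨x, c, fun u' hu' => hc u' ?_⟩
  rw [hr] at hu'
  exact hu'.2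

theorem TimedAutomaton.redgeDelays_subsingleton {f : REdge L X E} (hf : A.IsREdge f)
    (h : ¬ A.LooseEdge f) (v : X → ℝ) : (A.redgeDelays v f).Subsingleton := by
  obtain ⟨x, c, hc⟩ := exists_const_of_not_looseEdge hf h
  intro t ht u hu
  have h1 := hc _ ht.1
  have h2 := hc _ hu.1
  simp only [shift] at h1 h2
  linarith

/-- From every state in its source vertex, a region edge can be taken. -/
theorem TimedAutomaton.IsREdge.exists_delay [Finite X] {f : REdge L X E} (hf : A.IsREdge f)
    {s : L × (X → ℝ)} (hs : ∀ x, 0 ≤ s.2 x) (hv : A.vertexOf s = f.src) :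
    ∃ t, 0 ≤ t ∧ shift s.2 t ∈ f.mid := by
  obtain ⟨v, u, hu, hfe⟩ := hf.exists_eq
  have h2 : A.regionOf s.2 = f.src.2 := congrArg Prod.snd hv
  rw [hfe] at h2
  have h3 : A.RegionEquiv v s.2 := (regionOf_eq_iff hs).1 h2.symm
  obtain ⟨t, ht, h⟩ := h3.exists_shift (delay_nonneg hu)
  refine ⟨t, ht, ?_⟩
  rw [hfe]
  exact ⟨shift_nonneg hs ht, h⟩

variable [Finite L] [Finite E]

/-- The possible steps from a state depend on its region and on the region reached by the delay
only. -/
theorem TimedAutomaton.mem_edgeDelays_of_regionEquiv {ℓ : L} {v v' : X → ℝ} {t t' : ℝ} {e : E}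
    (hv' : ∀ x, 0 ≤ v' x) (ht' : 0 ≤ t') (h : A.RegionEquiv v v')
    (h' : A.RegionEquiv (shift v t) (shift v' t')) (ht : t ∈ A.edgeDelays (ℓ, v) e) :
    t' ∈ A.edgeDelays (ℓ, v') e := by
  rw [mem_edgeDelays] at ht ⊢
  obtain ⟨-, h2, h3, -, h5, h6, h7⟩ := ht
  exact ⟨hv', (h.sat_iff fun _ => bound_le_maxConst_of_mem_inv).1 h2, h3, ht',
    (h'.sat_iff fun _ => bound_le_maxConst_of_mem_inv).1 h5,
    (h'.sat_iff fun _ => bound_le_maxConst_of_mem_guard).1 h6,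
    ((h'.resetClocks _).sat_iff fun _ => bound_le_maxConst_of_mem_inv).1 h7⟩

/-- A delay leads from a state in the source of a region edge `f` along `f` if and only if it leads
to the region that labels `f`. -/
theorem TimedAutomaton.IsREdge.step_of_shift_mem {f : REdge L X E} (hf : A.IsREdge f)
    {s : L × (X → ℝ)} (hs : ∀ x, 0 ≤ s.2 x) (hv : A.vertexOf s = f.src) {t : ℝ} (ht : 0 ≤ t)
    (h : shift s.2 t ∈ f.mid) : t ∈ A.edgeDelays s f.edge ∧ A.redge s t f.edge = f := by
  obtain ⟨v, u, hu, hfe⟩ := hf.exists_eq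
  obtain ⟨ℓ, w⟩ := s
  have hℓ : ℓ = f.src.1 := congrArg Prod.fst hv
  have h2 : A.regionOf w = f.src.2 := congrArg Prod.snd hv
  rw [hfe] at h2
  have h3 : A.RegionEquiv v w := (regionOf_eq_iff hs).1 h2.symm
  have h4 : A.RegionEquiv (shift v u) (shift w t) := by
    rw [hfe] at h
    exact h.2
  subst hℓ
  refine ⟨mem_edgeDelays_of_regionEquiv hs ht h3 h4 hu, ?_⟩
  conv_rhs => rw [hfe]
  exact (redge_eq_of_regionEquiv h3 h4).symm

theorem TimedAutomaton.IsREdge.mem_redgeDelays_iff {f : REdge L X E} (hf : A.IsREdge f)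
    {s : L × (X → ℝ)} (hs : ∀ x, 0 ≤ s.2 x) (hv : A.vertexOf s = f.src) {t : ℝ} :
    t ∈ A.redgeDelays s.2 f ↔ 0 ≤ t ∧ shift s.2 t ∈ f.mid := by
  refine ⟨fun h => ⟨?_, h.1⟩, fun h => ⟨h.2, ?_⟩⟩
  · obtain ⟨-, s', h⟩ := h
    exact h.2.2.1
  · have := (hf.step_of_shift_mem hs hv h.1 h.2).1
    have h1 : f.src.1 = s.1 := congrArg Prod.fst hv.symm
    rw [h1]
    exact this

theorem TimedAutomaton.finite_isREdge [Finite X] : {f : REdge L X E | A.IsREdge f}.Finite := by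
  have h := A.finite_regions
  have hV : ((Set.univ : Set L) ×ˢ A.regions).Finite := Set.finite_univ.prod h
  have hfin := (hV.prod (h.prod ((Set.finite_univ (α := E)).prod hV))).image
    fun p => (⟨p.1, p.2.1, p.2.2.1, p.2.2.2⟩ : REdge L X E)
  refine hfin.subset ?_
  rintro f ⟨h1, h2, h3, -⟩
  exact ⟨(f.src, f.mid, f.edge, f.tgt), ⟨⟨trivial, h1⟩, h2, trivial, trivial, h3⟩, rfl⟩

theorem TimedAutomaton.LooseEdge.exists_Ico_subset [Finite X] {f : REdge L X E}
    (hl : A.LooseEdge f) (hf : A.IsREdge f) {s : L × (X → ℝ)} (hs : ∀ x, 0 ≤ s.2 x)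
    (hv : A.vertexOf s = f.src) : ∃ a b, a < b ∧ Set.Ico a b ⊆ A.redgeDelays s.2 f := by
  obtain ⟨t, ht, hm⟩ := hf.exists_delay hs hv
  have h1 := (hl _ hm).eventually_regionEquiv ht
  have hc : Continuous fun u : ℝ => shift s.2 u := by unfold shift; fun_prop
  have h2 := (hc.tendsto t).eventually h1
  obtain ⟨ε, hε, h3⟩ := Metric.eventually_nhds_iff.1 h2
  refine ⟨t, t + ε, by linarith, fun u hu => (hf.mem_redgeDelays_iff hs hv).2
    ⟨ht.trans hu.1, ?_⟩⟩
  have h4 := h3 (y := u) (by rw [Real.dist_eq, abs_lt]; constructor <;> linarith [hu.1, hu.2])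
    s.2 u (.refl _) rfl
  have h5 := ((mem_region_iff hf.2.1).1 hm).2
  refine (mem_region_iff hf.2.1).2 ⟨shift_nonneg hs (ht.trans hu.1), ?_⟩
  rw [← h5]
  exact h4.regionOf_eq.symm

theorem TimedAutomaton.LooseEdge.dimH_redgeDelays [Finite X] {f : REdge L X E}
    (hl : A.LooseEdge f) (hf : A.IsREdge f) {s : L × (X → ℝ)} (hs : ∀ x, 0 ≤ s.2 x)
    (hv : A.vertexOf s = f.src) : dimH (A.redgeDelays s.2 f) = 1 := by
  obtain ⟨a, b, hab, h⟩ := hl.exists_Ico_subset hf hs hv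
  refine Real.dimH_of_mem_nhds (x := (a + b) / 2) (s := A.redgeDelays s.2 f) ?_ |>.trans (by simp)
  exact mem_of_superset (Ico_mem_nhds (by linarith) (by linarith)) h

/-- A region edge is thick if and only if its delays form a nondegenerate interval, or no edge with
the same source has this property. -/
theorem TimedAutomaton.isThickEdge_iff [Finite X] {f : REdge L X E} :
    A.IsThickEdge f ↔ A.IsREdge f ∧
      (A.LooseEdge f ∨ ∀ f', A.IsREdge f' → f'.src = f.src → ¬ A.LooseEdge f') := by
  refine and_congr_right fun hf => ?_
  have hvs : ∀ v ∈ f.src.2, (∀ x, 0 ≤ v x) ∧ A.vertexOf (f.src.1, v) = f.src := fun v hv =>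
    ⟨((mem_region_iff hf.1).1 hv).1, Prod.ext rfl ((mem_region_iff hf.1).1 hv).2⟩
  constructor
  · intro h
    by_contra hcon
    push Not at hcon
    obtain ⟨h1, f', hf', hsrc, hl'⟩ := hcon
    obtain ⟨v, hv⟩ : f.src.2.Nonempty := by
      obtain ⟨v, hv, h⟩ := hf.1
      exact ⟨v, h ▸ mem_regionOf hv⟩
    refine h ⟨v, hv, ?_⟩
    rw [(redgeDelays_subsingleton hf h1 v).dimH_zero]
    calc (0 : ℝ≥0∞) < 1 := zero_lt_one
      _ = dimH (A.redgeDelays v f') := (hl'.dimH_redgeDelays hf' (s := (f.src.1, v)) (hvs v hv).1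
          ((hvs v hv).2.trans hsrc.symm)).symm
      _ ≤ _ := dimH_mono fun t ht => Set.mem_biUnion (show f' ∈ {f' : REdge L X E |
          A.IsREdge f' ∧ f'.src = f.src} from ⟨hf', hsrc⟩) ht
  · rintro (h | h) ⟨v, hv, hlt⟩
    · rw [h.dimH_redgeDelays hf (s := (f.src.1, v)) (hvs v hv).1 (hvs v hv).2] at hlt
      refine hlt.not_ge ((dimH_mono (Set.subset_univ _)).trans ?_)
      rw [Real.dimH_univ]
    · have hfin : {f' : REdge L X E | A.IsREdge f' ∧ f'.src = f.src}.Finite :=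
        A.finite_isREdge.subset fun f' h' => h'.1
      rw [dimH_bUnion hfin.countable] at hlt
      refine hlt.not_ge ((iSup₂_le fun f' hf' => ?_).trans zero_le)
      exact (redgeDelays_subsingleton hf'.1 (h f' hf'.1 hf'.2) v).dimH_zero.le

theorem TimedAutomaton.exists_isThickEdge [Finite X] (hA : A.NonBlocking) {s : L × (X → ℝ)}
    (hs : A.IsState s) : ∃ f, A.IsThickEdge f ∧ f.src = A.vertexOf s := by
  by_cases h : ∃ f, A.IsREdge f ∧ f.src = A.vertexOf s ∧ A.LooseEdge f
  · obtain ⟨f, h1, h2, h3⟩ := h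
    exact ⟨f, isThickEdge_iff.2 ⟨h1, Or.inl h3⟩, h2⟩
  · push Not at h
    obtain ⟨t, ht⟩ := hA s hs
    obtain ⟨e, he⟩ := Set.mem_iUnion.1 ht
    exact ⟨A.redge s t e, isThickEdge_iff.2 ⟨isREdge_redge he, Or.inr h⟩, rfl⟩

end RegionEdges

/-! ### The criterion for filters on runs -/

/-- The values that a sequence takes infinitely often. -/
def infValues {α : Type*} (q : ℕ → α) : Set α := {a | ∃ᶠ i in atTop, q i = a}

theorem infValues_comp {α β : Type*} {F : Set α} (hF : F.Finite) {q : ℕ → α} (hq : ∀ i, q i ∈ F)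
    (g : α → β) : infValues (fun i => g (q i)) = g '' infValues q := by
  ext b
  constructor
  · intro hb
    by_contra hcon
    have h1 : ∀ a ∈ F, ∀ᶠ i in atTop, g a = b → q i ≠ a := by
      intro a _
      by_cases hab : g a = b
      · have : ¬ ∃ᶠ i in atTop, q i = a := fun h => hcon ⟨a, h, hab⟩
        filter_upwards [not_frequently.1 this] with i hi _
        exact hi
      · exact Eventually.of_forall fun i h => absurd h hab
    refine hb ?_
    filter_upwards [(eventually_all_finite hF).2 h1] with i hi hb'
    exact hi (q i) (hq i) hb' rfl
  · rintro ⟨a, ha, rfl⟩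
    exact Frequently.mono ha fun i hi => congrArg g hi

theorem infValues_nonempty {α : Type*} {F : Set α} (hF : F.Finite) {q : ℕ → α}
    (hq : ∀ i, q i ∈ F) : (infValues q).Nonempty := by
  have h := infValues_comp hF hq fun _ => ()
  have h1 : () ∈ infValues fun i => (fun _ => ()) (q i) := Frequently.of_forall fun _ => rfl
  rw [h] at h1
  exact Set.image_nonempty.1 ⟨_, h1⟩

section Graph

variable {AP L X E : Type*} {A : TimedAutomaton AP L X E}

/-- The runs whose image in the region automaton is a path of the thick graph. -/
def TimedAutomaton.ThickRun {s : L × (X → ℝ)} (ρ : A.Run s) : Prop :=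
  ∀ i, A.IsThickEdge (A.redgeOf ρ i)

theorem TimedAutomaton.reach_of_le {f : ℕ → REdge L X E}
    (hf : ∀ i, A.IsThickEdge (f i) ∧ (f i).tgt = (f (i + 1)).src) {i j : ℕ} (hij : i ≤ j) :
    A.Reach (f i).src (f j).src := by
  induction j, hij using Nat.le_induction with
  | base => exact .refl
  | succ j _ ih => exact ih.tail ⟨f j, (hf j).1, rfl, (hf j).2⟩

/-- A path of the thick graph that visits all vertices of a bottom strongly connected component
infinitely often visits no other vertex infinitely often. -/
theorem TimedAutomaton.IsBSCC.infValues_eq {C : Set (L × Set (X → ℝ))} (hC : A.IsBSCC C)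
    {f : ℕ → REdge L X E} (hf : ∀ i, A.IsThickEdge (f i) ∧ (f i).tgt = (f (i + 1)).src)
    (hv : ∀ q ∈ C, ∃ᶠ i in atTop, (f i).src = q) : infValues (fun i => (f i).src) = C := by
  refine Set.Subset.antisymm (fun q hq => ?_) hv
  obtain ⟨q0, hq0⟩ := hC.1
  obtain ⟨i, hi⟩ := (hv q0 hq0).exists
  obtain ⟨j, hij, hj⟩ := (frequently_atTop.1 hq) i
  rw [← hC.2 q0 hq0, ← hi, ← hj]
  exact reach_of_le hf hij

variable [Finite L] [Finite X]

/-- The vertices visited infinitely often by a fair path of the thick graph form a bottom strongly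
connected component. -/
theorem TimedAutomaton.isBSCC_infValues {s : L × (X → ℝ)} {ρ : A.Run s} (ht : A.ThickRun ρ)
    (hfair : A.Fair ρ) : A.IsBSCC (infValues fun i => A.vertexOf (ρ.state i)) := by
  have hpath : ∀ i, A.IsThickEdge (A.redgeOf ρ i) ∧
      (A.redgeOf ρ i).tgt = (A.redgeOf ρ (i + 1)).src := fun i => ⟨ht i, rfl⟩
  refine ⟨?_, fun q hq q' => ⟨fun h => ?_, fun hq' => ?_⟩⟩
  · exact infValues_nonempty (Set.finite_univ.prod A.finite_regions) fun i =>
      ⟨trivial, regionOf_mem_regions (ρ.isState i).1⟩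
  · induction h with
    | refl => exact hq
    | tail _ hstep ih =>
      obtain ⟨f, hf, rfl, rfl⟩ := hstep
      have h1 := hfair f hf ih
      refine frequently_atTop.2 fun n => ?_
      obtain ⟨i, hi, h2⟩ := frequently_atTop.1 h1 n
      exact ⟨i + 1, by omega, congrArg REdge.tgt h2⟩
  · obtain ⟨i, hi⟩ := hq.exists
    obtain ⟨j, hij, hj⟩ := frequently_atTop.1 hq' i
    rw [← hi, ← hj]
    exact reach_of_le hpath hij

/-- The common core of the almost-sure and of the topological criterion. The filter stands for the
sets of full measure or for the residual sets: all that matters is that it contains the fair runs in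
the thick graph, and that reaching a given vertex of the thick graph is not negligible. -/
theorem TimedAutomaton.eventually_sem_iff_condS {s : L × (X → ℝ)} {P : Set (ℕ → Set AP)}
    (hP : PrefixIndependent P) (F : Filter (A.Run s))
    (hF : ∀ᶠ ρ in F, A.ThickRun ρ ∧ A.Fair ρ)
    (hreach : ∀ q, A.Reach (A.vertexOf s) q → ∃ᶠ ρ in F, ∃ n, A.vertexOf (ρ.state n) = q) :
    (∀ᶠ ρ in F, ρ ∈ A.sem s P) ↔ A.CondS s P := by
  have hV : ((Set.univ : Set L) ×ˢ A.regions).Finite := Set.finite_univ.prod A.finite_regions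
  have hpath : ∀ ρ : A.Run s, A.ThickRun ρ → ∀ i, A.IsThickEdge (A.redgeOf ρ i) ∧
      (A.redgeOf ρ i).tgt = (A.redgeOf ρ (i + 1)).src := fun ρ ht i => ⟨ht i, rfl⟩
  constructor
  · rintro h C hC ⟨q, hq, hsq⟩ f hf hv
    obtain ⟨ρ, ⟨n, hn⟩, ⟨ht, hfair⟩, hρ⟩ := ((hreach q hsq).and_eventually (hF.and h)).exists
    have hI := isBSCC_infValues ht hfair
    -- the run is caught in `C`, hence visits exactly the vertices of `C` infinitely often
    have hIC : infValues (fun i => A.vertexOf (ρ.state i)) = C := by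
      have hsub : infValues (fun i => A.vertexOf (ρ.state i)) ⊆ C := by
        intro q' hq'
        obtain ⟨j, hij, hj⟩ := frequently_atTop.1 hq' n
        rw [← hC.2 q hq, ← hn, ← hj]
        exact reach_of_le (hpath ρ ht) hij
      refine hsub.antisymm fun q' hq' => ?_
      obtain ⟨q'', hq''⟩ := hI.1
      exact (hI.2 q'' hq'' q').1 ((hC.2 q'' (hsub hq'') q').2 hq')
    refine (hP (A.word ρ) _ ?_).1 hρ
    have h1 : infLetters (A.word ρ) = (fun q => A.label q.1) '' C := by
      rw [← hIC]
      exact infValues_comp (q := fun i => A.vertexOf (ρ.state i)) (g := fun q => A.label q.1) hV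
        fun i => ⟨trivial, regionOf_mem_regions (ρ.isState i).1⟩
    have h2 : infLetters (fun i => A.label (f i).src.1) = (fun q => A.label q.1) '' C := by
      rw [← hC.infValues_eq hf hv]
      exact infValues_comp (g := fun q => A.label q.1) hV fun i => ⟨trivial, (hf i).1.1.1⟩
    rw [h1, h2]
  · intro h
    filter_upwards [hF] with ρ ⟨ht, hfair⟩
    have hI := isBSCC_infValues ht hfair
    obtain ⟨q, hq⟩ := hI.1
    refine h _ hI ⟨q, hq, ?_⟩ (A.redgeOf ρ) (hpath ρ ht) fun q hq => hq
    obtain ⟨i, hi⟩ := hq.exists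
    have h1 := reach_of_le (hpath ρ ht) (Nat.zero_le i)
    have h2 : (A.redgeOf ρ 0).src = A.vertexOf s := by
      show A.vertexOf (ρ.state 0) = _
      rw [ρ.start]
    rw [h2] at h1
    rw [← hi]
    exact h1

end Graph

/-! ### Finite paths and their polyhedra -/

section Trace

variable {AP L X E : Type*} {A : TimedAutomaton AP L X E}

/-- Extension of a finite sequence of delays by zeros. -/
def extend {n : ℕ} (τ : Fin n → ℝ) : ℕ → ℝ := fun i => if h : i < n then τ ⟨i, h⟩ else 0

/-- The first `i` entries of a finite sequence. -/
def restr {n : ℕ} (i : ℕ) (hi : i ≤ n) (τ : Fin n → ℝ) : Fin i → ℝ := fun j => τ (j.castLE hi)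

theorem extend_apply {n : ℕ} (τ : Fin n → ℝ) {i : ℕ} (hi : i < n) : extend τ i = τ ⟨i, hi⟩ :=
  dif_pos hi

theorem extend_restr {n i j : ℕ} (hi : i ≤ n) (τ : Fin n → ℝ) (hj : j < i) :
    extend (restr i hi τ) j = extend τ j := by
  rw [extend_apply _ hj, extend_apply _ (hj.trans_le hi)]
  rfl

theorem extend_init {n j : ℕ} (τ : Fin (n + 1) → ℝ) (hj : j < n) :
    extend (Fin.init τ) j = extend τ j := extend_restr n.le_succ τ hj

theorem extend_last {n : ℕ} (τ : Fin (n + 1) → ℝ) : extend τ n = τ (Fin.last n) :=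
  extend_apply _ n.lt_succ_self

theorem contDiff_extend (n i : ℕ) : ContDiff ℝ 1 fun τ : Fin n → ℝ => extend τ i := by
  by_cases hi : i < n
  · simp only [extend_apply _ hi]
    exact contDiff_apply ℝ ℝ _
  · simp only [extend, dif_neg hi]
    exact contDiff_const

theorem contDiff_restr {n i : ℕ} (hi : i ≤ n) : ContDiff ℝ 1 (restr (n := n) i hi) :=
  contDiff_pi.2 fun _ => contDiff_apply ℝ ℝ _

/-- The configuration reached from `s` after `n` steps with given edges and delays. -/
noncomputable def TimedAutomaton.trace (A : TimedAutomaton AP L X E) (s : L × (X → ℝ)) (e : ℕ → E)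
    (τ : ℕ → ℝ) : ℕ → L × (X → ℝ)
  | 0 => s
  | n + 1 => A.post (TimedAutomaton.trace A s e τ n) (τ n) (e n)

variable {s : L × (X → ℝ)} {e e' : ℕ → E} {τ τ' : ℕ → ℝ} {n : ℕ}

theorem TimedAutomaton.trace_congr (he : ∀ i < n, e i = e' i) (hτ : ∀ i < n, τ i = τ' i) :
    A.trace s e τ n = A.trace s e' τ' n := by
  induction n with
  | zero => rfl
  | succ n ih =>
    rw [trace, trace, ih (fun i hi => he i (by omega)) (fun i hi => hτ i (by omega)),
      he n (by omega), hτ n (by omega)]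

theorem TimedAutomaton.trace_cons (n : ℕ) : A.trace s e τ (n + 1) =
    A.trace (A.post s (τ 0) (e 0)) (fun i => e (i + 1)) (fun i => τ (i + 1)) n := by
  induction n with
  | zero => rfl
  | succ n ih => rw [trace, ih, trace]

theorem TimedAutomaton.Run.state_eq_trace (ρ : A.Run s) (n : ℕ) :
    ρ.state n = A.trace s ρ.edge ρ.delay n := by
  induction n with
  | zero => exact ρ.start
  | succ n ih => rw [ρ.state_succ, ih, trace]

/-- The edges and delays define a path of `n` steps from `s`. -/
def TimedAutomaton.Valid (A : TimedAutomaton AP L X E) (s : L × (X → ℝ)) (e : ℕ → E) (τ : ℕ → ℝ)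
    (n : ℕ) : Prop := ∀ i < n, τ i ∈ A.edgeDelays (A.trace s e τ i) (e i)

theorem TimedAutomaton.Valid.congr (h : A.Valid s e τ n) (he : ∀ i < n, e i = e' i)
    (hτ : ∀ i < n, τ i = τ' i) : A.Valid s e' τ' n := fun i hi => by
  rw [← trace_congr (fun j hj => he j (hj.trans hi)) (fun j hj => hτ j (hj.trans hi)), ← he i hi,
    ← hτ i hi]
  exact h i hi

theorem TimedAutomaton.Valid.isState (h : A.Valid s e τ n) (hs : A.IsState s) :
    A.IsState (A.trace s e τ n) := by
  cases n with
  | zero => exact hs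
  | succ n => exact isState_post (h n n.lt_succ_self)

theorem TimedAutomaton.Valid.mono {m : ℕ} (h : A.Valid s e τ n) (hm : m ≤ n) : A.Valid s e τ m :=
  fun i hi => h i (hi.trans_le hm)

theorem TimedAutomaton.Run.valid (ρ : A.Run s) (n : ℕ) : A.Valid s ρ.edge ρ.delay n :=
  fun i _ => by rw [← ρ.state_eq_trace]; exact ρ.delay_mem i

theorem TimedAutomaton.exists_run_of_forall_valid (h : ∀ n, A.Valid s e τ n) :
    ∃ ρ : A.Run s, ρ.edge = e ∧ ρ.delay = τ :=
  ⟨{ state := A.trace s e τ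
     delay := τ
     edge := e
     start := rfl
     step := fun i => step_post (h (i + 1) i i.lt_succ_self) }, rfl, rfl⟩

/-- Every finite path extends to an infinite run if the automaton is non-blocking. -/
theorem TimedAutomaton.exists_run (hA : A.NonBlocking) (hs : A.IsState s) (h : A.Valid s e τ n) :
    ∃ ρ : A.Run s, ∀ i < n, ρ.edge i = e i ∧ ρ.delay i = τ i := by
  classical
  have hne : ∀ s, ∃ p : ℝ × E, A.IsState s → p.1 ∈ A.edgeDelays s p.2 := by
    intro s'
    by_cases hs' : A.IsState s'
    · obtain ⟨t, ht⟩ := hA s' hs'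
      obtain ⟨e, he⟩ := Set.mem_iUnion.1 ht
      exact ⟨(t, e), fun _ => he⟩
    · exact ⟨(0, e 0), fun h => absurd h hs'⟩
  choose c hc using hne
  let d : ℕ → L × (X → ℝ) → ℝ × E := fun i s => if i < n then (τ i, e i) else c s
  let st : ℕ → L × (X → ℝ) := fun i => Nat.rec s (fun i s => A.post s (d i s).1 (d i s).2) i
  have hst : ∀ i ≤ n, st i = A.trace s e τ i := by
    intro i hi
    induction i with
    | zero => rfl
    | succ i ih =>
      have h1 : st (i + 1) = A.post (st i) (d i (st i)).1 (d i (st i)).2 := rfl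
      have h2 : d i (st i) = (τ i, e i) := if_pos (by omega)
      rw [h1, h2, ih (by omega), trace]
  have hd : ∀ i, A.IsState (st i) → (d i (st i)).1 ∈ A.edgeDelays (st i) (d i (st i)).2 := by
    intro i hi
    by_cases hin : i < n
    · have h2 : d i (st i) = (τ i, e i) := if_pos hin
      rw [h2, hst i hin.le]
      exact h i hin
    · have h2 : d i (st i) = c (st i) := if_neg hin
      rw [h2]
      exact hc _ hi
  have hS : ∀ i, A.IsState (st i) := by
    intro i
    induction i with
    | zero => exact hs
    | succ i ih => exact isState_post (hd i ih)
  refine ⟨{ state := st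
            delay := fun i => (d i (st i)).1
            edge := fun i => (d i (st i)).2
            start := rfl
            step := fun i => step_post (hd i (hS i)) }, fun i hi => ?_⟩
  have h2 : d i (st i) = (τ i, e i) := if_pos hi
  exact ⟨congrArg Prod.snd h2, congrArg Prod.fst h2⟩

/-- The polyhedron of the unconstrained path along the first `n` edges of `e`. -/
def TimedAutomaton.poly (A : TimedAutomaton AP L X E) (s : L × (X → ℝ)) (e : ℕ → E) (n : ℕ) :
    Set (Fin n → ℝ) := {τ | A.Valid s e (extend τ) n}

theorem TimedAutomaton.pol_eq (C : Set (Fin n → ℝ)) :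
    A.pol s (fun i : Fin n => e i) C = C ∩ A.poly s e n := by
  ext τ
  refine and_congr_right fun _ => ⟨?_, fun h => ?_⟩
  · rintro ⟨σ, h0, hσ⟩
    have hst : ∀ i (hi : i < n + 1), σ ⟨i, hi⟩ = A.trace s e (extend τ) i := by
      intro i hi
      induction i with
      | zero => exact h0
      | succ i ih =>
        have h1 := (hσ ⟨i, by omega⟩).2.2.2.2.2.1
        rw [trace, ← ih (by omega), extend_apply τ (by omega)]
        exact h1
    intro i hi
    rw [← hst i (by omega), extend_apply τ hi]
    exact ⟨_, hσ ⟨i, hi⟩⟩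
  · refine ⟨fun i => A.trace s e (extend τ) i, rfl, fun i => ?_⟩
    have h1 := step_post (h i i.isLt)
    rw [extend_apply τ i.isLt] at h1
    simp only [Fin.val_succ, trace, Fin.val_castSucc]
    rw [extend_apply τ i.isLt]
    exact h1

theorem TimedAutomaton.restr_mem_poly {i : ℕ} (hi : i ≤ n) {τ : Fin n → ℝ}
    (h : τ ∈ A.poly s e n) : restr i hi τ ∈ A.poly s e i :=
  (Valid.mono h hi).congr (fun _ _ => rfl) fun _ hj => (extend_restr hi τ hj).symm

theorem TimedAutomaton.mem_poly_succ {τ : Fin (n + 1) → ℝ} : τ ∈ A.poly s e (n + 1) ↔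
    Fin.init τ ∈ A.poly s e n ∧
      τ (Fin.last n) ∈ A.edgeDelays (A.trace s e (extend (Fin.init τ)) n) (e n) := by
  have h1 : A.trace s e (extend (Fin.init τ)) n = A.trace s e (extend τ) n :=
    trace_congr (fun _ _ => rfl) fun j hj => extend_init τ hj
  rw [h1, ← extend_last τ]
  constructor
  · intro h
    exact ⟨restr_mem_poly n.le_succ h, h n n.lt_succ_self⟩
  · rintro ⟨h2, h3⟩ i hi
    rcases Nat.lt_succ_iff_lt_or_eq.1 hi with h4 | rfl
    · exact (Valid.congr h2 (fun _ _ => rfl) fun j hj => extend_init τ hj) i h4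
    · exact h3

/-- The continuations by one delay of the delay sequences in `T`, along any edge. -/
def TimedAutomaton.fan (A : TimedAutomaton AP L X E) (s : L × (X → ℝ)) (e : ℕ → E) (i : ℕ)
    (T : Set (Fin i → ℝ)) : Set (Fin (i + 1) → ℝ) :=
  {τ | Fin.init τ ∈ T ∧ τ (Fin.last i) ∈ A.delays (A.trace s e (extend (Fin.init τ)) i)}

theorem TimedAutomaton.fan_mono {i : ℕ} {T T' : Set (Fin i → ℝ)} (h : T ⊆ T') :
    A.fan s e i T ⊆ A.fan s e i T' := fun _ hτ => ⟨h hτ.1, hτ.2⟩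

/-- Thickness of a path with nonempty polyhedron `S`: the dimension of each projection of `S` is the
dimension of the set of all continuations of the previous projection. -/
def TimedAutomaton.ThickSet (A : TimedAutomaton AP L X E) (s : L × (X → ℝ)) (e : ℕ → E) (n : ℕ)
    (S : Set (Fin n → ℝ)) : Prop :=
  ∀ i (hi : i < n), dimH (A.fan s e i (restr i hi.le '' S)) ≤ dimH (restr (i + 1) hi '' S)

theorem TimedAutomaton.not_isThinPath_iff {C : Set (Fin n → ℝ)}
    (hne : (C ∩ A.poly s e n).Nonempty) :
    ¬ A.IsThinPath s (fun i : Fin n => e i) C ↔ A.ThickSet s e n (C ∩ A.poly s e n) := by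
  have hproj : ∀ i (hi : i ≤ n), A.proj s (fun i : Fin n => e i) C i hi =
      restr i hi '' (C ∩ A.poly s e n) := by
    intro i hi
    rw [proj, pol_eq]
    ext τ
    constructor
    · rintro (rfl | ⟨τ', h, h'⟩)
      · obtain ⟨τ', h⟩ := hne
        exact ⟨τ', h, funext fun j => j.elim0⟩
      · exact ⟨τ', h, funext fun j => (h' j).symm⟩
    · rintro ⟨τ', h, rfl⟩
      exact Or.inr ⟨τ', h, fun _ => rfl⟩
  unfold IsThinPath ThickSet
  push Not
  rw [Fin.forall_iff]
  refine forall₂_congr fun i hi => ?_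
  rw [hproj, hproj]
  have h1 : A.pol s (fun j : Fin (i + 1) => e (j.castLE hi : Fin n))
      (restr (i + 1) hi '' (C ∩ A.poly s e n)) = restr (i + 1) hi '' (C ∩ A.poly s e n) := by
    have := pol_eq (A := A) (s := s) (e := e) (restr (i + 1) hi '' (C ∩ A.poly s e n))
    refine this.trans (Set.inter_eq_left.2 ?_)
    rintro _ ⟨τ, hτ, rfl⟩
    exact restr_mem_poly hi hτ.2
  have h2 : (⋃ e' : E, A.pol s
      (Fin.snoc (α := fun _ => E) (fun j : Fin i => e (j.castLE hi.le : Fin n)) e')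
      {τ : Fin (i + 1) → ℝ | (fun j : Fin i => τ j.castSucc) ∈
        restr i hi.le '' (C ∩ A.poly s e n)}) =
      A.fan s e i (restr i hi.le '' (C ∩ A.poly s e n)) := by
    have h3 : ∀ e' : E, (Fin.snoc (α := fun _ => E)
        (fun j : Fin i => e (j.castLE hi.le : Fin n)) e' : Fin (i + 1) → E) =
        fun j : Fin (i + 1) => Function.update e i e' j := by
      intro e'
      funext j
      refine Fin.lastCases ?_ (fun j => ?_) j
      · simp
      · simp [Function.update_of_ne j.isLt.ne]
    have h4 : ∀ (e' : E) (τ : Fin (i + 1) → ℝ),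
        A.trace s (Function.update e i e') (extend (Fin.init τ)) i =
          A.trace s e (extend (Fin.init τ)) i :=
      fun e' τ => trace_congr (fun j hj => Function.update_of_ne hj.ne _ _) fun _ _ => rfl
    ext τ
    simp only [h3, pol_eq, Set.mem_iUnion, Set.mem_inter_iff, mem_poly_succ, h4,
      Function.update_self]
    constructor
    · rintro ⟨e', h, -, h5⟩
      exact ⟨h, Set.mem_iUnion.2 ⟨e', h5⟩⟩
    · rintro ⟨h, h5⟩
      obtain ⟨e', h5⟩ := Set.mem_iUnion.1 h5
      refine ⟨e', h, ?_, h5⟩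
      obtain ⟨τ', h6, h7⟩ := h
      rw [← h7]
      exact Valid.congr (restr_mem_poly hi.le h6.2)
        (fun j hj => (Function.update_of_ne hj.ne _ _).symm) fun _ _ => rfl
  exact iff_of_eq (congrArg₂ (· ≤ ·) (congrArg dimH h2) (congrArg dimH h1))

theorem TimedAutomaton.trace_fst (τ τ' : ℕ → ℝ) (n : ℕ) :
    (A.trace s e τ n).1 = (A.trace s e τ' n).1 := by
  cases n <;> rfl

theorem TimedAutomaton.contDiff_trace (i : ℕ) (x : X) :
    ContDiff ℝ 1 fun τ : Fin n → ℝ => (A.trace s e (extend τ) i).2 x := by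
  induction i with
  | zero => exact contDiff_const (c := s.2 x)
  | succ i ih =>
    simp only [trace, post, resetClocks, shift]
    split_ifs
    · exact contDiff_const
    · exact ih.add (contDiff_extend n i)

theorem TimedAutomaton.continuous_trace (i : ℕ) :
    Continuous fun τ : Fin n → ℝ => (A.trace s e (extend τ) i).2 :=
  continuous_pi fun x => (contDiff_trace i x).continuous

theorem TimedAutomaton.continuous_shift_trace (i : ℕ) :
    Continuous fun τ : Fin n → ℝ => shift (A.trace s e (extend τ) i).2 (extend τ i) :=
  continuous_pi fun x => ((contDiff_trace i x).add (contDiff_extend n i)).continuous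

theorem shift_comb {v v' : X → ℝ} {t t' a b : ℝ} :
    shift (a • v + b • v') (a * t + b * t') = a • shift v t + b • shift v' t' := by
  funext x
  simp only [shift, Pi.add_apply, Pi.smul_apply, smul_eq_mul]
  ring

theorem resetClocks_comb (Y : Set X) {v v' : X → ℝ} {a b : ℝ} :
    resetClocks Y (a • v + b • v') = a • resetClocks Y v + b • resetClocks Y v' := by
  funext x
  simp only [resetClocks, Pi.add_apply, Pi.smul_apply, smul_eq_mul]
  split_ifs <;> simp

theorem extend_comb (τ τ' : Fin n → ℝ) (a b : ℝ) (i : ℕ) :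
    extend (a • τ + b • τ') i = a * extend τ i + b * extend τ' i := by
  unfold extend
  split_ifs <;> simp

theorem TimedAutomaton.trace_comb (τ τ' : Fin n → ℝ) {a b : ℝ} (hab : a + b = 1) (i : ℕ) :
    (A.trace s e (extend (a • τ + b • τ')) i).2 =
      a • (A.trace s e (extend τ) i).2 + b • (A.trace s e (extend τ') i).2 := by
  induction i with
  | zero => rw [trace, trace, trace, ← add_smul, hab, one_smul]
  | succ i ih => rw [trace, trace, trace, post, post, post, ih, extend_comb, shift_comb,
      resetClocks_comb]

theorem Guard.Sat.comb {g : Guard X} {v v' : X → ℝ} (h : g.Sat v) (h' : g.Sat v') {a b : ℝ}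
    (ha : 0 ≤ a) (hb : 0 ≤ b) (hab : a + b = 1) : g.Sat (a • v + b • v') := by
  intro c hc
  have h1 := h c hc
  have h2 := h' c hc
  cases hcmp : c.cmp <;> simp only [hcmp, Cmp.Holds, Pi.add_apply, Pi.smul_apply] at *
  · exact (convex_Iio (𝕜 := ℝ) (c.bound : ℝ)) (Set.mem_Iio.2 h1) (Set.mem_Iio.2 h2) ha hb hab
  · exact (convex_Iic (𝕜 := ℝ) (c.bound : ℝ)) (Set.mem_Iic.2 h1) (Set.mem_Iic.2 h2) ha hb hab
  · rw [h1, h2, ← add_smul, hab, one_smul]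
  · exact (convex_Ici (𝕜 := ℝ) (c.bound : ℝ)) (Set.mem_Ici.2 h1) (Set.mem_Ici.2 h2) ha hb hab
  · exact (convex_Ioi (𝕜 := ℝ) (c.bound : ℝ)) (Set.mem_Ioi.2 h1) (Set.mem_Ioi.2 h2) ha hb hab

theorem TimedAutomaton.convex_poly : Convex ℝ (A.poly s e n) := by
  intro τ hτ τ' hτ' a b ha hb hab i hi
  have h1 := hτ i hi
  have h2 := hτ' i hi
  rw [mem_edgeDelays] at h1 h2 ⊢
  rw [trace_fst (extend τ') (extend τ)] at h2
  rw [trace_fst (extend (a • τ + b • τ')) (extend τ), post, trace_comb τ τ' hab, extend_comb,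
    shift_comb, resetClocks_comb]
  obtain ⟨p1, p2, p3, p4, p5, p6, p7⟩ := h1
  obtain ⟨q1, q2, -, q4, q5, q6, q7⟩ := h2
  refine ⟨fun x => ?_, p2.comb q2 ha hb hab, p3, by positivity, p5.comb q5 ha hb hab,
    p6.comb q6 ha hb hab, p7.comb q7 ha hb hab⟩
  exact add_nonneg (mul_nonneg ha (p1 x)) (mul_nonneg hb (q1 x))

theorem Guard.isLocallyClosed_sat (g : Guard X) : IsLocallyClosed {v : X → ℝ | g.Sat v} := by
  induction g with
  | nil => simpa [Guard.Sat] using isOpen_univ.isLocallyClosed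
  | cons a g ih =>
    have : {v : X → ℝ | Guard.Sat (a :: g) v} =
        {v | a.cmp.Holds (v a.clock) (a.bound : ℝ)} ∩ {v | Guard.Sat g v} := by
      ext v; simp [Guard.Sat]
    rw [this]
    refine IsLocallyClosed.inter ?_ ih
    have hc : Continuous fun v : X → ℝ => v a.clock := continuous_apply _
    cases a.cmp <;> simp only [Cmp.Holds]
    · exact (isOpen_lt hc continuous_const).isLocallyClosed
    · exact (isClosed_le hc continuous_const).isLocallyClosed
    · exact (isClosed_eq hc continuous_const).isLocallyClosed
    · exact (isClosed_le continuous_const hc).isLocallyClosed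
    · exact (isOpen_lt continuous_const hc).isLocallyClosed

theorem TimedAutomaton.isLocallyClosed_poly : IsLocallyClosed (A.poly s e n) := by
  have key : ∀ i, IsLocallyClosed
      {τ : Fin n → ℝ | extend τ i ∈ A.edgeDelays (A.trace s e (extend τ) i) (e i)} := by
    intro i
    have hv := continuous_trace (A := A) (s := s) (e := e) (n := n) i
    have hw := continuous_shift_trace (A := A) (s := s) (e := e) (n := n) i
    have hu := continuous_trace (A := A) (s := s) (e := e) (n := n) (i + 1)
    have hℓ : ∀ τ : Fin n → ℝ, (A.trace s e (extend τ) i).1 = (A.trace s e (fun _ => 0) i).1 :=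
      fun τ => trace_fst _ _ i
    simp only [mem_edgeDelays, hℓ]
    refine IsLocallyClosed.inter ?_ (IsLocallyClosed.inter ?_ (IsLocallyClosed.inter ?_
      (IsLocallyClosed.inter ?_ (IsLocallyClosed.inter ?_ (IsLocallyClosed.inter ?_ ?_)))))
    · show IsLocallyClosed {τ : Fin n → ℝ | ∀ x, _}
      rw [Set.ofPred_forall]
      exact (isClosed_iInter fun x => isClosed_le continuous_const
        ((continuous_apply x).comp hv)).isLocallyClosed
    · exact (Guard.isLocallyClosed_sat _).preimage hv
    · show IsLocallyClosed {τ : Fin n → ℝ | _}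
      by_cases h : A.source (e i) = (A.trace s e (fun _ => 0) i).1
      · simpa [h] using isOpen_univ.isLocallyClosed
      · simpa [h] using isOpen_empty.isLocallyClosed
    · exact (isClosed_le continuous_const (contDiff_extend n i).continuous).isLocallyClosed
    · exact (Guard.isLocallyClosed_sat _).preimage hw
    · exact (Guard.isLocallyClosed_sat _).preimage hw
    · exact (Guard.isLocallyClosed_sat _).preimage hu
  have hall : ∀ m, IsLocallyClosed {τ : Fin n → ℝ | A.Valid s e (extend τ) m} := by
    intro m
    induction m with
    | zero => simpa [Valid] using isOpen_univ.isLocallyClosed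
    | succ m ih =>
      have : {τ : Fin n → ℝ | A.Valid s e (extend τ) (m + 1)} =
          {τ | A.Valid s e (extend τ) m} ∩
          {τ | extend τ m ∈ A.edgeDelays (A.trace s e (extend τ) m) (e m)} := by
        ext τ
        exact Nat.forall_lt_succ_right
      rw [this]
      exact ih.inter (key m)
  exact hall n

end Trace

/-! ### Hausdorff dimension of convex sets -/

section Dimension

open Module

/-- A neighbourhood of a point in a convex set contains scaled copies of all bounded parts of the
set, so the dimension of a linear image of a convex set can be read off near any point. -/
theorem dimH_image_convex_le {V W : Type*} [NormedAddCommGroup V] [NormedSpace ℝ V]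
    [NormedAddCommGroup W] [NormedSpace ℝ W] (f : V →ₗ[ℝ] W) {K O : Set V} (hK : Convex ℝ K)
    (hO : IsOpen O) {x : V} (hxK : x ∈ K) (hxO : x ∈ O) :
    dimH (f '' K) ≤ dimH (f '' (K ∩ O)) := by
  have hcov : f '' K = ⋃ m : ℕ, f '' (K ∩ Metric.ball x m) := by
    rw [← Set.image_iUnion, ← Set.inter_iUnion, Metric.iUnion_ball_nat, Set.inter_univ]
  rw [hcov, dimH_iUnion]
  refine iSup_le fun m => ?_
  obtain ⟨ε, hε, hball⟩ := Metric.isOpen_iff.1 hO x hxO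
  obtain ⟨l, hl0, hl1, hl⟩ : ∃ l : ℝ, 0 < l ∧ l ≤ 1 ∧ l * m < ε := by
    refine ⟨min 1 (ε / (m + 1)), by positivity, min_le_left _ _, ?_⟩
    have hm : (0 : ℝ) < m + 1 := by positivity
    calc min 1 (ε / (m + 1)) * m ≤ ε / (m + 1) * m := by gcongr; exact min_le_right _ _
      _ < ε / (m + 1) * (m + 1) := by gcongr; linarith
      _ = ε := by field_simp
  let h : W → W := fun y => f x + l • (y - f x)
  have hanti : AntilipschitzWith (Real.toNNReal l⁻¹) h := by
    refine AntilipschitzWith.of_le_mul_dist fun y z => ?_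
    rw [Real.coe_toNNReal _ (inv_nonneg.2 hl0.le)]
    simp only [h, dist_add_left, dist_smul₀, dist_sub_right, Real.norm_eq_abs, abs_of_pos hl0]
    rw [inv_mul_cancel_left₀ hl0.ne']
  refine (hanti.le_dimH_image _).trans (dimH_mono ?_)
  rintro _ ⟨_, ⟨y, ⟨hyK, hy⟩, rfl⟩, rfl⟩
  refine ⟨x + l • (y - x), ⟨?_, hball ?_⟩, by simp [h]⟩
  · have := hK hxK hyK (a := 1 - l) (b := l) (by linarith) hl0.le (by ring)
    convert this using 1
    rw [smul_sub, sub_smul, one_smul]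
    abel
  · rw [Metric.mem_ball, dist_eq_norm, add_sub_cancel_left, norm_smul, Real.norm_eq_abs,
      abs_of_pos hl0]
    rw [Metric.mem_ball, dist_eq_norm] at hy
    calc l * ‖y - x‖ ≤ l * m := by gcongr
      _ < ε := hl

theorem dimH_convex_le {V : Type*} [NormedAddCommGroup V] [NormedSpace ℝ V]
    {K O : Set V} (hK : Convex ℝ K) (hO : IsOpen O) {x : V} (hxK : x ∈ K) (hxO : x ∈ O) :
    dimH K ≤ dimH (K ∩ O) := by
  simpa using dimH_image_convex_le LinearMap.id hK hO hxK hxO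

/-- The half-open cylinder over a set of finite sequences: one more, nonnegative, entry. -/
def prism {n : ℕ} (K : Set (Fin n → ℝ)) : Set (Fin (n + 1) → ℝ) :=
  {τ | Fin.init τ ∈ K ∧ 0 ≤ τ (Fin.last n)}

theorem convex_prism {n : ℕ} {K : Set (Fin n → ℝ)} (hK : Convex ℝ K) : Convex ℝ (prism K) := by
  rintro τ ⟨h1, h2⟩ τ' ⟨h1', h2'⟩ a b ha hb hab
  exact ⟨hK h1 h1' ha hb hab, add_nonneg (mul_nonneg ha h2) (mul_nonneg hb h2')⟩

/-- The cylinder over a nonempty convex set has larger dimension than the set. With `W` the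
direction of the affine span of `K`, the set `K` lies in a copy of `W`, while its cylinder contains
a copy of a nonempty open subset of `W × ℝ`. -/
theorem dimH_lt_dimH_prism {n : ℕ} {K : Set (Fin n → ℝ)} (hK : Convex ℝ K) (hne : K.Nonempty) :
    dimH K < dimH (prism K) := by
  obtain ⟨_, p, hp, rfl⟩ := hne.intrinsicInterior hK
  let W := (affineSpan ℝ K).direction
  have h1 : dimH K ≤ finrank ℝ W := by
    have hsub : K ⊆ (fun w : W => (w : Fin n → ℝ) + p) '' Set.univ := by
      intro y hy
      refine ⟨⟨y - p, AffineSubspace.vsub_mem_direction (subset_affineSpan ℝ K hy) p.2⟩, trivial, ?_⟩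
      simp
    have hlip : LipschitzWith 1 fun w : W => (w : Fin n → ℝ) + p :=
      LipschitzWith.of_dist_le_mul fun a b => by simp [Subtype.dist_eq]
    rw [← Real.dimH_univ_eq_finrank]
    exact (dimH_mono hsub).trans (hlip.dimH_image_le _)
  have h2 : ((finrank ℝ W + 1 : ℕ) : ℝ≥0∞) ≤ dimH (prism K) := by
    let g : W × ℝ → (Fin (n + 1) → ℝ) := fun q =>
      Fin.snoc (α := fun _ => ℝ) ((q.1 : Fin n → ℝ) + p) q.2
    have hanti : AntilipschitzWith 1 g := by
      refine AntilipschitzWith.of_le_mul_dist fun a b => ?_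
      rw [NNReal.coe_one, one_mul, Prod.dist_eq]
      refine max_le ?_ ?_
      · have : dist a.1 b.1 = dist ((a.1 : Fin n → ℝ) + p) ((b.1 : Fin n → ℝ) + p) := by
          rw [dist_add_right]; rfl
        rw [this]
        refine (dist_pi_le_iff dist_nonneg).2 fun i => ?_
        have := dist_le_pi_dist (g a) (g b) i.castSucc
        simpa [g] using this
      · have := dist_le_pi_dist (g a) (g b) (Fin.last n)
        simpa [g] using this
    let c : W → affineSpan ℝ K := fun w => ⟨(w : Fin n → ℝ) + p,
      AffineSubspace.vadd_mem_of_mem_direction w.2 p.2⟩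
    have hc : Continuous c := by
      refine Continuous.subtype_mk ?_ _
      fun_prop
    let U : Set (W × ℝ) := (c ⁻¹' interior ((↑) ⁻¹' K)) ×ˢ Set.Ioi 0
    have hU : IsOpen U := (isOpen_interior.preimage hc).prod isOpen_Ioi
    have hUne : U.Nonempty := by
      refine ⟨(0, 1), ?_, Set.mem_Ioi.2 one_pos⟩
      have : c 0 = p := Subtype.ext (by simp [c])
      show c 0 ∈ interior ((↑) ⁻¹' K : Set (affineSpan ℝ K))
      rw [this]
      exact hp
    have hdim : dimH U = ((finrank ℝ W + 1 : ℕ) : ℝ≥0∞) := by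
      rw [Real.dimH_of_nonempty_interior (by rwa [hU.interior_eq]), finrank_prod, finrank_self]
    rw [← hdim]
    refine (hanti.le_dimH_image U).trans (dimH_mono ?_)
    rintro _ ⟨⟨w, t⟩, ⟨hw, ht⟩, rfl⟩
    refine ⟨?_, ?_⟩
    · have := interior_subset hw
      simpa [g, Fin.init_snoc] using this
    · simpa [g] using ht.le
  refine (h1.trans_lt ?_).trans_le h2
  exact_mod_cast Nat.lt_succ_self _

end Dimension

/-! ### Boxes of delay vectors -/

section Boxes

variable {AP L X E : Type*} {A : TimedAutomaton AP L X E} {s : L × (X → ℝ)} {e : ℕ → E} {n : ℕ}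

theorem restr_eq_funLeft {i : ℕ} (hi : i ≤ n) :
    restr (n := n) i hi = LinearMap.funLeft ℝ ℝ (Fin.castLE hi) := rfl

theorem TimedAutomaton.trace_init (τ : Fin (n + 1) → ℝ) :
    A.trace s e (extend (Fin.init τ)) n = A.trace s e (extend τ) n :=
  trace_congr (fun _ _ => rfl) fun _ hj => extend_init τ hj

/-- Thickness is inherited by nonempty relatively open subsets of the polyhedron: by convexity, the
projections of the polyhedron have the same dimension near every point. -/
theorem TimedAutomaton.ThickSet.mono {O O' : Set (Fin n → ℝ)}
    (h : A.ThickSet s e n (O ∩ A.poly s e n)) (hO' : IsOpen O')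
    (hne : (O' ∩ A.poly s e n).Nonempty) (hsub : O' ∩ A.poly s e n ⊆ O ∩ A.poly s e n) :
    A.ThickSet s e n (O' ∩ A.poly s e n) := by
  intro i hi
  obtain ⟨τ, hτ, hτ'⟩ := hne
  calc _ ≤ dimH (A.fan s e i (restr i hi.le '' (O ∩ A.poly s e n))) :=
        dimH_mono (fan_mono (Set.image_mono hsub))
    _ ≤ dimH (restr (i + 1) hi '' (O ∩ A.poly s e n)) := h i hi
    _ ≤ dimH (restr (i + 1) hi '' A.poly s e n) :=
        dimH_mono (Set.image_mono Set.inter_subset_right)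
    _ ≤ dimH (restr (i + 1) hi '' (A.poly s e n ∩ O')) := by
        rw [restr_eq_funLeft]
        exact dimH_image_convex_le _ convex_poly hO' hτ' hτ
    _ = _ := by rw [Set.inter_comm]

/-- An open set that meets `S` can be shrunk, still meeting `S`, so that finitely many continuous
functions have constant signs on its intersection with `S`. -/
theorem exists_open_sign_eq {Y ι : Type*} [TopologicalSpace Y] [Finite ι] {g : ι → Y → ℝ}
    (hg : ∀ j, Continuous (g j)) {O S : Set Y} (hO : IsOpen O) (hne : (O ∩ S).Nonempty) :
    ∃ O', IsOpen O' ∧ O' ⊆ O ∧ (O' ∩ S).Nonempty ∧ ∀ j, ∀ y ∈ O' ∩ S, ∀ y' ∈ O' ∩ S,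
      SignType.sign (g j y) = SignType.sign (g j y') := by
  classical
  have := Fintype.ofFinite ι
  suffices h : ∀ J : Finset ι, ∃ O', IsOpen O' ∧ O' ⊆ O ∧ (O' ∩ S).Nonempty ∧
      ∀ j ∈ J, ∀ y ∈ O' ∩ S, ∀ y' ∈ O' ∩ S,
        SignType.sign (g j y) = SignType.sign (g j y') by
    simpa using h Finset.univ
  intro J
  induction J using Finset.induction_on with
  | empty => exact ⟨O, hO, subset_rfl, hne, by simp⟩
  | insert j J _ ih =>
    obtain ⟨U, hU, hUO, hUne, hUs⟩ := ih
    have key : ∃ V, IsOpen V ∧ V ⊆ U ∧ (V ∩ S).Nonempty ∧ ∀ y ∈ V ∩ S, ∀ y' ∈ V ∩ S,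
        SignType.sign (g j y) = SignType.sign (g j y') := by
      by_cases hpos : ∃ y ∈ U ∩ S, 0 < g j y
      · obtain ⟨y, hy, hy'⟩ := hpos
        refine ⟨U ∩ {y | 0 < g j y}, hU.inter (isOpen_lt continuous_const (hg j)),
          Set.inter_subset_left, ⟨y, ⟨hy.1, hy'⟩, hy.2⟩, fun y hy y' hy' => ?_⟩
        rw [sign_pos hy.1.2, sign_pos hy'.1.2]
      by_cases hneg : ∃ y ∈ U ∩ S, g j y < 0
      · obtain ⟨y, hy, hy'⟩ := hneg
        refine ⟨U ∩ {y | g j y < 0}, hU.inter (isOpen_lt (hg j) continuous_const),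
          Set.inter_subset_left, ⟨y, ⟨hy.1, hy'⟩, hy.2⟩, fun y hy y' hy' => ?_⟩
        rw [sign_neg hy.1.2, sign_neg hy'.1.2]
      push Not at hpos hneg
      refine ⟨U, hU, subset_rfl, hUne, fun y hy y' hy' => ?_⟩
      rw [le_antisymm (hpos y hy) (hneg y hy), le_antisymm (hpos y' hy') (hneg y' hy')]
    obtain ⟨V, hV, hVU, hVne, hVs⟩ := key
    refine ⟨V, hV, hVU.trans hUO, hVne, fun k hk y hy y' hy' => ?_⟩
    rcases Finset.mem_insert.1 hk with rfl | hk
    · exact hVs y hy y' hy'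
    · exact hUs k hk y ⟨hVU hy.1, hy.2⟩ y' ⟨hVU hy'.1, hy'.2⟩

/-- If the last delay is determined by requiring that some clock has a given value, the dimension
does not grow. -/
theorem TimedAutomaton.dimH_graph_le (T : Set (Fin n → ℝ)) (x : X) (c : ℝ) :
    dimH {τ : Fin (n + 1) → ℝ | Fin.init τ ∈ T ∧
      shift (A.trace s e (extend (Fin.init τ)) n).2 (τ (Fin.last n)) x = c} ≤ dimH T := by
  let g : (Fin n → ℝ) → (Fin (n + 1) → ℝ) := fun τ =>
    Fin.snoc (α := fun _ => ℝ) τ (c - (A.trace s e (extend τ) n).2 x)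
  have hg : ContDiff ℝ 1 g := by
    refine contDiff_pi.2 fun j => ?_
    refine Fin.lastCases ?_ (fun j => ?_) j
    · simp only [g, Fin.snoc_last]
      exact contDiff_const.sub (contDiff_trace n x)
    · simp only [g, Fin.snoc_castSucc]
      exact contDiff_apply ℝ ℝ j
  refine (dimH_mono ?_).trans (hg.contDiffOn.dimH_image_le convex_univ (Set.subset_univ T))
  rintro τ ⟨h1, h2⟩
  refine ⟨Fin.init τ, h1, ?_⟩
  have h3 : c - (A.trace s e (extend (Fin.init τ)) n).2 x = τ (Fin.last n) := by
    rw [← h2, shift, add_sub_cancel_left]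
  simp only [g, h3, Fin.snoc_init_self]

theorem TimedAutomaton.convex_edgeDelays (s : L × (X → ℝ)) (e : E) :
    Convex ℝ (A.edgeDelays s e) := by
  intro t ht t' ht' a b ha hb hab
  simp only [smul_eq_mul]
  rw [mem_edgeDelays] at ht ht' ⊢
  have h1 : shift s.2 (a * t + b * t') = a • shift s.2 t + b • shift s.2 t' := by
    rw [← shift_comb, ← add_smul, hab, one_smul]
  rw [post, h1, resetClocks_comb]
  exact ⟨ht.1, ht.2.1, ht.2.2.1, add_nonneg (mul_nonneg ha ht.2.2.2.1)
    (mul_nonneg hb ht'.2.2.2.1), ht.2.2.2.2.1.comb ht'.2.2.2.2.1 ha hb hab,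
    ht.2.2.2.2.2.1.comb ht'.2.2.2.2.2.1 ha hb hab, ht.2.2.2.2.2.2.comb ht'.2.2.2.2.2.2 ha hb hab⟩

variable [Finite X]

/-- Following a loose region edge is an open condition on the last delay. -/
theorem TimedAutomaton.LooseEdge.eventually_mem {g : REdge L X E} (hl : A.LooseEdge g)
    (hg : A.IsREdge g) {T : Set (Fin n → ℝ)}
    (hT : ∀ τ ∈ T, (∀ x, 0 ≤ (A.trace s e (extend τ) n).2 x) ∧
      A.vertexOf (A.trace s e (extend τ) n) = g.src)
    {τ₁ : Fin (n + 1) → ℝ} (h1 : τ₁ ∈ prism T)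
    (h2 : shift (A.trace s e (extend (Fin.init τ₁)) n).2 (τ₁ (Fin.last n)) ∈ g.mid) :
    ∀ᶠ τ in 𝓝 τ₁, τ ∈ prism T →
      shift (A.trace s e (extend (Fin.init τ)) n).2 (τ (Fin.last n)) ∈ g.mid := by
  have hc : Continuous fun τ : Fin (n + 1) → ℝ =>
      shift (A.trace s e (extend (Fin.init τ)) n).2 (τ (Fin.last n)) := by
    simp only [trace_init, ← extend_last]
    exact continuous_shift_trace n
  filter_upwards [(hc.tendsto τ₁).eventually ((hl _ h2).eventually_regionEquiv h1.2)] with τ h3 h4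
  have hv : A.RegionEquiv (A.trace s e (extend (Fin.init τ₁)) n).2
      (A.trace s e (extend (Fin.init τ)) n).2 := by
    refine (regionOf_eq_iff (hT _ h4.1).1).1 ?_
    exact congrArg Prod.snd ((hT _ h1.1).2.trans (hT _ h4.1).2.symm)
  have h5 := h3 _ _ hv rfl
  refine (mem_region_iff hg.2.1).2 ⟨shift_nonneg (hT _ h4.1).1 h4.2, ?_⟩
  rw [← ((mem_region_iff hg.2.1).1 h2).2]
  exact h5.regionOf_eq.symm

variable [Finite L] [Finite E]

theorem TimedAutomaton.edgeDelays_subsingleton {s : L × (X → ℝ)}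
    (h : ∀ f, A.IsREdge f → f.src = A.vertexOf s → ¬ A.LooseEdge f) (e : E) :
    (A.edgeDelays s e).Subsingleton := by
  have hfin : (A.edgeDelays s e).Finite := by
    have h1 : {f : REdge L X E | A.IsREdge f ∧ f.src = A.vertexOf s}.Finite :=
      A.finite_isREdge.subset fun f hf => hf.1
    refine (h1.biUnion fun f hf => (redgeDelays_subsingleton hf.1 (h f hf.1 hf.2) s.2).finite).subset
      fun t ht => ?_
    exact Set.mem_biUnion (show A.redge s t e ∈ {f : REdge L X E | A.IsREdge f ∧
      f.src = A.vertexOf s} from ⟨isREdge_redge ht, rfl⟩) (mem_redgeDelays_redge ht)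
  intro t ht u hu
  by_contra hne
  rcases lt_or_gt_of_ne hne with h1 | h1
  · exact (Set.Icc_infinite h1).mono
      ((convex_edgeDelays s e).ordConnected.out ht hu) hfin
  · exact (Set.Icc_infinite h1).mono
      ((convex_edgeDelays s e).ordConnected.out hu ht) hfin

/-- Nonempty relatively open thick sets of delay vectors all of whose paths follow the thick region
edges `f 0, …, f (n - 1)` and end in the vertex `q`. Every nonempty open set of runs contains the
cylinder of a box. -/
structure TimedAutomaton.IsBox (A : TimedAutomaton AP L X E) (s : L × (X → ℝ)) (e : ℕ → E) (n : ℕ)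
    (O : Set (Fin n → ℝ)) (f : ℕ → REdge L X E) (q : L × Set (X → ℝ)) : Prop where
  isOpen : IsOpen O
  nonempty : (O ∩ A.poly s e n).Nonempty
  thickSet : A.ThickSet s e n (O ∩ A.poly s e n)
  redge : ∀ τ ∈ O ∩ A.poly s e n, ∀ i < n,
    A.redge (A.trace s e (extend τ) i) (extend τ i) (e i) = f i
  thickEdge : ∀ i < n, A.IsThickEdge (f i)
  vertex : ∀ τ ∈ O ∩ A.poly s e n, A.vertexOf (A.trace s e (extend τ) n) = q

/-- Every thick relatively open set contains one all of whose paths follow the same thick region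
edges. The signs of finitely many continuous functions of the delays determine the region edges,
and can be made constant on a smaller open set. A thin region edge among them would fix a
delay where a whole interval of delays is available, and so violate thickness. -/
theorem TimedAutomaton.ThickSet.exists_isBox (hs : A.IsState s) {O : Set (Fin n → ℝ)}
    (hO : IsOpen O) (hne : (O ∩ A.poly s e n).Nonempty)
    (h : A.ThickSet s e n (O ∩ A.poly s e n)) :
    ∃ O' f q, O' ⊆ O ∧ A.IsBox s e n O' f q := by
  obtain ⟨O₁, hO₁, hO₁O, hne₁, hsign₁⟩ := exists_open_sign_eq
    (g := fun (j : Fin (n + 1) × A.Test) (τ : Fin n → ℝ) =>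
      A.test j.2 (A.trace s e (extend τ) j.1).2)
    (fun j => (A.continuous_test j.2).comp (continuous_trace _)) hO hne
  obtain ⟨O₂, hO₂, hO₂O, ⟨τ₀, hτ₀⟩, hsign₂⟩ := exists_open_sign_eq
    (g := fun (j : Fin n × A.Test) (τ : Fin n → ℝ) =>
      A.test j.2 (shift (A.trace s e (extend τ) j.1).2 (extend τ j.1)))
    (fun j => (A.continuous_test j.2).comp (continuous_shift_trace _)) hO₁ hne₁
  have hsub : O₂ ∩ A.poly s e n ⊆ O₁ ∩ A.poly s e n := Set.inter_subset_inter_left _ hO₂O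
  have hnn : ∀ τ ∈ O₂ ∩ A.poly s e n, ∀ i ≤ n, ∀ x, 0 ≤ (A.trace s e (extend τ) i).2 x :=
    fun τ hτ i hi => ((Valid.mono hτ.2 hi).isState hs).1
  have hreg : ∀ τ ∈ O₂ ∩ A.poly s e n, ∀ i ≤ n, A.RegionEquiv (A.trace s e (extend τ₀) i).2
      (A.trace s e (extend τ) i).2 := fun τ hτ i hi =>
    regionEquiv_of_sign_test (hnn τ₀ hτ₀ i hi) fun j =>
      hsign₁ (⟨i, by omega⟩, j) τ₀ (hsub hτ₀) τ (hsub hτ)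
  have hreg' : ∀ τ ∈ O₂ ∩ A.poly s e n, ∀ i < n,
      A.RegionEquiv (shift (A.trace s e (extend τ₀) i).2 (extend τ₀ i))
        (shift (A.trace s e (extend τ) i).2 (extend τ i)) := fun τ hτ i hi =>
    regionEquiv_of_sign_test (shift_nonneg (hnn τ₀ hτ₀ i hi.le) (delay_nonneg (hτ₀.2 i hi)))
      fun j => hsign₂ (⟨i, hi⟩, j) τ₀ hτ₀ τ hτ
  have hvert : ∀ τ ∈ O₂ ∩ A.poly s e n, ∀ i ≤ n, A.vertexOf (A.trace s e (extend τ) i) =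
      A.vertexOf (A.trace s e (extend τ₀) i) := fun τ hτ i hi =>
    Prod.ext (trace_fst _ _ i) (hreg τ hτ i hi).regionOf_eq.symm
  have hthick : A.ThickSet s e n (O₂ ∩ A.poly s e n) :=
    h.mono hO₂ ⟨τ₀, hτ₀⟩ (Set.inter_subset_inter_left _ (hO₂O.trans hO₁O))
  let f : ℕ → REdge L X E := fun i => A.redge (A.trace s e (extend τ₀) i) (extend τ₀ i) (e i)
  have hf : ∀ τ ∈ O₂ ∩ A.poly s e n, ∀ i < n,
      A.redge (A.trace s e (extend τ) i) (extend τ i) (e i) = f i := by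
    intro τ hτ i hi
    have h1 := redge_eq_of_regionEquiv (ℓ := (A.trace s e (extend τ₀) i).1) (e := e i)
      (hreg τ hτ i hi.le) (hreg' τ hτ i hi)
    rw [trace_fst (extend τ₀) (extend τ)] at h1
    refine h1.symm.trans ?_
    rw [trace_fst (extend τ) (extend τ₀)]
  refine ⟨O₂, f, _, hO₂O.trans hO₁O, hO₂, ⟨τ₀, hτ₀⟩, hthick, hf, fun i hi => ?_,
    fun τ hτ => hvert τ hτ n le_rfl⟩
  have hfi : A.IsREdge (f i) := isREdge_redge (hτ₀.2 i hi)
  by_contra hthin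
  rw [isThickEdge_iff, not_and, not_or] at hthin
  obtain ⟨hnl, hex⟩ := hthin hfi
  push Not at hex
  obtain ⟨g, hg, hgsrc, hgl⟩ := hex
  obtain ⟨ε, hε, hball⟩ := Metric.isOpen_iff.1 hO₂ τ₀ hτ₀.1
  have hBsub : A.poly s e n ∩ Metric.ball τ₀ ε ⊆ O₂ ∩ A.poly s e n :=
    fun τ hτ => ⟨hball hτ.2, hτ.1⟩
  -- near `τ₀` the first `i` delays form a convex set `K`, of full dimension by convexity
  let K := restr i hi.le '' (A.poly s e n ∩ Metric.ball τ₀ ε)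
  have hK : Convex ℝ K := by
    simp only [K, restr_eq_funLeft]
    exact (convex_poly.inter (convex_ball τ₀ ε)).linear_image _
  have hτ₀K : restr i hi.le τ₀ ∈ K := ⟨τ₀, ⟨hτ₀.2, Metric.mem_ball_self hε⟩, rfl⟩
  have hKtr : ∀ τ : Fin n → ℝ, A.trace s e (extend (restr i hi.le τ)) i =
      A.trace s e (extend τ) i := fun τ =>
    trace_congr (fun _ _ => rfl) fun j hj => extend_restr hi.le τ hj
  have hKv : ∀ τ ∈ K, (∀ x, 0 ≤ (A.trace s e (extend τ) i).2 x) ∧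
      A.vertexOf (A.trace s e (extend τ) i) = g.src := by
    rintro _ ⟨τ, hτ, rfl⟩
    rw [hKtr]
    exact ⟨hnn τ (hBsub hτ) i hi.le, (hvert τ (hBsub hτ) i hi.le).trans hgsrc.symm⟩
  obtain ⟨x, c, hc⟩ := exists_const_of_not_looseEdge hfi hnl
  -- the thin edge `f i` fixes a clock, hence makes the next delay a function of the previous ones
  have upper : dimH (restr (i + 1) hi '' (O₂ ∩ A.poly s e n)) ≤ dimH K := by
    calc _ ≤ dimH (restr i hi.le '' (O₂ ∩ A.poly s e n)) := by
          refine (dimH_mono ?_).trans (dimH_graph_le (A := A) (s := s) (e := e) _ x c)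
          rintro _ ⟨τ, hτ, rfl⟩
          refine ⟨⟨τ, hτ, rfl⟩, ?_⟩
          have h1 : Fin.init (restr (i + 1) hi τ) = restr i hi.le τ := rfl
          have h2 : restr (i + 1) hi τ (Fin.last i) = extend τ i := (extend_apply τ hi).symm
          rw [h1, h2, hKtr]
          refine hc _ ?_
          rw [← hf τ hτ i hi]
          exact mem_regionOf (shift_nonneg (hnn τ hτ i hi.le) (delay_nonneg (hτ.2 i hi)))
      _ ≤ dimH (restr i hi.le '' A.poly s e n) :=
          dimH_mono (Set.image_mono Set.inter_subset_right)
      _ ≤ dimH K := by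
          simp only [K, restr_eq_funLeft]
          exact dimH_image_convex_le _ convex_poly Metric.isOpen_ball hτ₀.2
            (Metric.mem_ball_self hε)
  -- along the loose edge `g`, by contrast, the next delay can be varied
  have lower : dimH (prism K) ≤ dimH (A.fan s e i (restr i hi.le '' (O₂ ∩ A.poly s e n))) := by
    obtain ⟨t, ht, htm⟩ := hg.exists_delay (hKv _ hτ₀K).1 (hKv _ hτ₀K).2
    let τ₁ : Fin (i + 1) → ℝ := Fin.snoc (α := fun _ => ℝ) (restr i hi.le τ₀) t
    have h1 : Fin.init τ₁ = restr i hi.le τ₀ := by simp [τ₁]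
    have h2 : τ₁ (Fin.last i) = t := by simp [τ₁]
    have h3 : τ₁ ∈ prism K := ⟨by rw [h1]; exact hτ₀K, by rw [h2]; exact ht⟩
    have h4 := hgl.eventually_mem hg hKv h3 (by rw [h1, h2]; exact htm)
    obtain ⟨N, hN, hNo, hτN⟩ := eventually_nhds_iff.1 h4
    refine (dimH_convex_le (convex_prism hK) hNo h3 hτN).trans (dimH_mono ?_)
    rintro τ ⟨hτ, hτN⟩
    have h5 := hN τ hτN hτ
    refine ⟨Set.image_mono hBsub hτ.1, Set.mem_iUnion.2 ⟨g.edge, ?_⟩⟩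
    exact (hg.step_of_shift_mem (hKv _ hτ.1).1 (hKv _ hτ.1).2 hτ.2 h5).1
  exact (dimH_lt_dimH_prism hK ⟨_, hτ₀K⟩).not_ge (lower.trans ((hthick i hi).trans upper))

/-- A box can be continued along every thick region edge that leaves its final vertex. -/
theorem TimedAutomaton.IsBox.exists_succ (hs : A.IsState s) {O : Set (Fin n → ℝ)}
    {f : ℕ → REdge L X E} {q : L × Set (X → ℝ)} (h : A.IsBox s e n O f q) {g : REdge L X E}
    (hg : A.IsThickEdge g) (hgq : g.src = q) :
    ∃ O' : Set (Fin (n + 1) → ℝ),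
      A.IsBox s (Function.update e n g.edge) (n + 1) O' (Function.update f n g) g.tgt ∧
        ∀ τ ∈ O', Fin.init τ ∈ O := by
  set e' := Function.update e n g.edge
  have hee : ∀ i < n, e' i = e i := fun i hi => Function.update_of_ne hi.ne _ _
  have hen : e' n = g.edge := Function.update_self _ _ _
  have htr : ∀ (τ : ℕ → ℝ), ∀ i ≤ n, A.trace s e' τ i = A.trace s e τ i := fun τ i hi =>
    trace_congr (fun j hj => hee j (hj.trans_le hi)) fun _ _ => rfl
  have hpoly : A.poly s e' n = A.poly s e n := Set.ext fun τ =>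
    ⟨fun h => Valid.congr h hee fun _ _ => rfl,
      fun h => Valid.congr h (fun i hi => (hee i hi).symm) fun _ _ => rfl⟩
  have hfan : ∀ i ≤ n, ∀ T, A.fan s e' i T = A.fan s e i T := fun i hi T => by
    unfold fan
    simp only [htr _ i hi]
  have hmem : ∀ τ : Fin (n + 1) → ℝ, τ ∈ A.poly s e' (n + 1) ↔ Fin.init τ ∈ A.poly s e n ∧
      τ (Fin.last n) ∈ A.edgeDelays (A.trace s e (extend (Fin.init τ)) n) g.edge := by
    intro τ
    rw [mem_poly_succ, hpoly, htr _ n le_rfl, hen]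
  set S := O ∩ A.poly s e n
  have hSv : ∀ τ ∈ S, (∀ x, 0 ≤ (A.trace s e (extend τ) n).2 x) ∧
      A.vertexOf (A.trace s e (extend τ) n) = g.src := fun τ hτ =>
    ⟨(Valid.isState hτ.2 hs).1, (h.vertex τ hτ).trans hgq.symm⟩
  have hinit : Continuous (Fin.init : (Fin (n + 1) → ℝ) → (Fin n → ℝ)) :=
    (contDiff_restr n.le_succ).continuous
  -- `S'` is the set of all continuations of `S` along `g`; it has to be shown relatively open
  let Q : (Fin (n + 1) → ℝ) → Prop := fun τ =>
    A.redge (A.trace s e (extend (Fin.init τ)) n) (τ (Fin.last n)) g.edge = g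
  let S' : Set (Fin (n + 1) → ℝ) :=
    {τ | τ ∈ A.poly s e' (n + 1) ∧ Fin.init τ ∈ O ∧ Q τ}
  have hSS' : ∀ τ ∈ S', Fin.init τ ∈ S := fun τ hτ => ⟨hτ.2.1, ((hmem τ).1 hτ.1).1⟩
  have hSext : ∀ τ ∈ S, ∃ τ' ∈ S', Fin.init τ' = τ := by
    intro τ hτ
    obtain ⟨t, ht, htm⟩ := hg.1.exists_delay (hSv τ hτ).1 (hSv τ hτ).2
    have h1 := hg.1.step_of_shift_mem (hSv τ hτ).1 (hSv τ hτ).2 ht htm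
    have h2 : Fin.init (Fin.snoc (α := fun _ => ℝ) τ t) = τ := by simp
    have h3 : (Fin.snoc τ t : Fin (n + 1) → ℝ) (Fin.last n) = t := by simp
    refine ⟨Fin.snoc (α := fun _ => ℝ) τ t, ⟨(hmem _).2 ?_, ?_, ?_⟩, h2⟩
    · rw [h2, h3]
      exact ⟨hτ.2, h1.1⟩
    · rw [h2]
      exact hτ.1
    · show A.redge _ _ _ = _
      rw [h2, h3]
      exact h1.2
  have hprism : ∀ τ ∈ A.poly s e' (n + 1), Fin.init τ ∈ O → τ ∈ prism S := fun τ hτ hτO =>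
    ⟨⟨hτO, ((hmem τ).1 hτ).1⟩, delay_nonneg ((hmem τ).1 hτ).2⟩
  -- following `g` in the last step is an open condition, for loose and for other edges
  have hopen : ∀ τ₁ ∈ S', ∀ᶠ τ in 𝓝 τ₁, τ ∈ prism S → τ ∈ A.poly s e' (n + 1) → Q τ := by
    intro τ₁ hτ₁
    rcases (isThickEdge_iff.1 hg).2 with hl | hnl
    · have h2 : shift (A.trace s e (extend (Fin.init τ₁)) n).2 (τ₁ (Fin.last n)) ∈ g.mid := by
        have h3 := ((hmem τ₁).1 hτ₁.1).2
        have h4 := congrArg REdge.mid hτ₁.2.2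
        rw [← h4]
        exact mem_regionOf (shift_nonneg (nonneg_of_mem h3) (delay_nonneg h3))
      filter_upwards [hl.eventually_mem hg.1 hSv (hprism τ₁ hτ₁.1 hτ₁.2.1) h2] with τ h3 h4 _
      exact (hg.1.step_of_shift_mem (hSv _ h4.1).1 (hSv _ h4.1).2 h4.2 (h3 h4)).2
    · refine Eventually.of_forall fun τ h4 h5 => ?_
      obtain ⟨t, ht, htm⟩ := hg.1.exists_delay (hSv _ h4.1).1 (hSv _ h4.1).2
      have h6 := hg.1.step_of_shift_mem (hSv _ h4.1).1 (hSv _ h4.1).2 ht htm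
      have h7 : τ (Fin.last n) = t := by
        refine edgeDelays_subsingleton (fun f' hf' hsrc => hnl f' hf' ?_) g.edge
          ((hmem τ).1 h5).2 h6.1
        exact hsrc.trans (hSv _ h4.1).2
      show A.redge _ _ _ = _
      rw [h7]
      exact h6.2
  let O' : Set (Fin (n + 1) → ℝ) :=
    Fin.init ⁻¹' O ∩ interior {τ | τ ∈ prism S → τ ∈ A.poly s e' (n + 1) → Q τ}
  have hO'S' : O' ∩ A.poly s e' (n + 1) = S' := by
    ext τ
    refine ⟨fun hτ => ⟨hτ.2, hτ.1.1, interior_subset hτ.1.2 (hprism τ hτ.2 hτ.1.1) hτ.2⟩,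
      fun hτ => ⟨⟨hτ.2.1, ?_⟩, hτ.1⟩⟩
    exact mem_interior_iff_mem_nhds.2 (hopen τ hτ)
  obtain ⟨τ₀, hτ₀⟩ := h.nonempty
  obtain ⟨τ₁, hτ₁, hτ₁₀⟩ := hSext τ₀ hτ₀
  have himage : ∀ i (hi : i ≤ n), restr i (hi.trans n.le_succ) '' S' = restr i hi '' S := by
    intro i hi
    ext τ
    constructor
    · rintro ⟨τ', h1, rfl⟩
      exact ⟨Fin.init τ', hSS' τ' h1, rfl⟩
    · rintro ⟨τ', h1, rfl⟩
      obtain ⟨τ'', h2, rfl⟩ := hSext τ' h1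
      exact ⟨τ'', h2, rfl⟩
  -- only the last step is new; if `g` is loose, `S'` is open in the cylinder over the polyhedron,
  -- and otherwise all continuations have determined delays
  have hthick : A.ThickSet s e' (n + 1) S' := by
    intro i hi
    rcases Nat.lt_succ_iff_lt_or_eq.1 hi with h1 | rfl
    · rw [himage (i + 1) h1, himage i h1.le, hfan i h1.le]
      exact h.thickSet i h1
    · rw [himage i le_rfl, hfan i le_rfl]
      have e1 : restr (i + 1) hi '' S' = S' := Set.image_id S'
      have e2 : restr i le_rfl '' S = S := Set.image_id S
      rw [e1, e2]
      rcases (isThickEdge_iff.1 hg).2 with hl | hnl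
      · have h2 : shift (A.trace s e (extend (Fin.init τ₁)) i).2 (τ₁ (Fin.last i)) ∈ g.mid := by
          have h3 := ((hmem τ₁).1 hτ₁.1).2
          have h4 := congrArg REdge.mid hτ₁.2.2
          rw [← h4]
          exact mem_regionOf (shift_nonneg (nonneg_of_mem h3) (delay_nonneg h3))
        obtain ⟨N, hN, hNo, hτN⟩ := eventually_nhds_iff.1
          (hl.eventually_mem hg.1 hSv (hprism τ₁ hτ₁.1 hτ₁.2.1) h2)
        calc dimH (A.fan s e i S) ≤ dimH (prism (A.poly s e i)) := by
              refine dimH_mono fun τ hτ => ⟨hτ.1.2, ?_⟩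
              obtain ⟨e'', h3⟩ := Set.mem_iUnion.1 hτ.2
              exact delay_nonneg h3
          _ ≤ dimH (prism (A.poly s e i) ∩ (N ∩ Fin.init ⁻¹' O)) :=
              dimH_convex_le (convex_prism convex_poly) (hNo.inter (h.isOpen.preimage hinit))
                (x := τ₁) ⟨((hmem τ₁).1 hτ₁.1).1, delay_nonneg ((hmem τ₁).1 hτ₁.1).2⟩
                ⟨hτN, hτ₁.2.1⟩
          _ ≤ dimH S' := by
              refine dimH_mono fun τ hτ => ?_
              have h3 : τ ∈ prism S := ⟨⟨hτ.2.2, hτ.1.1⟩, hτ.1.2⟩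
              have h4 := hg.1.step_of_shift_mem (hSv _ h3.1).1 (hSv _ h3.1).2 h3.2
                (hN τ hτ.2.1 h3)
              exact ⟨(hmem τ).2 ⟨h3.1.2, h4.1⟩, hτ.2.2, h4.2⟩
      · have hfin : {f' : REdge L X E | A.IsREdge f' ∧ f'.src = g.src}.Finite :=
          A.finite_isREdge.subset fun f' h' => h'.1
        have hcov : A.fan s e i S ⊆ ⋃ f' ∈ {f' : REdge L X E | A.IsREdge f' ∧ f'.src = g.src},
            {τ | Fin.init τ ∈ S ∧
              shift (A.trace s e (extend (Fin.init τ)) i).2 (τ (Fin.last i)) ∈ f'.mid} := by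
          rintro τ ⟨h1, h2⟩
          obtain ⟨e'', h3⟩ := Set.mem_iUnion.1 h2
          exact Set.mem_biUnion (show A.redge _ _ e'' ∈ {f' : REdge L X E | A.IsREdge f' ∧
            f'.src = g.src} from ⟨isREdge_redge h3, (hSv _ h1).2⟩)
            ⟨h1, (mem_redgeDelays_redge h3).1⟩
        calc dimH (A.fan s e i S) ≤ dimH S := by
              refine (dimH_mono hcov).trans ?_
              rw [dimH_bUnion hfin.countable]
              refine iSup₂_le fun f' hf' => ?_
              obtain ⟨x, c, hc⟩ := exists_const_of_not_looseEdge hf'.1 (hnl f' hf'.1 hf'.2)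
              refine (dimH_mono ?_).trans (dimH_graph_le (A := A) (s := s) (e := e) S x c)
              exact fun τ hτ => ⟨hτ.1, hc _ hτ.2⟩
          _ = dimH (restr i i.le_succ '' S') := by rw [himage i le_rfl, e2]
          _ ≤ dimH S' := (contDiff_restr i.le_succ).contDiffOn.dimH_image_le
              convex_univ (Set.subset_univ S')
  have hlast : ∀ τ ∈ S', A.redge (A.trace s e' (extend τ) n) (extend τ n) (e' n) = g := by
    intro τ hτ
    rw [htr _ n le_rfl, hen, ← trace_init, extend_last]
    exact hτ.2.2
  refine ⟨O', ⟨?_, ?_, ?_, ?_, ?_, ?_⟩, fun τ hτ => hτ.1⟩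
  · exact (h.isOpen.preimage hinit).inter isOpen_interior
  · rw [hO'S']
    exact ⟨τ₁, hτ₁⟩
  · rw [hO'S']
    exact hthick
  · rw [hO'S']
    intro τ hτ i hi
    rcases Nat.lt_succ_iff_lt_or_eq.1 hi with h1 | rfl
    · rw [Function.update_of_ne h1.ne, ← h.redge _ (hSS' τ hτ) i h1, htr _ i h1.le, hee i h1,
        extend_init τ h1]
      rw [trace_congr (fun _ _ => rfl) fun j hj => extend_init τ (hj.trans h1)]
    · rw [Function.update_self]
      exact hlast τ hτ
  · intro i hi
    rcases Nat.lt_succ_iff_lt_or_eq.1 hi with h1 | rfl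
    · rw [Function.update_of_ne h1.ne]
      exact h.thickEdge i h1
    · rw [Function.update_self]
      exact hg
  · rw [hO'S']
    intro τ hτ
    exact congrArg REdge.tgt (hlast τ hτ)

end Boxes

/-! ### The topology on runs -/

section RunTopology

variable {AP L X E : Type*} {A : TimedAutomaton AP L X E} {s : L × (X → ℝ)}

theorem TimedAutomaton.Run.delay_mem_poly (ρ : A.Run s) (n : ℕ) :
    (fun i : Fin n => ρ.delay i) ∈ A.poly s ρ.edge n :=
  (ρ.valid n).congr (fun _ _ => rfl) fun _ hi =>
    (extend_apply (fun i : Fin n => ρ.delay i) hi).symm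

theorem TimedAutomaton.Run.trace_eq_state (ρ : A.Run s) {e : ℕ → E} {n i : ℕ} (hi : i ≤ n)
    (he : ∀ j < n, ρ.edge j = e j) :
    A.trace s e (extend fun j : Fin n => ρ.delay j) i = ρ.state i := by
  rw [ρ.state_eq_trace]
  exact trace_congr (fun j hj => (he j (hj.trans_le hi)).symm)
    fun j hj => extend_apply _ (hj.trans_le hi)

/-- The cylinder along the first `n` edges of `e`. -/
abbrev TimedAutomaton.cylinder (A : TimedAutomaton AP L X E) (s : L × (X → ℝ)) (e : ℕ → E) (n : ℕ)
    (O : Set (Fin n → ℝ)) : Set (A.Run s) := A.cyl s (fun i : Fin n => e i) O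

theorem TimedAutomaton.mem_cylinder {e : ℕ → E} {n : ℕ} {O : Set (Fin n → ℝ)} {ρ : A.Run s} :
    ρ ∈ A.cylinder s e n O ↔ (∀ i < n, ρ.edge i = e i) ∧ (fun i : Fin n => ρ.delay i) ∈ O :=
  and_congr_left fun _ => Fin.forall_iff

theorem TimedAutomaton.mem_inter_poly {e : ℕ → E} {n : ℕ} {O : Set (Fin n → ℝ)} {ρ : A.Run s}
    (h : ρ ∈ A.cylinder s e n O) : (fun i : Fin n => ρ.delay i) ∈ O ∩ A.poly s e n := by
  rw [mem_cylinder] at h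
  exact ⟨h.2, Valid.congr (ρ.delay_mem_poly n) h.1 fun _ _ => rfl⟩

theorem TimedAutomaton.cylinder_mono {e : ℕ → E} {n : ℕ} {O O' : Set (Fin n → ℝ)}
    (h : O' ∩ A.poly s e n ⊆ O) : A.cylinder s e n O' ⊆ A.cylinder s e n O := fun _ hρ =>
  ⟨hρ.1, h (mem_inter_poly hρ)⟩

theorem TimedAutomaton.isOpen_cylinder {e : ℕ → E} {n : ℕ} {O : Set (Fin n → ℝ)} (hO : IsOpen O)
    (hne : (O ∩ A.poly s e n).Nonempty) (h : A.ThickSet s e n (O ∩ A.poly s e n)) :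
    IsOpen (A.cylinder s e n O) := by
  refine TopologicalSpace.isOpen_generateFrom_of_mem (Or.inr ⟨n, _, O, rfl,
    (not_isThinPath_iff hne).2 h, hO.measurableSet, O, hO, ?_⟩)
  rw [pol_eq, pol_eq, Set.univ_inter]

/-- The open thick cylinders form a base of the topology; in particular the intersection of two of
them is again one. -/
theorem TimedAutomaton.exists_cylinder_subset {U : Set (A.Run s)} (hU : IsOpen U) {ρ : A.Run s}
    (hρ : ρ ∈ U) : ∃ (n : ℕ) (O : Set (Fin n → ℝ)), IsOpen O ∧
      A.ThickSet s ρ.edge n (O ∩ A.poly s ρ.edge n) ∧ ρ ∈ A.cylinder s ρ.edge n O ∧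
      A.cylinder s ρ.edge n O ⊆ U := by
  induction hU with
  | basic S hS =>
    rcases hS with (rfl | rfl) | ⟨n, e, C, rfl, hthin, -, O, hO, hpol⟩
    · exact ⟨0, Set.univ, isOpen_univ, fun i hi => absurd hi (Nat.not_lt_zero i),
        ⟨fun i => i.elim0, trivial⟩, Set.subset_univ _⟩
    · exact absurd hρ (Set.notMem_empty _)
    · obtain rfl : (fun i : Fin n => ρ.edge i) = e := funext hρ.1
      rw [pol_eq, pol_eq, Set.univ_inter] at hpol
      have h1 := mem_inter_poly hρ
      rw [not_isThinPath_iff ⟨_, h1⟩, hpol] at hthin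
      refine ⟨n, O, hO, hthin, ⟨hρ.1, ?_⟩, cylinder_mono ?_⟩
      · rw [hpol] at h1
        exact h1.1
      · rw [← hpol]
        exact Set.inter_subset_left
  | univ =>
    exact ⟨0, Set.univ, isOpen_univ, fun i hi => absurd hi (Nat.not_lt_zero i),
      ⟨fun i => i.elim0, trivial⟩, Set.subset_univ _⟩
  | inter U V _ _ ihU ihV =>
    -- the cylinder of the longer path, with the constraint of the shorter one added
    have key : ∀ {n m : ℕ} {O : Set (Fin n → ℝ)} {O' : Set (Fin m → ℝ)}, n ≤ m → IsOpen O →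
        IsOpen O' → A.ThickSet s ρ.edge m (O' ∩ A.poly s ρ.edge m) →
        ρ ∈ A.cylinder s ρ.edge n O → ρ ∈ A.cylinder s ρ.edge m O' →
        ∃ O'' : Set (Fin m → ℝ), IsOpen O'' ∧
          A.ThickSet s ρ.edge m (O'' ∩ A.poly s ρ.edge m) ∧ ρ ∈ A.cylinder s ρ.edge m O'' ∧
          A.cylinder s ρ.edge m O'' ⊆ A.cylinder s ρ.edge n O ∩ A.cylinder s ρ.edge m O' := by
      intro n m O O' hnm hO hO' ht hρ hρ'
      have ho : IsOpen (O' ∩ restr n hnm ⁻¹' O) :=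
        hO'.inter (hO.preimage (contDiff_restr hnm).continuous)
      have hm : ρ ∈ A.cylinder s ρ.edge m (O' ∩ restr n hnm ⁻¹' O) := ⟨hρ'.1, hρ'.2, hρ.2⟩
      refine ⟨_, ho, ht.mono ho ⟨_, mem_inter_poly hm⟩
        (Set.inter_subset_inter_left _ Set.inter_subset_left), hm, fun ρ' h => ⟨⟨?_, h.2.2⟩,
        h.1, h.2.1⟩⟩
      exact fun i => h.1 (i.castLE hnm)
    obtain ⟨n, O, hO, ht, hρO, hOU⟩ := ihU hρ.1
    obtain ⟨m, O', hO', ht', hρO', hOV⟩ := ihV hρ.2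
    rcases le_total n m with h | h
    · obtain ⟨O'', h1, h2, h3, h4⟩ := key h hO hO' ht' hρO hρO'
      exact ⟨m, O'', h1, h2, h3, h4.trans (Set.inter_subset_inter hOU hOV)⟩
    · obtain ⟨O'', h1, h2, h3, h4⟩ := key h hO' hO ht hρO' hρO
      refine ⟨n, O'', h1, h2, h3, h4.trans ?_⟩
      rw [Set.inter_comm]
      exact Set.inter_subset_inter hOU hOV
  | sUnion S _ ih =>
    obtain ⟨U, hUS, hρU⟩ := hρ
    obtain ⟨n, O, h1, h2, h3, h4⟩ := ih U hUS hρU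
    exact ⟨n, O, h1, h2, h3, h4.trans (Set.subset_sUnion_of_mem hUS)⟩

/-- A decreasing sequence of nonempty cylinders with compact constraints has a common run. -/
theorem TimedAutomaton.nonempty_iInter_cylinder {e : ℕ → ℕ → E} {n : ℕ → ℕ}
    {Z : ∀ k, Set (Fin (n k) → ℝ)} (hn : ∀ k, k ≤ n k) (hZ : ∀ k, IsCompact (Z k))
    (hZp : ∀ k, Z k ⊆ A.poly s (e k) (n k))
    (hne : ∀ k, (A.cylinder s (e k) (n k) (Z k)).Nonempty)
    (hanti : Antitone fun k => A.cylinder s (e k) (n k) (Z k)) :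
    (⋂ k, A.cylinder s (e k) (n k) (Z k)).Nonempty := by
  choose ρ hρ using hne
  have hmem : ∀ {j k}, k ≤ j → ρ j ∈ A.cylinder s (e k) (n k) (Z k) :=
    fun h => hanti h (hρ _)
  -- the delays of the runs `ρ j` converge along an ultrafilter, one coordinate at a time
  let F : Ultrafilter ℕ := hyperfilter ℕ
  have hF : ∀ k, ∀ᶠ j in (F : Filter ℕ), k ≤ j := fun k =>
    (Nat.cofinite_eq_atTop ▸ hyperfilter_le_cofinite : (F : Filter ℕ) ≤ atTop)
      (eventually_ge_atTop k)
  have hlim : ∀ i, ∃ t, Tendsto (fun j => (ρ j).delay i) F (𝓝 t) := by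
    intro i
    have hi : i < n (i + 1) := hn (i + 1)
    have hc : IsCompact ((fun τ : Fin (n (i + 1)) → ℝ => τ ⟨i, hi⟩) '' Z (i + 1)) :=
      (hZ (i + 1)).image (continuous_apply _)
    obtain ⟨t, -, ht⟩ := hc.ultrafilter_le_nhds (F.map fun j => (ρ j).delay i) (by
      rw [le_principal_iff, Ultrafilter.coe_map, mem_map]
      filter_upwards [hF (i + 1)] with j hj
      exact ⟨_, (hmem hj).2, rfl⟩)
    exact ⟨t, ht⟩
  choose τ hτ using hlim
  have hτZ : ∀ k, (fun i : Fin (n k) => τ i) ∈ Z k := by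
    intro k
    refine (hZ k).isClosed.mem_of_tendsto (tendsto_pi_nhds.2 fun i => hτ i) ?_
    filter_upwards [hF k] with j hj
    exact (hmem hj).2
  let e' : ℕ → E := fun i => e (i + 1) i
  have he : ∀ k, ∀ i < n k, e k i = e' i := by
    intro k i hi
    have h1 := (mem_cylinder.1 (hmem (le_max_left k (i + 1)))).1 i hi
    have h2 := (mem_cylinder.1 (hmem (le_max_right k (i + 1)))).1 i (hn (i + 1))
    exact h1.symm.trans h2
  obtain ⟨ρ', h1, h2⟩ := exists_run_of_forall_valid (A := A) (s := s) (e := e') (τ := τ) fun k =>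
    (Valid.congr (hZp k (hτZ k)) (he k) fun i hi => extend_apply _ hi).mono (hn k)
  refine ⟨ρ', Set.mem_iInter.2 fun k => mem_cylinder.2 ⟨fun i hi => ?_, ?_⟩⟩
  · rw [h1, he k i hi]
  · rw [h2]
    exact hτZ k

variable {e : ℕ → E} {n : ℕ} {O : Set (Fin n → ℝ)}
  {f : ℕ → REdge L X E} {q : L × Set (X → ℝ)}

namespace TimedAutomaton.IsBox

theorem isOpen_cylinder (h : A.IsBox s e n O f q) : IsOpen (A.cylinder s e n O) :=
  TimedAutomaton.isOpen_cylinder h.isOpen h.nonempty h.thickSet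

theorem cylinder_nonempty (hA : A.NonBlocking) (hs : A.IsState s) (h : A.IsBox s e n O f q) :
    (A.cylinder s e n O).Nonempty := by
  obtain ⟨τ, hτ⟩ := h.nonempty
  obtain ⟨ρ, hρ⟩ := exists_run hA hs hτ.2
  refine ⟨ρ, mem_cylinder.2 ⟨fun i hi => (hρ i hi).1, ?_⟩⟩
  have : (fun i : Fin n => ρ.delay i) = τ :=
    funext fun i => ((hρ i i.isLt).2).trans (extend_apply τ i.isLt)
  rw [this]
  exact hτ.1

theorem redgeOf_eq (h : A.IsBox s e n O f q) {ρ : A.Run s} (hρ : ρ ∈ A.cylinder s e n O) {i : ℕ}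
    (hi : i < n) : A.redgeOf ρ i = f i := by
  have he := (mem_cylinder.1 hρ).1
  rw [TimedAutomaton.redgeOf_eq, ← h.redge _ (mem_inter_poly hρ) i hi,
    ρ.trace_eq_state hi.le he, he i hi, extend_apply _ hi]

theorem vertexOf_eq (h : A.IsBox s e n O f q) {ρ : A.Run s} (hρ : ρ ∈ A.cylinder s e n O) :
    A.vertexOf (ρ.state n) = q := by
  rw [← h.vertex _ (mem_inter_poly hρ), ρ.trace_eq_state le_rfl (mem_cylinder.1 hρ).1]

theorem mono (h : A.IsBox s e n O f q) {O' : Set (Fin n → ℝ)} (hO' : IsOpen O') (hsub : O' ⊆ O)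
    (hne : (O' ∩ A.poly s e n).Nonempty) : A.IsBox s e n O' f q where
  isOpen := hO'
  nonempty := hne
  thickSet := h.thickSet.mono hO' hne (Set.inter_subset_inter_left _ hsub)
  redge := fun τ hτ => h.redge τ ⟨hsub hτ.1, hτ.2⟩
  thickEdge := h.thickEdge
  vertex := fun τ hτ => h.vertex τ ⟨hsub hτ.1, hτ.2⟩

/-- Boxes can be shrunk so that their delay vectors stay in a compact part of the polyhedron: the
polyhedron is locally closed. -/
theorem exists_isCompact (h : A.IsBox s e n O f q) : ∃ (O' Z : Set (Fin n → ℝ)),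
    A.IsBox s e n O' f q ∧ IsCompact Z ∧ O' ∩ A.poly s e n ⊆ Z ∧ Z ⊆ O ∩ A.poly s e n := by
  obtain ⟨τ, hτO, hτp⟩ := h.nonempty
  obtain ⟨U, V, hU, hV, hUV⟩ := isLocallyClosed_poly (A := A) (s := s) (e := e) (n := n)
  have hτU : τ ∈ U := by rw [hUV] at hτp; exact hτp.1
  obtain ⟨ε, hε, hball⟩ := Metric.nhds_basis_closedBall.mem_iff.1
    ((h.isOpen.inter hU).mem_nhds ⟨hτO, hτU⟩)
  have hZ : Metric.closedBall τ ε ∩ A.poly s e n = Metric.closedBall τ ε ∩ V := by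
    rw [hUV, ← Set.inter_assoc, Set.inter_eq_left.2 (hball.trans Set.inter_subset_right)]
  refine ⟨Metric.ball τ ε, Metric.closedBall τ ε ∩ A.poly s e n,
    h.mono Metric.isOpen_ball (Metric.ball_subset_closedBall.trans
      (hball.trans Set.inter_subset_left)) ⟨τ, Metric.mem_ball_self hε, hτp⟩, ?_,
    Set.inter_subset_inter_left _ Metric.ball_subset_closedBall,
    Set.inter_subset_inter_left _ (hball.trans Set.inter_subset_left)⟩
  rw [hZ]
  exact (isCompact_closedBall τ ε).inter_right hV

variable [Finite X] [Finite L] [Finite E]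

/-- A box can be continued to every vertex that is reachable from its final vertex. -/
theorem exists_reach (hs : A.IsState s) (h : A.IsBox s e n O f q) {q' : L × Set (X → ℝ)}
    (hq : A.Reach q q') : ∃ (e' : ℕ → E) (m : ℕ) (O' : Set (Fin m → ℝ)) (f' : ℕ → REdge L X E),
      n ≤ m ∧ A.IsBox s e' m O' f' q' ∧ A.cylinder s e' m O' ⊆ A.cylinder s e n O := by
  induction hq with
  | refl => exact ⟨e, n, O, f, le_rfl, h, subset_rfl⟩
  | tail _ hstep ih =>
    obtain ⟨e', m, O', f', hm, hbox, hsub⟩ := ih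
    obtain ⟨g, hg, hsrc, rfl⟩ := hstep
    obtain ⟨O'', hbox', hinit⟩ := hbox.exists_succ hs hg hsrc
    refine ⟨_, _, O'', _, hm.trans m.le_succ, hbox', Set.Subset.trans (fun ρ hρ => ?_) hsub⟩
    rw [mem_cylinder] at hρ ⊢
    refine ⟨fun i hi => ?_, hinit _ hρ.2⟩
    rw [hρ.1 i (hi.trans m.lt_succ_self), Function.update_of_ne hi.ne]

theorem exists_thickEdge (hA : A.NonBlocking) (hs : A.IsState s) (h : A.IsBox s e n O f q) :
    ∃ g, A.IsThickEdge g ∧ g.src = q := by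
  obtain ⟨τ, hτ⟩ := h.nonempty
  rw [← h.vertex τ hτ]
  exact exists_isThickEdge hA (Valid.isState hτ.2 hs)

/-- Boxes can be continued to any length, because every state has a thick edge. -/
theorem exists_length_ge (hA : A.NonBlocking) (hs : A.IsState s) (h : A.IsBox s e n O f q)
    (N : ℕ) : ∃ (e' : ℕ → E) (m : ℕ) (O' : Set (Fin m → ℝ)) (f' : ℕ → REdge L X E)
      (q' : L × Set (X → ℝ)), N ≤ m ∧ A.IsBox s e' m O' f' q' ∧
        A.cylinder s e' m O' ⊆ A.cylinder s e n O := by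
  induction N with
  | zero => exact ⟨e, n, O, f, q, Nat.zero_le _, h, subset_rfl⟩
  | succ N ih =>
    obtain ⟨e', m, O', f', q', hm, hbox, hsub⟩ := ih
    obtain ⟨g, hg, hsrc⟩ := hbox.exists_thickEdge hA hs
    obtain ⟨O'', hbox', hinit⟩ := hbox.exists_succ hs hg hsrc
    refine ⟨_, _, O'', _, _, Nat.succ_le_succ hm, hbox', Set.Subset.trans (fun ρ hρ => ?_) hsub⟩
    rw [mem_cylinder] at hρ ⊢
    refine ⟨fun i hi => ?_, hinit _ hρ.2⟩
    rw [hρ.1 i (hi.trans m.lt_succ_self), Function.update_of_ne hi.ne]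

end TimedAutomaton.IsBox

variable [Finite X] [Finite L] [Finite E]

theorem TimedAutomaton.exists_isBox_subset (hs : A.IsState s) {U : Set (A.Run s)} (hU : IsOpen U)
    (hne : U.Nonempty) : ∃ (e : ℕ → E) (n : ℕ) (O : Set (Fin n → ℝ)) (f : ℕ → REdge L X E)
      (q : L × Set (X → ℝ)), A.IsBox s e n O f q ∧ A.cylinder s e n O ⊆ U := by
  obtain ⟨ρ, hρ⟩ := hne
  obtain ⟨n, O, hO, ht, hρO, hsub⟩ := exists_cylinder_subset hU hρ
  obtain ⟨O', f, q, hO', hbox⟩ := ht.exists_isBox hs hO ⟨_, mem_inter_poly hρO⟩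
  exact ⟨ρ.edge, n, O', f, q, hbox, (cylinder_mono (Set.inter_subset_left.trans hO')).trans hsub⟩

/-- The space of runs is a Baire space. -/
theorem TimedAutomaton.baireSpace_run (hA : A.NonBlocking) (hs : A.IsState s) :
    BaireSpace (A.Run s) := by
  refine ⟨fun U hUo hUd => dense_iff_inter_open.2 fun V hV hVne => ?_⟩
  -- cylinders of boxes with compact constraints
  let T : Type _ := {p : (ℕ → E) × (Σ n : ℕ, Set (Fin n → ℝ)) // IsCompact p.2.2 ∧
    p.2.2 ⊆ A.poly s p.1 p.2.1 ∧ ∃ O f q, A.IsBox s p.1 p.2.1 O f q ∧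
      O ∩ A.poly s p.1 p.2.1 ⊆ p.2.2}
  let cy : T → Set (A.Run s) := fun p => A.cylinder s p.1.1 p.1.2.1 p.1.2.2
  have hbase : ∀ (N : ℕ) (W : Set (A.Run s)), IsOpen W → W.Nonempty →
      ∃ p : T, N ≤ p.1.2.1 ∧ cy p ⊆ W := by
    intro N W hW hWne
    obtain ⟨e, n, O, f, q, hbox, hsub⟩ := exists_isBox_subset hs hW hWne
    obtain ⟨e', m, O', f', q', hm, hbox', hsub'⟩ := hbox.exists_length_ge hA hs N
    obtain ⟨O'', Z, hbox'', hZ, hOZ, hZO⟩ := hbox'.exists_isCompact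
    refine ⟨⟨⟨e', m, Z⟩, hZ, hZO.trans Set.inter_subset_right, O'', f', q', hbox'', hOZ⟩, hm, ?_⟩
    exact (cylinder_mono (Set.inter_subset_left.trans
      (hZO.trans Set.inter_subset_left))).trans (hsub'.trans hsub)
  have hstep : ∀ (k : ℕ) (p : T), ∃ p' : T, k + 1 ≤ p'.1.2.1 ∧ cy p' ⊆ cy p ∩ U k := by
    rintro k ⟨⟨e, n, Z⟩, hZ, hZp, O, f, q, hbox, hOZ⟩
    obtain ⟨p', h1, h2⟩ := hbase (k + 1) (A.cylinder s e n O ∩ U k)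
      (hbox.isOpen_cylinder.inter (hUo k))
      ((hUd k).inter_open_nonempty _ hbox.isOpen_cylinder (hbox.cylinder_nonempty hA hs))
    exact ⟨p', h1, h2.trans (Set.inter_subset_inter_left _ (cylinder_mono hOZ))⟩
  choose next hnext1 hnext2 using hstep
  obtain ⟨p0, -, hp0⟩ := hbase 0 V hV hVne
  let b : ℕ → T := fun k => Nat.rec p0 next k
  have hb : ∀ k, b (k + 1) = next k (b k) := fun k => rfl
  have hb1 : ∀ k, k ≤ (b k).1.2.1 := by
    intro k
    cases k with
    | zero => exact Nat.zero_le _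
    | succ k => rw [hb]; exact hnext1 k (b k)
  obtain ⟨ρ, hρ⟩ := nonempty_iInter_cylinder (A := A) (s := s) (e := fun k => (b k).1.1)
    (n := fun k => (b k).1.2.1) (Z := fun k => (b k).1.2.2) hb1 (fun k => (b k).2.1)
    (fun k => (b k).2.2.1) (fun k => by
      obtain ⟨O, f, q, hbox, hOZ⟩ := (b k).2.2.2
      exact (hbox.cylinder_nonempty hA hs).mono (cylinder_mono hOZ))
    (antitone_nat_of_succ_le fun k => (hnext2 k (b k)).trans Set.inter_subset_left)
  rw [Set.mem_iInter] at hρ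
  refine ⟨ρ, hp0 (hρ 0), Set.mem_iInter.2 fun k => ?_⟩
  exact (hnext2 k (b k) (hρ (k + 1))).2

/-- To see that a property holds on a residual set of runs, it suffices to find in the cylinder of
every box the cylinder of another box on which the property holds. -/
theorem TimedAutomaton.eventually_residual_of_isBox (hA : A.NonBlocking) (hs : A.IsState s)
    {p : A.Run s → Prop}
    (h : ∀ (e : ℕ → E) (n : ℕ) (O : Set (Fin n → ℝ)) (f : ℕ → REdge L X E)
      (q : L × Set (X → ℝ)), A.IsBox s e n O f q →
      ∃ (e' : ℕ → E) (m : ℕ) (O' : Set (Fin m → ℝ)) (f' : ℕ → REdge L X E)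
        (q' : L × Set (X → ℝ)), A.IsBox s e' m O' f' q' ∧
        A.cylinder s e' m O' ⊆ A.cylinder s e n O ∧ ∀ ρ ∈ A.cylinder s e' m O', p ρ) :
    ∀ᶠ ρ in residual (A.Run s), p ρ := by
  let W : Set (A.Run s) := interior {ρ | p ρ}
  have hWd : Dense W := by
    refine dense_iff_inter_open.2 fun V hV hVne => ?_
    obtain ⟨e, n, O, f, q, hbox, hsub⟩ := exists_isBox_subset hs hV hVne
    obtain ⟨e', m, O', f', q', hbox', hsub', hp⟩ := h e n O f q hbox
    obtain ⟨ρ, hρ⟩ := hbox'.cylinder_nonempty hA hs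
    exact ⟨ρ, hsub (hsub' hρ), mem_interior.2 ⟨_, hp, hbox'.isOpen_cylinder, hρ⟩⟩
  exact mem_of_superset (residual_of_dense_open isOpen_interior hWd) interior_subset

/-- Topologically, almost all runs are fair paths of the thick graph. -/
theorem TimedAutomaton.eventually_residual_thick_fair (hA : A.NonBlocking) (hs : A.IsState s) :
    ∀ᶠ ρ in residual (A.Run s), A.ThickRun ρ ∧ A.Fair ρ := by
  have h1 : ∀ᶠ ρ in residual (A.Run s), A.ThickRun ρ := by
    refine eventually_countable_forall.2 fun N =>
      eventually_residual_of_isBox hA hs fun e n O f q hbox => ?_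
    obtain ⟨e', m, O', f', q', hm, hbox', hsub⟩ := hbox.exists_length_ge hA hs (N + 1)
    refine ⟨e', m, O', f', q', hbox', hsub, fun ρ hρ => ?_⟩
    rw [hbox'.redgeOf_eq hρ hm]
    exact hbox'.thickEdge N hm
  -- from some time on the source of `g` is out of reach, or `g` is taken after time `N`
  have h2 : ∀ᶠ ρ in residual (A.Run s), ∀ g ∈ {g : REdge L X E | A.IsREdge g}, ∀ N : ℕ,
      A.IsThickEdge g → (∃ i ≥ N, A.redgeOf ρ i = g) ∨
        ∃ m, ¬ A.Reach (A.vertexOf (ρ.state m)) g.src := by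
    refine (eventually_countable_ball A.finite_isREdge.countable).2 fun g _ =>
      eventually_countable_forall.2 fun N =>
      eventually_residual_of_isBox hA hs fun e n O f q hbox => ?_
    obtain ⟨e₁, m₁, O₁, f₁, q₁, hm₁, hbox₁, hsub₁⟩ := hbox.exists_length_ge hA hs N
    by_cases hg : A.IsThickEdge g
    · by_cases hr : A.Reach q₁ g.src
      · obtain ⟨e₂, m₂, O₂, f₂, hm₂, hbox₂, hsub₂⟩ := hbox₁.exists_reach hs hr
        obtain ⟨O₃, hbox₃, hinit⟩ := hbox₂.exists_succ hs hg rfl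
        refine ⟨_, _, O₃, _, _, hbox₃, Set.Subset.trans (fun ρ hρ => ?_) (hsub₂.trans hsub₁),
          fun ρ hρ _ => Or.inl ⟨m₂, hm₁.trans hm₂, ?_⟩⟩
        · rw [mem_cylinder] at hρ ⊢
          refine ⟨fun i hi => ?_, hinit _ hρ.2⟩
          rw [hρ.1 i (hi.trans m₂.lt_succ_self), Function.update_of_ne hi.ne]
        · rw [hbox₃.redgeOf_eq hρ m₂.lt_succ_self, Function.update_self]
      · refine ⟨e₁, m₁, O₁, f₁, q₁, hbox₁, hsub₁, fun ρ hρ _ => Or.inr ⟨m₁, ?_⟩⟩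
        rwa [hbox₁.vertexOf_eq hρ]
    · exact ⟨e, n, O, f, q, hbox, subset_rfl, fun _ _ h => absurd h hg⟩
  filter_upwards [h1, h2] with ρ hρ1 hρ2
  refine ⟨hρ1, fun g hg hio => frequently_atTop.2 fun N => ?_⟩
  rcases hρ2 g hg.1 N hg with h | ⟨m, hm⟩
  · exact h
  · obtain ⟨j, hmj, hj⟩ := frequently_atTop.1 hio m
    refine absurd ?_ hm
    rw [← hj]
    exact reach_of_le (f := A.redgeOf ρ) (fun i => ⟨hρ1 i, rfl⟩) hmj

/-- The runs through a vertex that is reachable in the thick graph form a set that is not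
meagre. -/
theorem TimedAutomaton.frequently_residual_vertexOf (hA : A.NonBlocking) (hs : A.IsState s)
    {q : L × Set (X → ℝ)} (hq : A.Reach (A.vertexOf s) q) :
    ∃ᶠ ρ in residual (A.Run s), ∃ n, A.vertexOf (ρ.state n) = q := by
  have := baireSpace_run hA hs
  obtain ⟨t, ht⟩ := hA s hs
  obtain ⟨e₀, -⟩ := Set.mem_iUnion.1 ht
  have hbox : A.IsBox s (fun _ => e₀) 0 Set.univ (fun _ => A.redge s t e₀) (A.vertexOf s) :=
    { isOpen := isOpen_univ
      nonempty := ⟨Fin.elim0, trivial, fun i hi => absurd hi (Nat.not_lt_zero i)⟩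
      thickSet := fun i hi => absurd hi (Nat.not_lt_zero i)
      redge := fun _ _ i hi => absurd hi (Nat.not_lt_zero i)
      thickEdge := fun i hi => absurd hi (Nat.not_lt_zero i)
      vertex := fun _ _ => rfl }
  obtain ⟨e, m, O, f, -, hbox', -⟩ := hbox.exists_reach hs hq
  intro hcon
  obtain ⟨ρ, h1, h2⟩ := (dense_of_mem_residual hcon).inter_open_nonempty _ hbox'.isOpen_cylinder
    (hbox'.cylinder_nonempty hA hs)
  exact h2 ⟨m, hbox'.vertexOf_eq h1⟩

theorem TimedAutomaton.largelySat_iff_condS (hA : A.NonBlocking) (hs : A.IsState s)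
    {P : Set (ℕ → Set AP)} (hP : PrefixIndependent P) : A.LargelySat s P ↔ A.CondS s P := by
  rw [← eventually_sem_iff_condS hP (residual (A.Run s)) (eventually_residual_thick_fair hA hs)
    fun q hq => frequently_residual_vertexOf hA hs hq, LargelySat, IsMeagre, compl_compl]
  rfl

end RunTopology

/-! ### Measurability and probability of paths -/

theorem measurableSet_frequently {α : Type*} [MeasurableSpace α] {p : ℕ → α → Prop}
    (hp : ∀ i, MeasurableSet {a | p i a}) : MeasurableSet {a | ∃ᶠ i in atTop, p i a} := by
  simp only [frequently_atTop]
  rw [Set.ofPred_forall]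
  refine MeasurableSet.iInter fun n => ?_
  have : {a | ∃ i ≥ n, p i a} = ⋃ i ∈ {i | n ≤ i}, {a | p i a} := by
    ext a; simp
  rw [this]
  exact MeasurableSet.biUnion (Set.to_countable _) fun i _ => hp i

section RunMeasurability

variable {AP L X E : Type*} {A : TimedAutomaton AP L X E} {s : L × (X → ℝ)}

/-- The delay vectors of length `n` all of whose steps satisfy given predicates. -/
def TimedAutomaton.pathSet (A : TimedAutomaton AP L X E) (D : ℕ → L × (X → ℝ) → ℝ → E → Prop)
    (n : ℕ) (s : L × (X → ℝ)) (e : ℕ → E) : Set (Fin n → ℝ) :=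
  {τ | ∀ i < n, D i (A.trace s e (extend τ) i) (extend τ i) (e i)}

theorem TimedAutomaton.mem_pathSet_iff {D : ℕ → L × (X → ℝ) → ℝ → E → Prop} {n : ℕ} {e : ℕ → E}
    {ρ : A.Run s} (he : ∀ i < n, ρ.edge i = e i) :
    (fun i : Fin n => ρ.delay i) ∈ A.pathSet D n s e ↔
      ∀ i < n, D i (ρ.state i) (ρ.delay i) (ρ.edge i) := by
  refine forall₂_congr fun i hi => ?_
  rw [ρ.trace_eq_state hi.le he, extend_apply _ hi, he i hi]

theorem TimedAutomaton.cons_mem_pathSet_iff {D : ℕ → L × (X → ℝ) → ℝ → E → Prop} {n : ℕ}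
    {e : ℕ → E} {t : ℝ} {τ : Fin n → ℝ} :
    (Fin.cons t τ : Fin (n + 1) → ℝ) ∈ A.pathSet D (n + 1) s e ↔
      D 0 s t (e 0) ∧ τ ∈ A.pathSet (fun i => D (i + 1)) n (A.post s t (e 0))
        fun i => e (i + 1) := by
  have h0 : extend (Fin.cons t τ : Fin (n + 1) → ℝ) 0 = t := extend_apply _ n.succ_pos
  have h1 : ∀ i, extend (Fin.cons t τ : Fin (n + 1) → ℝ) (i + 1) = extend τ i := by
    intro i
    unfold extend
    by_cases hi : i < n
    · rw [dif_pos hi, dif_pos (Nat.succ_lt_succ hi)]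
      rfl
    · rw [dif_neg hi, dif_neg fun h => hi (Nat.lt_of_succ_lt_succ h)]
  have h2 : ∀ i, A.trace s e (extend (Fin.cons t τ : Fin (n + 1) → ℝ)) (i + 1) =
      A.trace (A.post s t (e 0)) (fun i => e (i + 1)) (extend τ) i := by
    intro i
    rw [trace_cons, h0]
    exact trace_congr (fun _ _ => rfl) fun j _ => h1 j
  constructor
  · intro h
    refine ⟨?_, fun i hi => ?_⟩
    · have := h 0 n.succ_pos
      rwa [h0] at this
    · have := h (i + 1) (Nat.succ_lt_succ hi)
      rwa [h1, h2] at this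
  · rintro ⟨h, h'⟩ i hi
    cases i with
    | zero => rw [h0]; exact h
    | succ i => rw [h1, h2]; exact h' i (Nat.lt_of_succ_lt_succ hi)

/-- Reachability in the thick graph, in terms of a sequence of edges `f` and one of vertices `v`. -/
theorem TimedAutomaton.Reach.exists_path {q q' : L × Set (X → ℝ)}
    [Nonempty E] (h : A.Reach q q') :
    ∃ (n : ℕ) (f : ℕ → REdge L X E) (v : ℕ → L × Set (X → ℝ)), v 0 = q ∧ v n = q' ∧
      ∀ i < n, A.IsThickEdge (f i) ∧ (f i).src = v i ∧ (f i).tgt = v (i + 1) := by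
  induction h using Relation.ReflTransGen.head_induction_on with
  | refl =>
    exact ⟨0, fun _ => ⟨q', ∅, Classical.arbitrary E, q'⟩, fun _ => q', rfl, rfl,
      fun i hi => absurd hi (Nat.not_lt_zero i)⟩
  | @head a _ hstep _ ih =>
    obtain ⟨g, hg, hsrc, htgt⟩ := hstep
    obtain ⟨n, f, v, h0, hn, hf⟩ := ih
    refine ⟨n + 1, fun i => Nat.casesOn i g f, fun i => Nat.casesOn i a v, rfl, hn,
      fun i hi => ?_⟩
    cases i with
    | zero => exact ⟨hg, hsrc, htgt.trans h0.symm⟩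
    | succ i => exact hf i (Nat.lt_of_succ_lt_succ hi)

variable [Finite E]

theorem TimedAutomaton.measurable_delay (i : ℕ) : Measurable fun ρ : A.Run s => ρ.delay i := by
  intro B hB
  have : (fun ρ : A.Run s => ρ.delay i) ⁻¹' B =
      ⋃ e : Fin (i + 1) → E, A.cyl s e {τ | τ (Fin.last i) ∈ B} := by
    ext ρ
    simp only [Set.mem_preimage, Set.mem_iUnion]
    exact ⟨fun h => ⟨fun j => ρ.edge j, fun _ => rfl, h⟩, fun ⟨_, _, h⟩ => h⟩
  rw [this]
  exact MeasurableSet.iUnion fun e =>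
    A.measurableSet_cyl s e (measurable_pi_apply (Fin.last i) hB)

variable [MeasurableSpace E]

theorem TimedAutomaton.measurable_edge (i : ℕ) : Measurable fun ρ : A.Run s => ρ.edge i := by
  refine measurable_to_countable' fun e₀ => ?_
  have : (fun ρ : A.Run s => ρ.edge i) ⁻¹' {e₀} =
      ⋃ e ∈ {e : Fin (i + 1) → E | e (Fin.last i) = e₀}, A.cyl s e Set.univ := by
    ext ρ
    simp only [Set.mem_preimage, Set.mem_singleton_iff, Set.mem_iUnion]
    constructor
    · rintro h
      exact ⟨fun j => ρ.edge j, h, fun _ => rfl, trivial⟩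
    · rintro ⟨e, h, h1, -⟩
      exact (h1 (Fin.last i)).trans h
  rw [this]
  exact MeasurableSet.biUnion (Set.to_countable _) fun e _ =>
    A.measurableSet_cyl s e MeasurableSet.univ

variable [Finite L] [Finite X] [MeasurableSpace L] [DiscreteMeasurableSpace L]
  [DiscreteMeasurableSpace E]

theorem TimedAutomaton.measurable_state (i : ℕ) : Measurable fun ρ : A.Run s => ρ.state i := by
  induction i with
  | zero =>
    have : (fun ρ : A.Run s => ρ.state 0) = fun _ => s := funext fun ρ => ρ.start
    rw [this]
    exact measurable_const
  | succ i ih =>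
    simp only [Run.state_succ]
    exact A.measurable_post ih (measurable_delay i) (measurable_edge i)

/-- The triples of a state, a delay and an edge that follow the region edge `f`. -/
def TimedAutomaton.followStep (A : TimedAutomaton AP L X E) (f : REdge L X E) (s : L × (X → ℝ))
    (t : ℝ) (e : E) : Prop := t ∈ A.edgeDelays s e ∧ A.redge s t e = f

theorem TimedAutomaton.measurableSet_followStep (f : REdge L X E) :
    MeasurableSet {p : (L × (X → ℝ)) × ℝ × E | A.followStep f p.1 p.2.1 p.2.2} := by
  by_cases hf : A.IsREdge f
  · have hd := A.measurableSet_edgeDelays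
      (measurable_fst : Measurable fun p : (L × (X → ℝ)) × ℝ × E => p.1)
      (measurable_fst.comp measurable_snd) (measurable_snd.comp measurable_snd)
    have h1 : MeasurableSet {p : (L × (X → ℝ)) × ℝ × E | p.1.1 = f.src.1} :=
      (measurable_fst.comp measurable_fst) (MeasurableSet.of_discrete (s := {f.src.1}))
    have h2 : MeasurableSet {p : (L × (X → ℝ)) × ℝ × E | p.1.2 ∈ f.src.2} :=
      (measurable_snd.comp measurable_fst) (measurableSet_region hf.1)
    have h3 : MeasurableSet {p : (L × (X → ℝ)) × ℝ × E | shift p.1.2 p.2.1 ∈ f.mid} :=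
      (measurable_shift (measurable_snd.comp measurable_fst) (measurable_fst.comp measurable_snd))
        (measurableSet_region hf.2.1)
    have h4 : MeasurableSet {p : (L × (X → ℝ)) × ℝ × E | p.2.2 = f.edge} :=
      (measurable_snd.comp measurable_snd) (MeasurableSet.of_discrete (s := {f.edge}))
    have := hd.inter (h1.inter (h2.inter (h3.inter h4)))
    refine (congrArg MeasurableSet (Set.ext fun p => ⟨?_, ?_⟩)).mp this
    · rintro ⟨k0, k1, k2, k3, k4⟩
      obtain ⟨s, t, e⟩ := p
      obtain rfl : e = f.edge := k4
      have k5 := (mem_region_iff hf.1).1 k2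
      exact ⟨k0, (hf.step_of_shift_mem k5.1 (Prod.ext k1 k5.2) (delay_nonneg k0) k3).2⟩
    · rintro ⟨k0, rfl⟩
      have k1 := nonneg_of_mem k0
      exact ⟨k0, rfl, mem_regionOf k1, mem_regionOf (shift_nonneg k1 (delay_nonneg k0)), rfl⟩
  · convert MeasurableSet.empty
    ext p
    exact iff_of_false (fun h => hf (h.2 ▸ isREdge_redge h.1)) (Set.notMem_empty _)

/-- The triples of a state, a delay and an edge that follow a thin region edge. -/
def TimedAutomaton.thinStep (A : TimedAutomaton AP L X E) (s : L × (X → ℝ)) (t : ℝ) (e : E) :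
    Prop := t ∈ A.edgeDelays s e ∧ ¬ A.IsThickEdge (A.redge s t e)

theorem TimedAutomaton.measurableSet_thinStep :
    MeasurableSet {p : (L × (X → ℝ)) × ℝ × E | A.thinStep p.1 p.2.1 p.2.2} := by
  have : {p : (L × (X → ℝ)) × ℝ × E | A.thinStep p.1 p.2.1 p.2.2} =
      ⋃ f ∈ {f : REdge L X E | A.IsREdge f ∧ ¬ A.IsThickEdge f},
        {p | A.followStep f p.1 p.2.1 p.2.2} := by
    ext p
    simp only [Set.mem_iUnion]
    constructor
    · rintro ⟨h1, h2⟩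
      exact ⟨_, ⟨isREdge_redge h1, h2⟩, h1, rfl⟩
    · rintro ⟨f, hf, h1, rfl⟩
      exact ⟨h1, hf.2⟩
  rw [this]
  exact MeasurableSet.biUnion (A.finite_isREdge.subset fun f hf => hf.1).countable fun f _ =>
    measurableSet_followStep f

theorem TimedAutomaton.measurableSet_redgeOf (f : REdge L X E) (i : ℕ) :
    MeasurableSet {ρ : A.Run s | A.redgeOf ρ i = f} := by
  have h1 : Measurable fun ρ : A.Run s => (ρ.state i, ρ.delay i, ρ.edge i) :=
    (measurable_state i).prodMk ((measurable_delay i).prodMk (measurable_edge i))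
  have h2 := h1 (measurableSet_followStep (A := A) f)
  refine (congrArg MeasurableSet (Set.ext fun ρ => ?_)).mp h2
  simp only [Set.mem_preimage, Set.mem_ofPred_eq, followStep, redgeOf_eq, ρ.delay_mem i, true_and]

theorem TimedAutomaton.measurableSet_vertexOf {q : L × Set (X → ℝ)} (hq : q.2 ∈ A.regions) (i : ℕ) :
    MeasurableSet {ρ : A.Run s | A.vertexOf (ρ.state i) = q} := by
  have h1 := (measurable_state (A := A) (s := s) i)
    ((measurable_fst (MeasurableSet.of_discrete (s := {q.1}))).inter
      (measurable_snd (measurableSet_region hq)))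
  refine (congrArg MeasurableSet (Set.ext fun ρ => ?_)).mp h1
  simp only [Set.mem_preimage, Set.mem_inter_iff, Set.mem_singleton_iff, mem_region_iff hq,
    Set.mem_ofPred_eq, Prod.ext_iff, vertexOf, (ρ.isState i).1, implies_true, true_and]

theorem TimedAutomaton.measurableSet_fair : MeasurableSet {ρ : A.Run s | A.Fair ρ} := by
  have : {ρ : A.Run s | A.Fair ρ} = ⋂ f ∈ {f | A.IsThickEdge f},
      {ρ : A.Run s | (∃ᶠ i in atTop, A.vertexOf (ρ.state i) = f.src) →
        ∃ᶠ i in atTop, A.redgeOf ρ i = f} := by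
    ext ρ; simp [Fair]
  rw [this]
  refine MeasurableSet.biInter (A.finite_isREdge.subset fun f hf => hf.1).countable fun f hf => ?_
  exact (measurableSet_frequently fun i => measurableSet_vertexOf hf.1.1 i).imp
    (measurableSet_frequently fun i => measurableSet_redgeOf f i)

/-- A prefix-independent property is measurable: it is determined by which of finitely many letters
occur infinitely often. -/
theorem TimedAutomaton.measurableSet_sem [Finite AP] {P : Set (ℕ → Set AP)}
    (hP : PrefixIndependent P) : MeasurableSet (A.sem s P) := by
  have hlet : ∀ a, MeasurableSet {ρ : A.Run s | a ∈ infLetters (A.word ρ)} := by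
    intro a
    refine measurableSet_frequently fun i => ?_
    exact (measurable_fst.comp (measurable_state i))
      (MeasurableSet.of_discrete (s := {ℓ | A.label ℓ = a}))
  have : A.sem s P = ⋃ B ∈ infLetters '' P, ⋂ a,
      {ρ : A.Run s | a ∈ infLetters (A.word ρ) ↔ a ∈ B} := by
    ext ρ
    simp only [Set.mem_iUnion, Set.mem_iInter]
    constructor
    · intro h
      exact ⟨_, ⟨_, h, rfl⟩, fun a => Iff.rfl⟩
    · rintro ⟨_, ⟨w, hw, rfl⟩, h⟩
      exact (hP _ _ (Set.ext h)).2 hw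
  rw [this]
  exact MeasurableSet.biUnion (Set.to_countable _) fun B _ => MeasurableSet.iInter fun a =>
    (hlet a).iff (MeasurableSet.const _)

theorem TimedAutomaton.measurable_trace {α : Type*} [MeasurableSpace α] {σ : α → L × (X → ℝ)}
    {n : ℕ} {τ : α → Fin n → ℝ} (hσ : Measurable σ) (hτ : Measurable τ) (e : ℕ → E) (i : ℕ) :
    Measurable fun a => A.trace (σ a) e (extend (τ a)) i := by
  induction i with
  | zero => exact hσ
  | succ i ih =>
    exact A.measurable_post ih ((contDiff_extend n i).continuous.measurable.comp hτ)
      measurable_const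

theorem TimedAutomaton.measurableSet_pathSet {D : ℕ → L × (X → ℝ) → ℝ → E → Prop}
    (hD : ∀ i, MeasurableSet {p : (L × (X → ℝ)) × ℝ × E | D i p.1 p.2.1 p.2.2})
    {α : Type*} [MeasurableSpace α] {σ : α → L × (X → ℝ)}
    {n : ℕ} {τ : α → Fin n → ℝ} (hσ : Measurable σ) (hτ : Measurable τ) (e : ℕ → E) :
    MeasurableSet {a | τ a ∈ A.pathSet D n (σ a) e} := by
  have : {a | τ a ∈ A.pathSet D n (σ a) e} = ⋂ i ∈ {i | i < n},
      {a | D i (A.trace (σ a) e (extend (τ a)) i) (extend (τ a) i) (e i)} := by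
    ext a; simp [pathSet]
  rw [this]
  refine MeasurableSet.biInter (Set.to_countable _) fun i _ => ?_
  have h1 : Measurable fun a => (A.trace (σ a) e (extend (τ a)) i, extend (τ a) i, e i) :=
    (measurable_trace hσ hτ e i).prodMk
      (((contDiff_extend n i).continuous.measurable.comp hτ).prodMk measurable_const)
  exact h1 (hD i)

end RunMeasurability

section Probability

variable {AP L X E : Type*} [Fintype E] {A : StochasticTA AP L X E} {s : L × (X → ℝ)}

theorem StochasticTA.subset_delays (e : E) : A.edgeDelays s e ⊆ A.delays s :=
  Set.subset_iUnion (A.edgeDelays s) e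

theorem StochasticTA.redgeDelays_subset {f : REdge L X E}
    (hv : A.vertexOf s = f.src) : A.redgeDelays s.2 f ⊆ A.edgeDelays s f.edge := by
  rintro t ⟨-, h⟩
  have h1 : f.src.1 = s.1 := congrArg Prod.fst hv.symm
  rw [h1] at h
  exact h

theorem StochasticTA.pathProb_pathSet_succ (D : ℕ → L × (X → ℝ) → ℝ → E → Prop) (n : ℕ)
    (s : L × (X → ℝ)) (e : ℕ → E) :
    A.pathProb (n + 1) s (fun i => e i) (A.pathSet D (n + 1) s e) =
      ∫⁻ t in A.edgeDelays s (e 0), ENNReal.ofReal (A.edgeProb A.weight (s.1, shift s.2 t) (e 0)) *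
        A.pathProb n (A.post s t (e 0)) (fun i => e (i + 1))
          {τ | D 0 s t (e 0) ∧ τ ∈ A.pathSet (fun i => D (i + 1)) n (A.post s t (e 0))
            fun i => e (i + 1)} ∂(A.delay s.1 s.2) := by
  rw [StochasticTA.pathProb]
  simp only [TimedAutomaton.cons_mem_pathSet_iff]
  rfl

theorem StochasticTA.pathProb_empty {n : ℕ} {s : L × (X → ℝ)} {e : Fin n → E} :
    A.pathProb n s e ∅ = 0 := by
  induction n generalizing s with
  | zero => simp [StochasticTA.pathProb]
  | succ n ih => simp [StochasticTA.pathProb, ih]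

theorem StochasticTA.edgeProb_pos {t : ℝ} {e : E} (ht : t ∈ A.edgeDelays s e) :
    0 < A.edgeProb A.weight (s.1, shift s.2 t) e := by
  classical
  have h0 := (A.zero_mem_edgeDelays (subset_delays e ht) e).2 ht
  unfold TimedAutomaton.edgeProb
  rw [if_pos h0]
  refine div_pos (A.weight_pos e) (Finset.sum_pos (fun e _ => A.weight_pos e) ⟨e, ?_⟩)
  simpa using h0

variable [Finite L] [Finite X]

theorem StochasticTA.prob_cyl (hs : A.IsState s) {n : ℕ} (e : Fin n → E) {C : Set (Fin n → ℝ)}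
    (hC : MeasurableSet C) : A.prob s hs (A.cyl s e C) = A.pathProb n s e C :=
  (A.existsUnique_runMeasure s hs).choose_spec.1 n e C hC

instance StochasticTA.isProbabilityMeasure_prob (hs : A.IsState s) :
    IsProbabilityMeasure (A.prob s hs) := by
  refine ⟨?_⟩
  have h := prob_cyl hs (Fin.elim0 : Fin 0 → E) (MeasurableSet.univ (α := Fin 0 → ℝ))
  have h1 : A.cyl s (Fin.elim0 : Fin 0 → E) Set.univ = Set.univ := by
    ext ρ; simp [TimedAutomaton.cyl]
  rw [h1] at h
  rw [h]
  simp [StochasticTA.pathProb]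

theorem StochasticTA.volume_delays_pos {f : REdge L X E} (hf : A.IsREdge f)
    (hl : A.LooseEdge f) (hs : A.IsState s) (hv : A.vertexOf s = f.src) :
    0 < volume (A.delays s) := by
  obtain ⟨a, b, hab, h⟩ := hl.exists_Ico_subset hf hs.1 hv
  refine lt_of_lt_of_le ?_ (measure_mono (h.trans ((redgeDelays_subset hv).trans
    (subset_delays f.edge))))
  rw [Real.volume_Ico]
  exact ENNReal.ofReal_pos.2 (sub_pos.2 hab)

/-- A thick region edge is taken with positive probability from every state in its source. -/
theorem StochasticTA.delay_redgeDelays_ne_zero {f : REdge L X E} (hf : A.IsThickEdge f)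
    (hs : A.IsState s) (hv : A.vertexOf s = f.src) :
    A.delay s.1 s.2 (A.redgeDelays s.2 f) ≠ 0 := by
  intro h0
  rcases (TimedAutomaton.isThickEdge_iff.1 hf).2 with hl | hnl
  · obtain ⟨a, b, hab, h⟩ := hl.exists_Ico_subset hf.1 hs.1 hv
    have h1 := (A.equiv_volume s hs (volume_delays_pos hf.1 hl hs hv)).2
      (measure_mono_null h h0)
    rw [Measure.restrict_apply measurableSet_Ico, Set.inter_eq_left.2 (h.trans
      ((redgeDelays_subset hv).trans (subset_delays f.edge))), Real.volume_Ico,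
      ENNReal.ofReal_eq_zero] at h1
    linarith
  · have hfin : (A.delays s).Finite := Set.finite_iUnion fun e =>
      (TimedAutomaton.edgeDelays_subsingleton
        (fun f' hf' hsrc => hnl f' hf' (hsrc.trans hv)) e).finite
    have h1 := (A.equiv_uniform s hs (hfin.measure_zero volume)).2 h0
    rw [uniformOn_eq_zero_iff hfin] at h1
    obtain ⟨t, ht, htm⟩ := hf.1.exists_delay hs.1 hv
    have h2 := (hf.1.mem_redgeDelays_iff hs.1 hv).2 ⟨ht, htm⟩
    have h3 : t ∈ A.delays s ∩ A.redgeDelays s.2 f :=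
      ⟨subset_delays f.edge (redgeDelays_subset hv h2), h2⟩
    rw [h1] at h3
    exact h3

/-- Thin region edges are taken with probability zero: there are thin edges at `s` only if there are
loose ones, and then the distribution of the delay has no atoms. -/
theorem StochasticTA.ae_isThickEdge (hs : A.IsState s) :
    ∀ᵐ t ∂(A.delay s.1 s.2), ∀ e, t ∈ A.edgeDelays s e → A.IsThickEdge (A.redge s t e) := by
  by_cases hex : ∃ f, A.IsREdge f ∧ f.src = A.vertexOf s ∧ A.LooseEdge f
  · obtain ⟨f, hf, hsrc, hl⟩ := hex
    have hfin : {f : REdge L X E | A.IsREdge f ∧ ¬ A.LooseEdge f}.Finite :=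
      A.finite_isREdge.subset fun f hf => hf.1
    have hB : (⋃ f ∈ {f : REdge L X E | A.IsREdge f ∧ ¬ A.LooseEdge f},
        A.redgeDelays s.2 f).Finite :=
      hfin.biUnion fun f hf => (TimedAutomaton.redgeDelays_subsingleton hf.1 hf.2 s.2).finite
    have h0 := (A.equiv_volume s hs (volume_delays_pos hf hl hs hsrc.symm)).1
      (Measure.absolutelyContinuous_of_le Measure.restrict_le_self
        (hB.measure_zero volume))
    filter_upwards [measure_eq_zero_iff_ae_notMem.1 h0] with t ht e he
    refine TimedAutomaton.isThickEdge_iff.2 ⟨TimedAutomaton.isREdge_redge he, Or.inl ?_⟩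
    by_contra hnl
    exact ht (Set.mem_biUnion (show A.redge s t e ∈ {f : REdge L X E | A.IsREdge f ∧
      ¬ A.LooseEdge f} from ⟨TimedAutomaton.isREdge_redge he, hnl⟩)
      (TimedAutomaton.mem_redgeDelays_redge he))
  · push Not at hex
    exact Eventually.of_forall fun t e he => TimedAutomaton.isThickEdge_iff.2
      ⟨TimedAutomaton.isREdge_redge he, Or.inr hex⟩

variable [MeasurableSpace L] [DiscreteMeasurableSpace L] [MeasurableSpace E]
  [DiscreteMeasurableSpace E]

/-- Path probabilities depend measurably on parameters, because they are the measures of sections of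
a measurable set in the space of random seeds from which runs are drawn. -/
theorem StochasticTA.measurable_pathProb [Nonempty E] {n : ℕ} (e : Fin n → E)
    {C : Set (ℝ × (Fin n → ℝ))} (hC : MeasurableSet C) {σ : ℝ → L × (X → ℝ)} (hσ : Measurable σ) :
    Measurable fun t => A.pathProb n (σ t) e {τ | (t, τ) ∈ C} := by
  obtain ⟨K, hKm, hK⟩ := A.exists_kernel
  obtain ⟨φ, hφ, hφK⟩ := Kernel.exists_measurable_map_eq_unitInterval K
  let P : Measure (ℕ → unitInterval) := Measure.infinitePi fun _ => volume
  have hP := infinitePi_cons P rfl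
  have hfol := A.measure_follows (fun s => (hK s).1) hφ hφK P hP
  have h1 : ∀ t, A.pathProb n (σ t) e {τ | (t, τ) ∈ C} =
      P (A.follows φ (σ t) e {τ | (t, τ) ∈ C}) := fun t =>
    (hfol n (σ t) e _ ((measurable_const.prodMk measurable_id :
      Measurable fun τ : Fin n → ℝ => (t, τ)) hC)).symm
  simp only [h1]
  have h2 : Measurable fun p : ℝ × (L × (X → ℝ)) =>
      P (A.follows φ p.2 e {τ | (p.1, τ) ∈ C}) :=
    measurable_measure_prodMk_left (A.measurableSet_follows hφ e hC)
  exact h2.comp (measurable_id.prodMk hσ)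

/-- The probability of taking a thin region edge at a given step is zero. -/
theorem StochasticTA.pathProb_thinStep (n : ℕ) : ∀ (s : L × (X → ℝ)) (e : ℕ → E), A.IsState s →
    A.pathProb (n + 1) s (fun i => e i)
      (A.pathSet (fun i s t e => i = n → A.thinStep s t e) (n + 1) s e) = 0 := by
  induction n with
  | zero =>
    intro s e hs
    rw [pathProb_pathSet_succ, ← lintegral_zero]
    refine lintegral_congr_ae (ae_restrict_of_ae ?_)
    filter_upwards [ae_isThickEdge hs] with t ht
    have : {τ : Fin 0 → ℝ | (0 = 0 → A.thinStep s t (e 0)) ∧ τ ∈ A.pathSet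
        (fun i s t e => i + 1 = 0 → A.thinStep s t e) 0 (A.post s t (e 0)) fun i => e (i + 1)} =
        ∅ := by
      ext τ
      exact iff_of_false (fun h => (h.1 rfl).2 (ht _ (h.1 rfl).1)) (Set.notMem_empty _)
    rw [this, pathProb_empty, mul_zero]
  | succ n ih =>
    intro s e hs
    rw [pathProb_pathSet_succ]
    refine (setLIntegral_congr_fun (A.measurableSet_edgeDelays measurable_const measurable_id
      measurable_const) fun t ht => ?_).trans lintegral_zero
    have h1 := ih (A.post s t (e 0)) (fun i => e (i + 1)) (TimedAutomaton.isState_post ht)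
    have : {τ : Fin (n + 1) → ℝ | (0 = n + 1 → A.thinStep s t (e 0)) ∧ τ ∈ A.pathSet
        (fun i s t e => i + 1 = n + 1 → A.thinStep s t e) (n + 1) (A.post s t (e 0))
          fun i => e (i + 1)} =
        A.pathSet (fun i s t e => i = n → A.thinStep s t e) (n + 1) (A.post s t (e 0))
          fun i => e (i + 1) := by
      ext τ
      simp [TimedAutomaton.pathSet]
    rw [this, h1, mul_zero]

/-- Every path of the thick graph is followed with positive probability. -/
theorem StochasticTA.pathProb_followStep_pos [Nonempty E] (n : ℕ) : ∀ (s : L × (X → ℝ))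
    (f : ℕ → REdge L X E) (v : ℕ → L × Set (X → ℝ)), A.IsState s → A.vertexOf s = v 0 →
    (∀ i < n, A.IsThickEdge (f i) ∧ (f i).src = v i ∧ (f i).tgt = v (i + 1)) →
    A.pathProb n s (fun i => (f i).edge)
      (A.pathSet (fun i => A.followStep (f i)) n s fun i => (f i).edge) ≠ 0 := by
  induction n with
  | zero =>
    intro s f v _ _ _
    have : (Fin.elim0 : Fin 0 → ℝ) ∈
        A.pathSet (fun i => A.followStep (f i)) 0 s fun i => (f i).edge :=
      fun i hi => absurd hi (Nat.not_lt_zero i)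
    rw [StochasticTA.pathProb, Set.indicator_of_mem this]
    exact one_ne_zero
  | succ n ih =>
    intro s f v hs hv hf
    obtain ⟨hf0, hsrc, htgt⟩ := hf 0 n.succ_pos
    have hv0 : A.vertexOf s = (f 0).src := hv.trans hsrc.symm
    have hrec := pathProb_pathSet_succ (A := A) (fun i => A.followStep (f i)) n s
      fun i => (f i).edge
    rw [hrec]
    have hmS : MeasurableSet (A.edgeDelays s (f 0).edge) :=
      A.measurableSet_edgeDelays measurable_const measurable_id measurable_const
    have hpost : Measurable fun t => A.post s t (f 0).edge :=
      A.measurable_post measurable_const measurable_id measurable_const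
    have hC : MeasurableSet {p : ℝ × (Fin n → ℝ) | A.followStep (f 0) s p.1 (f 0).edge ∧
        p.2 ∈ A.pathSet (fun i => A.followStep (f (i + 1))) n (A.post s p.1 (f 0).edge)
          fun i => (f (i + 1)).edge} := by
      refine MeasurableSet.inter ?_ ?_
      · exact (measurable_const.prodMk (measurable_fst.prodMk measurable_const) :
          Measurable fun p : ℝ × (Fin n → ℝ) => (s, p.1, (f 0).edge))
          (TimedAutomaton.measurableSet_followStep (A := A.toTimedAutomaton) (f 0))
      · exact TimedAutomaton.measurableSet_pathSet
          (fun i => TimedAutomaton.measurableSet_followStep (f (i + 1)))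
          (hpost.comp measurable_fst) measurable_snd _
    have hm1 : Measurable fun t => A.edgeProb A.weight (s.1, shift s.2 t) (f 0).edge :=
      A.measurable_edgeProb A.weight _ (measurable_const.prodMk
        (measurable_shift measurable_const measurable_id))
    have hm2 := hm1.ennreal_ofReal.mul
      (measurable_pathProb (A := A) (fun i : Fin n => (f (i + 1)).edge) hC hpost)
    intro h0
    replace h0 := (lintegral_eq_zero_iff hm2).1 h0
    refine delay_redgeDelays_ne_zero hf0 hs hv0 (measure_mono_null ?_
      ((ae_restrict_iff' hmS).1 h0))
    intro t ht
    have hte := redgeDelays_subset hv0 ht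
    have hstep := hf0.1.step_of_shift_mem hs.1 hv0 (TimedAutomaton.delay_nonneg hte) ht.1
    simp only [Set.mem_compl_iff, Set.mem_ofPred_eq, hte, true_implies, Pi.zero_apply,
      Pi.mul_apply, mul_eq_zero, not_or]
    refine ⟨(ENNReal.ofReal_pos.2 (edgeProb_pos hte)).ne', ?_⟩
    have h2 := ih (A.post s t (f 0).edge) (fun i => f (i + 1)) (fun i => v (i + 1))
      (TimedAutomaton.isState_post hte)
      ((congrArg REdge.tgt hstep.2).trans htgt) fun i hi => hf (i + 1) (Nat.succ_lt_succ hi)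
    have h3 : A.followStep (f 0) s t (f 0).edge := ⟨hte, hstep.2⟩
    simp only [h3, true_and]
    exact h2

/-- Almost every run follows the thick graph. -/
theorem StochasticTA.ae_thickRun (hs : A.IsState s) : ∀ᵐ ρ ∂(A.prob s hs), A.ThickRun ρ := by
  refine ae_all_iff.2 fun n => ?_
  -- extension of a finite sequence of edges; the entries from `n + 1` on are irrelevant
  let ext : (Fin (n + 1) → E) → ℕ → E := fun e i => if h : i < n + 1 then e ⟨i, h⟩ else e 0
  have hmeas : ∀ e : ℕ → E, MeasurableSet
      (A.pathSet (fun i s t e => i = n → A.thinStep s t e) (n + 1) s e) := fun e =>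
    TimedAutomaton.measurableSet_pathSet (A := A.toTimedAutomaton)
      (D := fun i s t e => i = n → A.thinStep s t e) (σ := fun _ => s) (τ := fun τ => τ)
      (fun i => (MeasurableSet.const (i = n)).imp TimedAutomaton.measurableSet_thinStep)
      measurable_const measurable_id e
  have hnull : A.prob s hs (⋃ e : Fin (n + 1) → E, A.cylinder s (ext e) (n + 1)
      (A.pathSet (fun i s t e => i = n → A.thinStep s t e) (n + 1) s (ext e))) = 0 := by
    refine measure_iUnion_null fun e => ?_
    rw [prob_cyl hs _ (hmeas _)]
    exact pathProb_thinStep n s (ext e) hs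
  refine measure_mono_null (fun ρ hρ => ?_) hnull
  have he : ∀ i < n + 1, ρ.edge i = ext (fun j => ρ.edge j) i := fun i hi =>
    (dif_pos (c := i < n + 1) (t := fun _ => ρ.edge i) (e := fun _ => ρ.edge 0) hi).symm
  refine Set.mem_iUnion.2 ⟨fun j => ρ.edge j, TimedAutomaton.mem_cylinder.2 ⟨he, ?_⟩⟩
  rw [TimedAutomaton.mem_pathSet_iff he]
  rintro i - rfl
  refine ⟨ρ.delay_mem i, ?_⟩
  rw [← TimedAutomaton.redgeOf_eq]
  exact hρ

/-- Every vertex that is reachable in the thick graph is reached with positive probability. -/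
theorem StochasticTA.frequently_ae_vertexOf (hs : A.IsState s) {q : L × Set (X → ℝ)}
    (hq : A.Reach (A.vertexOf s) q) :
    ∃ᶠ ρ in ae (A.prob s hs), ∃ n, A.vertexOf (ρ.state n) = q := by
  obtain ⟨t, ht⟩ := A.nonblocking s hs
  have : Nonempty E := ⟨(Set.mem_iUnion.1 ht).choose⟩
  obtain ⟨n, f, v, h0, hn, hf⟩ := hq.exists_path
  have hmeas : MeasurableSet
      (A.pathSet (fun i => A.followStep (f i)) n s fun i => (f i).edge) :=
    TimedAutomaton.measurableSet_pathSet (A := A.toTimedAutomaton)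
      (D := fun i => A.followStep (f i)) (σ := fun _ => s) (τ := fun τ => τ)
      (fun i => TimedAutomaton.measurableSet_followStep (f i)) measurable_const measurable_id _
  have hpos := pathProb_followStep_pos n s f v hs h0.symm hf
  rw [← prob_cyl hs _ hmeas] at hpos
  rw [frequently_ae_iff]
  refine fun h => hpos (measure_mono_null ?_ h)
  intro ρ hρ
  refine ⟨n, ?_⟩
  have hρ' := (TimedAutomaton.mem_cylinder (e := fun i => (f i).edge)).1 hρ
  rw [TimedAutomaton.mem_pathSet_iff hρ'.1] at hρ'
  cases n with
  | zero => rw [ρ.start, ← h0, hn]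
  | succ n =>
    have h1 := congrArg REdge.tgt (hρ'.2 n n.lt_succ_self).2
    rw [← hn, ← (hf n n.lt_succ_self).2.2, ← h1, ρ.state_succ]
    rfl

end Probability

theorem StochasticTA.almostSurelySat_iff_condS {AP L X E : Type*} [Finite AP] [Finite L] [Finite X]
    [Fintype E] {A : StochasticTA AP L X E} {s : L × (X → ℝ)} (hs : A.IsState s)
    {P : Set (ℕ → Set AP)} (hP : PrefixIndependent P) (hfair : A.AlmostSurelyFair s hs) :
    A.AlmostSurelySat s hs P ↔ A.CondS s P := by
  let _ : MeasurableSpace L := ⊤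
  let _ : MeasurableSpace E := ⊤
  have : DiscreteMeasurableSpace L := ⟨fun _ => trivial⟩
  have : DiscreteMeasurableSpace E := ⟨fun _ => trivial⟩
  have hm : MeasurableSet (A.sem s P) := TimedAutomaton.measurableSet_sem hP
  have hf : ∀ᵐ ρ ∂(A.prob s hs), A.Fair ρ :=
    (mem_ae_iff_prob_eq_one TimedAutomaton.measurableSet_fair).2 hfair
  rw [← TimedAutomaton.eventually_sem_iff_condS hP (ae (A.prob s hs))
    ((ae_thickRun hs).and hf) fun q hq => frequently_ae_vertexOf hs hq]
  exact ⟨fun h => (mem_ae_iff_prob_eq_one hm).2 h.2,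
    fun h => ⟨hm, (mem_ae_iff_prob_eq_one hm).1 h⟩⟩

end TimedAut

theorem mainTheorem3 {AP L X E : Type*} [Finite AP] [Finite L] [Finite X] [Fintype E]
    (A : TimedAut.StochasticTA AP L X E) (s : L × (X → ℝ)) (hs : A.IsState s)
    (P : Set (ℕ → Set AP)) (hP : TimedAut.PrefixIndependent P)
    (hfair : A.AlmostSurelyFair s hs) :
    (A.AlmostSurelySat s hs P ↔ A.LargelySat s P) ∧ (A.LargelySat s P ↔ A.CondS s P) := by
  have h1 := TimedAut.StochasticTA.almostSurelySat_iff_condS hs hP hfair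
  have h2 := TimedAut.TimedAutomaton.largelySat_iff_condS A.nonblocking hs hP
  exact ⟨h1.trans h2.symm, h2⟩
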